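/- Let $\rho,k,\gamma:[0,\infty)\to\mathbb R$ be such that $\rho,k\in C^1[0,\infty)$ are positive, $\rho k\in C^2[0,\infty)$ and $(\rho k)'(0)=0$; extend $\rho,k,\gamma$ evenly to $\mathbb R$ (same notation). Put $$\sigma(x)=\int_0^x\sqrt{\rho/k}\,d\xi,\qquad Q_1=\sqrt{\tfrac k\rho}\,\frac{(k\rho)'}{4k\rho},\qquad Q_2=\sqrt{\tfrac k\rho}\,Q_1'+Q_1^2,\qquad q=Q_2-\gamma,$$ and assume $\sigma(x)\to+\infty$ as $x\to+\infty$, $q\in L^\infty(0,\infty)\cap C^1[0,\infty)$ and $\sqrt{\rho/k}\,q\,\sigma\in L^1(0,\infty)$. (All functions and distributions are real-valued.) Let $\mathbb H^0=L^2_\rho(\mathbb R)$ be the space $L^2(\mathbb R,\rho\,dx)$. For $\varphi\in L^2_\rho(\mathbb R)$ let $\mathbb D\varphi=\sqrt{k/\rho}\,\varphi'+Q_1\varphi$, where $\varphi'$ is the distributional derivative. Let $\mathbb H^1=\{\varphi\in L^2_\rho(\mathbb R): \mathbb D\varphi\in L^2_\rho(\mathbb R)\}$ with norm $(\|\varphi\|^2_{L^2_\rho}+\|\mathbb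 D\varphi\|^2_{L^2_\rho})^{1/2}$, let $\mathbb H^{-1}=(\mathbb H^1)^*$ with duality $\langle\langle\cdot,\cdot\rangle\rangle$, and let $\widehat{\mathbb H}^1$, $\widehat{\mathbb H}^{-1}$ be the subspaces of even elements of $\mathbb H^1$, $\mathbb H^{-1}$. A function $f\in\mathbb H^0$ is identified with the functional $\langle\langle f,\varphi\rangle\rangle=\int_{\mathbb R} f\varphi\rho\,dx$ in $\mathbb H^{-1}$; for $f\in\mathbb H^0$ define $\mathbb Df\in\mathbb H^{-1}$ by $\langle\langle\mathbb Df,\varphi\rangle\rangle=-\langle\langle f,\mathbb D\varphi\rangle\rangle$; and $\langle\langle\delta,\varphi\rangle\rangle=\varphi(0)$, where $\varphi\in\mathbb H^1$ is identified with its continuous representative. For $T>0$, $W^0\in\widehat{\mathbb H}^1$ and $u\in L^\infty(0,T)$, a solution of $$W_t=\mathbb D^2W-qW-2\sqrt{(\rho k)(0)}\,u\,\delta\ \text{ on }\mathbb R\times(0,T),\qquad W(\cdot,0)=W^0,\tag{1}$$ is a map $W:[0,T]\to\widehat{\mathbb H}^1$ with $W(0)=W^0$ that is absolutely continuous on $[0,T]$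 as a map into $\mathbb H^{-1}$ and satisfies the equation in $\mathbb H^{-1}$ for almost every $t\in(0,T)$ (so that $W_t(t)\in\widehat{\mathbb H}^{-1}$ for almost every $t$). A state $W^0\in\widehat{\mathbb H}^1$ is controllable to $W^T\in\widehat{\mathbb H}^1$ in time $T>0$ if there is a control $u\in L^\infty(0,T)$ such that (1) has a unique solution $W$ and $W(T)=W^T$. Theorem. If $W^0\in\widehat{\mathbb H}^1$ is controllable to $0$ with respect to system (1) in some time $T>0$, then $W^0=0$. -/

import Mathlib

open MeasureTheory Set Filter
open scoped ENNReal ContDiff Topology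

noncomputable section

namespace HeatControl

/-- The even extension to `ℝ` of a function given on `[0, ∞)`. -/
def evenExt (f : ℝ → ℝ) : ℝ → ℝ := fun x => f |x|

/-- `Q₁(ρ, k) = √(k/ρ) (kρ)' / (4kρ)`. -/
def Q1 (ρ k : ℝ → ℝ) : ℝ → ℝ := fun x =>
  √(k x / ρ x) * deriv (fun y => k y * ρ y) x / (4 * (k x * ρ x))

/-- `Q₂(ρ, k) = √(k/ρ) Q₁' + Q₁²`. -/
def Q2 (ρ k : ℝ → ℝ) : ℝ → ℝ := fun x =>
  √(k x / ρ x) * deriv (Q1 ρ k) x + Q1 ρ k x ^ 2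

/-- `σ(x) = ∫₀ˣ √(ρ/k)`. -/
def sigma (ρ k : ℝ → ℝ) : ℝ → ℝ := fun x => ∫ ξ in (0 : ℝ)..x, √(ρ ξ / k ξ)

/-- `q = Q₂(ρ, k) - γ`. -/
def potential (ρ k γ : ℝ → ℝ) : ℝ → ℝ := fun x => Q2 ρ k x - γ x

/-- The coefficients `ρ, k, γ` of the equation, given on `[0, ∞)`, with the standing
assumptions on them. (Values at negative arguments are never used.) -/
structure HeatData where
  ρ : ℝ → ℝ
  k : ℝ → ℝ
  γ : ℝ → ℝ
  ρ_C1 : ContDiffOn ℝ 1 ρ (Ici 0)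
  k_C1 : ContDiffOn ℝ 1 k (Ici 0)
  ρ_pos : ∀ x, 0 ≤ x → 0 < ρ x
  k_pos : ∀ x, 0 ≤ x → 0 < k x
  ρk_C2 : ContDiffOn ℝ 2 (fun x => ρ x * k x) (Ici 0)
  ρk_deriv_zero : derivWithin (fun x => ρ x * k x) (Ici 0) 0 = 0
  sigma_tendsto : Tendsto (sigma (evenExt ρ) (evenExt k)) atTop atTop
  q_bounded : ∃ C : ℝ, ∀ x, 0 ≤ x → |potential (evenExt ρ) (evenExt k) (evenExt γ) x| ≤ C
  q_C1 : ContDiffOn ℝ 1 (potential (evenExt ρ) (evenExt k) (evenExt γ)) (Ici 0)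
  q_moment : IntegrableOn (fun x => √(evenExt ρ x / evenExt k x) *
    potential (evenExt ρ) (evenExt k) (evenExt γ) x * sigma (evenExt ρ) (evenExt k) x) (Ioi 0)

/-- `g` is the distributional derivative on `ℝ` of `f` (both locally integrable). -/
def IsWeakDeriv (f g : ℝ → ℝ) : Prop :=
  LocallyIntegrable f ∧ LocallyIntegrable g ∧
    ∀ η : ℝ → ℝ, ContDiff ℝ ∞ η → HasCompactSupport η →
      ∫ x, f x * deriv η x = -∫ x, g x * η x

lemma IsWeakDeriv.congr {f g f' g' : ℝ → ℝ} (h : IsWeakDeriv f g)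
    (hf : f =ᵐ[volume] f') (hg : g =ᵐ[volume] g') : IsWeakDeriv f' g' := by
  refine ⟨h.1.congr hf, h.2.1.congr hg, fun η h1 h2 => ?_⟩
  have e1 : ∫ x, f' x * deriv η x = ∫ x, f x * deriv η x :=
    integral_congr_ae (hf.mono fun x hx => by simp only [hx])
  have e2 : ∫ x, g' x * η x = ∫ x, g x * η x :=
    integral_congr_ae (hg.mono fun x hx => by simp only [hx])
  rw [e1, e2]
  exact h.2.2 η h1 h2

lemma intervalIntegrable_of_loc {g : ℝ → ℝ} (hg : LocallyIntegrable g) (a b : ℝ) :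
    IntervalIntegrable g volume a b :=
  (hg.integrableOn_isCompact isCompact_uIcc).intervalIntegrable

lemma integrable_mul_test {f η : ℝ → ℝ} (hf : LocallyIntegrable f) (hη : Continuous η)
    (hc : HasCompactSupport η) : Integrable (fun x => f x * η x) := by
  simpa [mul_comm] using hf.integrable_smul_left_of_hasCompactSupport hη hc

lemma IsWeakDeriv.add {f g f' g' : ℝ → ℝ} (h : IsWeakDeriv f g) (h' : IsWeakDeriv f' g') :
    IsWeakDeriv (fun x => f x + f' x) (fun x => g x + g' x) := by
  refine ⟨h.1.add h'.1, h.2.1.add h'.2.1, fun η h1 h2 => ?_⟩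
  have hd : Continuous (deriv η) := h1.continuous_deriv (by simp)
  simp only [add_mul]
  rw [integral_add (integrable_mul_test h.1 hd h2.deriv) (integrable_mul_test h'.1 hd h2.deriv),
    integral_add (integrable_mul_test h.2.1 h1.continuous h2)
      (integrable_mul_test h'.2.1 h1.continuous h2), h.2.2 η h1 h2, h'.2.2 η h1 h2]
  ring

lemma IsWeakDeriv.const_mul {f g : ℝ → ℝ} (h : IsWeakDeriv f g) (c : ℝ) :
    IsWeakDeriv (fun x => c * f x) (fun x => c * g x) := by
  refine ⟨h.1.smul c, h.2.1.smul c, fun η h1 h2 => ?_⟩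
  simp only [mul_assoc, integral_const_mul]
  rw [h.2.2 η h1 h2]
  ring

lemma isWeakDeriv_primitive {g : ℝ → ℝ} (hg : LocallyIntegrable g) :
    IsWeakDeriv (fun x => ∫ y in (0 : ℝ)..x, g y) g := by
  have hii : ∀ a b, IntervalIntegrable g volume a b := intervalIntegrable_of_loc hg
  have hcont : Continuous (fun x => ∫ y in (0 : ℝ)..x, g y) :=
    intervalIntegral.continuous_primitive hii 0
  refine ⟨hcont.locallyIntegrable, hg, fun η h1 h2 => ?_⟩
  obtain ⟨R, hR0, hR⟩ : ∃ R : ℝ, 0 < R ∧ ∀ x, R ≤ |x| → η x = 0 := by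
    obtain ⟨R, hR⟩ := h2.isCompact.isBounded.subset_closedBall 0
    refine ⟨max (R + 1) 1, by positivity, fun x hx => ?_⟩
    by_contra hne
    have h3 := hR (subset_tsupport η hne)
    simp only [Metric.mem_closedBall, dist_zero_right, Real.norm_eq_abs] at h3
    have h4 := le_max_left (R + 1) 1
    linarith
  have hR' : ∀ x, R < |x| → deriv η x = 0 := by
    intro x hx
    have : η =ᶠ[𝓝 x] fun _ => 0 := by
      filter_upwards [(continuous_abs.tendsto x).eventually (lt_mem_nhds hx)] with y hy
      exact hR y hy.le
    rw [this.deriv_eq]; simp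
  have key : ∀ F : ℝ → ℝ, (∀ x, R < |x| → F x = 0) → ∫ x, F x = ∫ x in (-R)..R, F x := by
    intro F hF
    rw [intervalIntegral.integral_of_le (by linarith), ← integral_Icc_eq_integral_Ioc,
      setIntegral_eq_integral_of_forall_compl_eq_zero]
    intro x hx
    apply hF
    by_contra hle
    exact hx (abs_le.mp (not_lt.mp hle))
  rw [key _ (fun x hx => by simp [hR' x hx]), key _ (fun x hx => by simp [hR x hx.le])]
  have hAC : AbsolutelyContinuousOnInterval (fun x => ∫ y in (0 : ℝ)..x, g y) (-R) R := by
    apply IntervalIntegrable.absolutelyContinuousOnInterval_intervalIntegral (hii _ _)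
    rw [uIcc_of_le (by linarith)]; constructor <;> linarith
  have hACη : AbsolutelyContinuousOnInterval η (-R) R :=
    (h1.contDiffOn.of_le (by simp)).absolutelyContinuousOnInterval
  rw [hAC.integral_mul_deriv_eq_deriv_mul hACη, hR R (le_abs_self R),
    hR (-R) (by rw [abs_neg]; exact le_abs_self R)]
  have hae := LocallyIntegrable.ae_hasDerivAt_integral hg
  have : ∫ x in (-R)..R, deriv (fun x => ∫ y in (0 : ℝ)..x, g y) x * η x
      = ∫ x in (-R)..R, g x * η x := by
    apply intervalIntegral.integral_congr_ae
    filter_upwards [hae] with x hx _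
    rw [(hx 0).deriv]
  rw [this]; simp

/-- A distribution with vanishing derivative is constant. -/
lemma isWeakDeriv_zero {f : ℝ → ℝ} (h : IsWeakDeriv f (fun _ => 0)) :
    ∃ c : ℝ, f =ᵐ[volume] fun _ => c := by
  obtain ⟨b⟩ : Nonempty (ContDiffBump (0 : ℝ)) := ⟨⟨1, 2, one_pos, one_lt_two⟩⟩
  set η₀ : ℝ → ℝ := b.normed volume with hη₀
  have s0 : ContDiff ℝ ∞ η₀ := b.contDiff_normed
  have c0 : HasCompactSupport η₀ := b.hasCompactSupport_normed
  have i0 : ∫ x, η₀ x = 1 := b.integral_normed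
  refine ⟨∫ x, f x * η₀ x, ?_⟩
  refine ae_eq_of_integral_contDiff_smul_eq h.1
    (continuous_const.locallyIntegrable) fun η s c => ?_
  set m : ℝ := ∫ x, η x with hm
  set ζ : ℝ → ℝ := fun x => η x - m * η₀ x with hζ
  have sζ : ContDiff ℝ ∞ ζ := s.sub (contDiff_const.mul s0)
  have cζ : HasCompactSupport ζ := c.sub (c0.mul_left)
  have iη : Integrable η := s.continuous.integrable_of_hasCompactSupport c
  have iη0 : Integrable η₀ := s0.continuous.integrable_of_hasCompactSupport c0
  have iζ : Integrable ζ := iη.sub (iη0.const_mul m)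
  have zζ : ∫ x, ζ x = 0 := by
    rw [hζ, integral_sub iη (iη0.const_mul m), integral_const_mul, i0, ← hm]; ring
  obtain ⟨R, hR0, hR⟩ : ∃ R : ℝ, 0 < R ∧ ∀ x, R ≤ |x| → ζ x = 0 := by
    obtain ⟨R, hR⟩ := cζ.isCompact.isBounded.subset_closedBall 0
    refine ⟨max (R + 1) 1, by positivity, fun x hx => ?_⟩
    by_contra hne
    have h3 := hR (subset_tsupport ζ hne)
    simp only [Metric.mem_closedBall, dist_zero_right, Real.norm_eq_abs] at h3
    have h4 := le_max_left (R + 1) 1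
    linarith
  set Z : ℝ → ℝ := fun x => ∫ y in (-R)..x, ζ y with hZ
  have dZ : ∀ x, HasDerivAt Z (ζ x) x := fun x =>
    intervalIntegral.integral_hasDerivAt_right (sζ.continuous.intervalIntegrable _ _)
      (sζ.continuous.stronglyMeasurableAtFilter _ _) sζ.continuous.continuousAt
  have dZ' : deriv Z = ζ := funext fun x => (dZ x).deriv
  have sZ : ContDiff ℝ ∞ Z := by
    rw [contDiff_infty_iff_deriv, dZ']
    exact ⟨fun x => (dZ x).differentiableAt, sζ⟩
  have full : ∫ y in (-R)..R, ζ y = 0 := by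
    rw [← zζ, intervalIntegral.integral_of_le (by linarith), ← integral_Icc_eq_integral_Ioc,
      setIntegral_eq_integral_of_forall_compl_eq_zero]
    intro x hx
    apply hR
    by_contra hle
    exact hx (abs_le.mp (not_le.mp hle).le)
  have cZ : HasCompactSupport Z := by
    apply HasCompactSupport.intro (isCompact_Icc (a := -R) (b := R))
    intro x hx
    by_cases hlt : x < -R
    · apply intervalIntegral.integral_zero_ae
      refine Eventually.of_forall fun y hy => ?_
      rw [uIoc_of_ge hlt.le] at hy
      apply hR
      rw [abs_of_nonpos (by linarith [hy.2])]; linarith [hy.2]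
    · have hgt : R < x := by
        by_contra hle
        exact hx ⟨not_lt.mp hlt, not_lt.mp hle⟩
      have hsplit := intervalIntegral.integral_add_adjacent_intervals
        (sζ.continuous.intervalIntegrable (μ := volume) (-R) R)
        (sζ.continuous.intervalIntegrable (μ := volume) R x)
      simp only [hZ]
      rw [← hsplit, full, zero_add]
      apply intervalIntegral.integral_zero_ae
      refine Eventually.of_forall fun y hy => ?_
      rw [uIoc_of_le hgt.le] at hy
      apply hR
      exact hy.1.le.trans (le_abs_self y)
  have hfin := h.2.2 Z sZ cZ
  rw [dZ'] at hfin
  simp only [zero_mul, integral_zero, neg_zero, hζ, mul_sub] at hfin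
  have e1 := integrable_mul_test h.1 s.continuous c
  have e2 := integrable_mul_test h.1 s0.continuous c0
  have e3 : (fun x => f x * (m * η₀ x)) = fun x => m * (f x * η₀ x) := by
    funext x; ring
  rw [integral_sub e1 (by rw [e3]; exact e2.const_mul m), e3, integral_const_mul] at hfin
  simp only [smul_eq_mul]
  rw [integral_mul_const, ← hm]
  have : ∫ x, η x * f x = ∫ x, f x * η x := by simp only [mul_comm]
  rw [this]; linarith

/-- A locally integrable function with locally integrable distributional derivative has a
continuous representative. -/
lemma IsWeakDeriv.exists_rep {f g : ℝ → ℝ} (h : IsWeakDeriv f g) :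
    ∃ c : ℝ, f =ᵐ[volume] fun x => c + ∫ y in (0 : ℝ)..x, g y := by
  have h0 := (h.add ((isWeakDeriv_primitive h.2.1).const_mul (-1)))
  obtain ⟨c, hc⟩ := isWeakDeriv_zero (h0.congr (ae_eq_refl _)
    (Eventually.of_forall fun x => by simp))
  exact ⟨c, hc.mono fun x hx => by linarith⟩

namespace HeatData

variable (d : HeatData)

/-- The coefficients, extended evenly to `ℝ`. -/
def rho : ℝ → ℝ := evenExt d.ρ

def kappa : ℝ → ℝ := evenExt d.k

def q : ℝ → ℝ := potential (evenExt d.ρ) (evenExt d.k) (evenExt d.γ)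

def Q : ℝ → ℝ := Q1 (evenExt d.ρ) (evenExt d.k)

/-- The measure `ρ(x) dx` on `ℝ`. -/
def meas : Measure ℝ := volume.withDensity fun x => ENNReal.ofReal (d.rho x)

/-- `L²_ρ(ℝ)`. -/
abbrev L2 : Type := Lp ℝ 2 d.meas

lemma rho_pos (x : ℝ) : 0 < d.rho x := d.ρ_pos _ (abs_nonneg x)

lemma kappa_pos (x : ℝ) : 0 < d.kappa x := d.k_pos _ (abs_nonneg x)

lemma continuous_evenExt {f : ℝ → ℝ} (hf : ContinuousOn f (Ici 0)) : Continuous (evenExt f) :=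
  hf.comp_continuous continuous_abs fun x => abs_nonneg x

lemma rho_cont : Continuous d.rho := continuous_evenExt d.ρ_C1.continuousOn

lemma kappa_cont : Continuous d.kappa := continuous_evenExt d.k_C1.continuousOn

lemma vol_ac : (volume : Measure ℝ) ≪ d.meas :=
  withDensity_absolutelyContinuous' (d.rho_cont.measurable.ennreal_ofReal.aemeasurable)
    (Eventually.of_forall fun x => by simpa using d.rho_pos x)

lemma meas_ac : d.meas ≪ (volume : Measure ℝ) := withDensity_absolutelyContinuous _ _

/-- `ℍ¹`, realised as the set of pairs `(φ, 𝔻φ)` with `φ, 𝔻φ ∈ L²_ρ(ℝ)`, where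
`𝔻φ = √(k/ρ) φ' + Q₁ φ` and `φ'` is the distributional derivative; that is,
`φ' = √(ρ/k) (𝔻φ - Q₁ φ)` in the sense of distributions. As a subspace of the `ℓ²`-product
`L²_ρ × L²_ρ` it carries the norm `(‖φ‖² + ‖𝔻φ‖²)^(1/2)`. -/
def H1 : Submodule ℝ (WithLp 2 (d.L2 × d.L2)) where
  carrier := {p | IsWeakDeriv (fun x => p.fst x)
    (fun x => √(d.rho x / d.kappa x) * (p.snd x - d.Q x * p.fst x))}
  zero_mem' := by
    have h0 : (fun x => ((0 : d.L2) : ℝ → ℝ) x) =ᵐ[volume] fun _ => 0 :=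
      d.vol_ac.ae_eq (Lp.coeFn_zero ℝ 2 d.meas)
    have : IsWeakDeriv (fun _ => (0 : ℝ)) (fun _ => 0) :=
      ⟨locallyIntegrable_zero, locallyIntegrable_zero, fun η _ _ => by simp⟩
    refine this.congr h0.symm (h0.mono fun x hx => ?_)
    have e : √(d.rho x / d.kappa x) *
        (((0 : d.L2) : ℝ → ℝ) x - d.Q x * ((0 : d.L2) : ℝ → ℝ) x) = 0 := by
      simp only at hx; rw [hx]; ring
    exact e.symm
  add_mem' := by
    intro a b ha hb
    have h1 := d.vol_ac.ae_eq (Lp.coeFn_add a.fst b.fst)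
    have h2 := d.vol_ac.ae_eq (Lp.coeFn_add a.snd b.snd)
    refine (IsWeakDeriv.add ha hb).congr (h1.mono fun x hx => ?_) ?_
    · simp only [WithLp.add_fst]; rw [hx]; rfl
    · filter_upwards [h1, h2] with x hx1 hx2
      simp only [WithLp.add_fst, WithLp.add_snd]; rw [hx1, hx2]
      simp only [Pi.add_apply]; ring
  smul_mem' := by
    intro c a ha
    have h1 := d.vol_ac.ae_eq (Lp.coeFn_smul c a.fst)
    have h2 := d.vol_ac.ae_eq (Lp.coeFn_smul c a.snd)
    refine (IsWeakDeriv.const_mul ha c).congr (h1.mono fun x hx => ?_) ?_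
    · simp only [WithLp.smul_fst]; rw [hx]; rfl
    · filter_upwards [h1, h2] with x hx1 hx2
      simp only [WithLp.smul_fst, WithLp.smul_snd]; rw [hx1, hx2]
      simp only [Pi.smul_apply, smul_eq_mul]; ring

/-- The inclusion `ℍ¹ → ℍ⁰ = L²_ρ(ℝ)`. -/
def val : d.H1 →L[ℝ] d.L2 := (WithLp.fstL 2 ℝ d.L2 d.L2).comp d.H1.subtypeL

/-- The derivative `𝔻 : ℍ¹ → ℍ⁰ = L²_ρ(ℝ)`. -/
def D : d.H1 →L[ℝ] d.L2 := (WithLp.sndL 2 ℝ d.L2 d.L2).comp d.H1.subtypeL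

/-- `ℍ⁻¹`, the dual space of `ℍ¹`. -/
abbrev Hneg1 : Type := StrongDual ℝ d.H1

/-- The embedding `ℍ⁰ → ℍ⁻¹`, `⟨⟨f, φ⟩⟩ = ∫ f φ ρ dx`. -/
def ofL2 (f : d.L2) : d.Hneg1 := (innerSL ℝ f).comp d.val

/-- The derivative `𝔻 : ℍ⁰ → ℍ⁻¹`, `⟨⟨𝔻f, φ⟩⟩ = -⟨⟨f, 𝔻φ⟩⟩ = -∫ f (𝔻φ) ρ dx`. -/
def Dneg (f : d.L2) : d.Hneg1 := -((innerSL ℝ f).comp d.D)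

/-- `ℍ̂¹`, the subspace of the even elements of `ℍ¹`. -/
def H1even : Submodule ℝ d.H1 where
  carrier := {φ | ∀ᵐ x : ℝ, d.val φ (-x) = d.val φ x}
  zero_mem' := by
    have h := d.vol_ac.ae_eq (Lp.coeFn_zero ℝ 2 d.meas)
    filter_upwards [h, (Measure.measurePreserving_neg (volume : Measure ℝ)).quasiMeasurePreserving.ae h]
      with x h1 h2
    rw [map_zero, h1, h2]; rfl
  add_mem' := by
    intro a b ha hb
    have h := d.vol_ac.ae_eq (Lp.coeFn_add (d.val a) (d.val b))
    change ∀ᵐ x : ℝ, d.val (a + b) (-x) = d.val (a + b) x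
    filter_upwards [h, (Measure.measurePreserving_neg (volume : Measure ℝ)).quasiMeasurePreserving.ae h,
      ha, hb] with x h1 h2 h3 h4
    rw [map_add, h1, h2, Pi.add_apply, Pi.add_apply, h3, h4]
  smul_mem' := by
    intro c a ha
    have h := d.vol_ac.ae_eq (Lp.coeFn_smul c (d.val a))
    change ∀ᵐ x : ℝ, d.val (c • a) (-x) = d.val (c • a) x
    filter_upwards [h, (Measure.measurePreserving_neg (volume : Measure ℝ)).quasiMeasurePreserving.ae h,
      ha] with x h1 h2 h3
    rw [map_smul, h1, h2, Pi.smul_apply, Pi.smul_apply, h3]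

lemma exists_cont_rep (φ : d.H1) : ∃ F : ℝ → ℝ, Continuous F ∧ d.val φ =ᵐ[volume] F := by
  have h : IsWeakDeriv _ _ := φ.2
  obtain ⟨c, hc⟩ := h.exists_rep
  exact ⟨_, continuous_const.add
    (intervalIntegral.continuous_primitive (intervalIntegrable_of_loc h.2.1) 0), hc⟩

/-- The continuous representative of an element of `ℍ¹`. -/
def contRep (φ : d.H1) : ℝ → ℝ := Classical.choose (d.exists_cont_rep φ)

lemma contRep_continuous (φ : d.H1) : Continuous (d.contRep φ) :=
  (Classical.choose_spec (d.exists_cont_rep φ)).1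

lemma contRep_ae (φ : d.H1) : d.val φ =ᵐ[volume] d.contRep φ :=
  (Classical.choose_spec (d.exists_cont_rep φ)).2

lemma contRep_unique (φ : d.H1) {F : ℝ → ℝ} (hF : Continuous F)
    (h : d.val φ =ᵐ[volume] F) : d.contRep φ = F :=
  ((d.contRep_continuous φ).ae_eq_iff_eq volume hF).1 ((d.contRep_ae φ).symm.trans h)

lemma contRep_add (φ ψ : d.H1) : d.contRep (φ + ψ) = d.contRep φ + d.contRep ψ := by
  apply d.contRep_unique _ ((d.contRep_continuous φ).add (d.contRep_continuous ψ))
  rw [map_add]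
  exact (d.vol_ac.ae_eq (Lp.coeFn_add _ _)).trans ((d.contRep_ae φ).add (d.contRep_ae ψ))

lemma contRep_smul (c : ℝ) (φ : d.H1) : d.contRep (c • φ) = c • d.contRep φ := by
  apply d.contRep_unique _ ((d.contRep_continuous φ).const_smul c)
  rw [map_smul]
  exact (d.vol_ac.ae_eq (Lp.coeFn_smul _ _)).trans ((d.contRep_ae φ).const_smul c)

lemma exists_local_bound : ∃ C : ℝ, 0 ≤ C ∧ ∀ f : d.L2,
    IntegrableOn (fun x => f x) (Icc 0 1) ∧ ∫ x in Icc (0 : ℝ) 1, |f x| ≤ C * ‖f‖ := by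
  obtain ⟨x₀, _, hx₀⟩ := (isCompact_Icc (a := (0 : ℝ)) (b := 1)).exists_isMinOn
    ⟨0, by simp⟩ d.rho_cont.continuousOn
  set m := d.rho x₀ with hm
  have hmpos : 0 < m := d.rho_pos x₀
  set c : ℝ≥0∞ := ENNReal.ofReal m⁻¹ with hc
  have hle : (volume : Measure ℝ).restrict (Icc 0 1) ≤ c • d.meas := by
    refine Measure.le_iff.2 fun s hs => ?_
    rw [Measure.restrict_apply hs, Measure.smul_apply, smul_eq_mul, meas,
      withDensity_apply _ hs, ← lintegral_const_mul' _ _ ENNReal.ofReal_ne_top]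
    calc volume (s ∩ Icc 0 1) = ∫⁻ _ in s ∩ Icc 0 1, 1 := by simp
      _ ≤ ∫⁻ x in s ∩ Icc 0 1, c * ENNReal.ofReal (d.rho x) := by
          refine setLIntegral_mono' (hs.inter measurableSet_Icc) fun x hx => ?_
          rw [hc, ← ENNReal.ofReal_mul (by positivity), ← ENNReal.ofReal_one]
          apply ENNReal.ofReal_le_ofReal
          have h1 : m ≤ d.rho x := hx₀ hx.2
          rw [inv_mul_eq_div, one_le_div hmpos]; exact h1
      _ ≤ _ := lintegral_mono_set inter_subset_left
  have hprob : IsProbabilityMeasure ((volume : Measure ℝ).restrict (Icc 0 1)) := ⟨by simp⟩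
  refine ⟨(c ^ (1 / (2 : ℝ≥0∞)).toReal).toReal, ENNReal.toReal_nonneg, fun f => ?_⟩
  have hf2 : MemLp f 2 (c • d.meas) := (Lp.memLp f).smul_measure ENNReal.ofReal_ne_top
  have hfr : MemLp f 2 ((volume : Measure ℝ).restrict (Icc 0 1)) := hf2.mono_measure hle
  have hint : IntegrableOn (fun x => f x) (Icc 0 1) :=
    memLp_one_iff_integrable.1 (hfr.mono_exponent (by norm_num))
  refine ⟨hint, ?_⟩
  have e1 : ∫ x in Icc (0 : ℝ) 1, |f x|
      = (eLpNorm f 1 ((volume : Measure ℝ).restrict (Icc 0 1))).toReal := by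
    rw [eLpNorm_one_eq_lintegral_enorm, ← integral_norm_eq_lintegral_enorm
      hint.aestronglyMeasurable]
    rfl
  have e2 : eLpNorm f 1 ((volume : Measure ℝ).restrict (Icc 0 1))
      ≤ c ^ (1 / (2 : ℝ≥0∞)).toReal * eLpNorm f 2 d.meas := by
    calc _ ≤ eLpNorm f 2 ((volume : Measure ℝ).restrict (Icc 0 1)) :=
          eLpNorm_le_eLpNorm_of_exponent_le (by norm_num) hfr.1
      _ ≤ eLpNorm f 2 (c • d.meas) := eLpNorm_mono_measure _ hle
      _ = _ := by
          rw [eLpNorm_smul_measure_of_ne_top (by norm_num)]; rfl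
  rw [e1, Lp.norm_def, ← ENNReal.toReal_mul]
  exact ENNReal.toReal_mono (ENNReal.mul_ne_top
    (ENNReal.rpow_ne_top_of_nonneg ENNReal.toReal_nonneg ENNReal.ofReal_ne_top)
    (Lp.eLpNorm_ne_top f)) e2

lemma Q_eq {x : ℝ} (hx : 0 < x) : d.Q x = √(d.kappa x / d.rho x) *
    derivWithin (fun x => d.ρ x * d.k x) (Ici 0) x / (4 * (d.kappa x * d.rho x)) := by
  have : deriv (fun y => evenExt d.k y * evenExt d.ρ y) x
      = derivWithin (fun x => d.ρ x * d.k x) (Ici 0) x := by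
    rw [derivWithin_of_mem_nhds (Ici_mem_nhds hx)]
    apply EventuallyEq.deriv_eq
    filter_upwards [lt_mem_nhds hx] with y hy
    simp only [evenExt, abs_of_pos hy, mul_comm]
  simp only [Q, Q1, this]
  rfl

lemma exists_Q_bound : ∃ B : ℝ, 0 ≤ B ∧ ∀ x ∈ Ioc (0 : ℝ) 1, |d.Q x| ≤ B := by
  have h1 : ContinuousOn (fun x => √(d.kappa x / d.rho x) *
      derivWithin (fun x => d.ρ x * d.k x) (Ici 0) x / (4 * (d.kappa x * d.rho x))) (Icc 0 1) := by
    have hd : ContinuousOn (derivWithin (fun x => d.ρ x * d.k x) (Ici 0)) (Icc 0 1) :=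
      (d.ρk_C2.continuousOn_derivWithin (uniqueDiffOn_Ici 0) (by norm_num)).mono
        Icc_subset_Ici_self
    refine ContinuousOn.div (ContinuousOn.mul ?_ hd) ?_ fun x _ => ?_
    · exact (Real.continuous_sqrt.comp (d.kappa_cont.div d.rho_cont
        fun x => (d.rho_pos x).ne')).continuousOn
    · exact (continuous_const.mul (d.kappa_cont.mul d.rho_cont)).continuousOn
    · have := d.rho_pos x; have := d.kappa_pos x; positivity
  obtain ⟨B, hB⟩ := isCompact_Icc.exists_bound_of_continuousOn h1
  refine ⟨B, (norm_nonneg _).trans (hB 0 (by simp)), fun x hx => ?_⟩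
  rw [d.Q_eq hx.1]
  exact hB x ⟨hx.1.le, hx.2⟩

lemma exists_trace_bound : ∃ C : ℝ, ∀ φ : d.H1, ‖d.contRep φ 0‖ ≤ C * ‖φ‖ := by
  obtain ⟨C, hC0, hC⟩ := d.exists_local_bound
  obtain ⟨B, hB0, hB⟩ := d.exists_Q_bound
  obtain ⟨A, hA⟩ := (isCompact_Icc (a := (0 : ℝ)) (b := 1)).exists_bound_of_continuousOn
    (f := fun x => √(d.rho x / d.kappa x)) (Real.continuous_sqrt.comp
      (d.rho_cont.div d.kappa_cont fun x => (d.kappa_pos x).ne')).continuousOn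
  have hA0 : 0 ≤ A := (norm_nonneg _).trans (hA 0 (by simp))
  refine ⟨C * ‖d.val‖ + A * (C * ‖d.D‖ + B * (C * ‖d.val‖)), fun φ => ?_⟩
  have hw : IsWeakDeriv (fun x => d.val φ x)
    (fun x => √(d.rho x / d.kappa x) * (d.D φ x - d.Q x * d.val φ x)) := φ.2
  set g := fun x => √(d.rho x / d.kappa x) * (d.D φ x - d.Q x * d.val φ x) with hg
  obtain ⟨c, hc⟩ := hw.exists_rep
  have hrep : d.contRep φ = fun x => c + ∫ y in (0 : ℝ)..x, g y :=
    d.contRep_unique φ (continuous_const.add (intervalIntegral.continuous_primitive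
      (intervalIntegrable_of_loc hw.2.1) 0)) hc
  have h0 : d.contRep φ 0 = c := by rw [hrep]; simp
  rw [h0, Real.norm_eq_abs]
  obtain ⟨iv, bv⟩ := hC (d.val φ)
  obtain ⟨iD, bD⟩ := hC (d.D φ)
  have ig : IntegrableOn g (Icc 0 1) := hw.2.1.integrableOn_isCompact isCompact_Icc
  set G := ∫ x in Icc (0 : ℝ) 1, |g x| with hG
  have hpt : ∀ᵐ x ∂(volume : Measure ℝ).restrict (Icc 0 1), |c| ≤ |d.val φ x| + G := by
    filter_upwards [ae_restrict_mem measurableSet_Icc, ae_restrict_of_ae hc] with x hx hcx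
    have h1 : |∫ y in (0 : ℝ)..x, g y| ≤ G := by
      rw [intervalIntegral.integral_of_le hx.1]
      refine (abs_integral_le_integral_abs).trans ?_
      exact setIntegral_mono_set ig.abs (Eventually.of_forall fun _ => abs_nonneg _)
        (Eventually.of_forall fun y hy => ⟨hy.1.le, hy.2.trans hx.2⟩)
    have h2 : c = d.val φ x - ∫ y in (0 : ℝ)..x, g y := by rw [hcx]; ring
    calc |c| = |d.val φ x - ∫ y in (0 : ℝ)..x, g y| := by rw [← h2]
      _ ≤ _ := (abs_sub _ _).trans (by linarith)
  have hGb : G ≤ A * ((∫ x in Icc (0 : ℝ) 1, |d.D φ x|)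
      + B * ∫ x in Icc (0 : ℝ) 1, |d.val φ x|) := by
    rw [← integral_const_mul, ← integral_add iD.abs (iv.abs.const_mul B), ← integral_const_mul]
    refine integral_mono_ae ig.abs ((iD.abs.add (iv.abs.const_mul B)).const_mul A) ?_
    rw [Measure.restrict_congr_set (Ioc_ae_eq_Icc (μ := volume)).symm]
    filter_upwards [ae_restrict_mem measurableSet_Ioc] with x hx
    have h1 := hA x ⟨hx.1.le, hx.2⟩
    have h2 := hB x hx
    simp only [hg, abs_mul]
    rw [Real.norm_eq_abs] at h1
    refine mul_le_mul h1 ((abs_sub _ _).trans ?_) (abs_nonneg _) hA0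
    rw [abs_mul]
    gcongr
  have hcint : |c| ≤ (∫ x in Icc (0 : ℝ) 1, |d.val φ x|) + G := by
    have := integral_mono_ae (μ := (volume : Measure ℝ).restrict (Icc 0 1))
      (integrable_const |c|) (iv.abs.add (integrable_const G)) hpt
    rw [integral_const, integral_add' iv.abs (integrable_const G), integral_const] at this
    simpa using this
  have nv := d.val.le_opNorm φ
  have nD := d.D.le_opNorm φ
  have bv' : ∫ x in Icc (0 : ℝ) 1, |d.val φ x| ≤ C * ‖d.val‖ * ‖φ‖ := by
    rw [mul_assoc]; exact bv.trans (by gcongr)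
  have bD' : ∫ x in Icc (0 : ℝ) 1, |d.D φ x| ≤ C * ‖d.D‖ * ‖φ‖ := by
    rw [mul_assoc]; exact bD.trans (by gcongr)
  calc |c| ≤ C * ‖d.val‖ * ‖φ‖ + A * (C * ‖d.D‖ * ‖φ‖ + B * (C * ‖d.val‖ * ‖φ‖)) := by
        refine hcint.trans (add_le_add bv' (hGb.trans ?_))
        gcongr
    _ = _ := by ring

/-- The Dirac distribution `δ ∈ ℍ⁻¹`: `⟨⟨δ, φ⟩⟩ = φ(0)`, with `φ` continuous. -/
def delta : d.Hneg1 :=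
  LinearMap.mkContinuousOfExistsBound
    { toFun := fun φ => d.contRep φ 0
      map_add' := fun φ ψ => by rw [contRep_add]; rfl
      map_smul' := fun c φ => by rw [contRep_smul]; rfl }
    d.exists_trace_bound

lemma q_even (x : ℝ) : d.q |x| = d.q x := by
  rcases abs_choice x with h | h
  · rw [h]
  have e (f : ℝ → ℝ) (y : ℝ) : evenExt f (-y) = evenExt f y := by simp [evenExt]
  have hQ : ∀ y, d.Q (-y) = -d.Q y := by
    intro y
    have h1 : deriv (fun y => evenExt d.k y * evenExt d.ρ y) (-y)
        = -deriv (fun y => evenExt d.k y * evenExt d.ρ y) y := by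
      have := deriv_comp_neg (fun y => evenExt d.k y * evenExt d.ρ y) y
      simp only [e] at this
      rw [this, neg_neg]
    simp only [Q, Q1, e, h1]
    ring
  have hd : deriv d.Q (-x) = deriv d.Q x := by
    have := deriv_comp_neg d.Q x
    simp only [hQ] at this
    rw [deriv.fun_neg] at this
    linarith
  rw [h]
  have hQx := hQ x
  simp only [Q] at hd hQx
  simp only [q, potential, Q2, e, hd, hQx]
  ring

lemma q_cont : Continuous d.q := by
  have h : Continuous (fun x : ℝ => d.q |x|) :=
    d.q_C1.continuousOn.comp_continuous continuous_abs fun x => abs_nonneg x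
  exact h.congr d.q_even

lemma q_memLp : MemLp d.q ∞ d.meas := by
  obtain ⟨C, hC⟩ := d.q_bounded
  refine memLp_top_of_bound d.q_cont.aestronglyMeasurable C (Eventually.of_forall fun x => ?_)
  rw [← d.q_even]
  exact hC _ (abs_nonneg x)

/-- Multiplication by `q` on `L²_ρ(ℝ)`. -/
def mulq (f : d.L2) : d.L2 := ((Lp.memLp f).mul d.q_memLp (r := 2)).toLp _

/-- The right-hand side `𝔻²W - qW - 2√((ρk)(0)) u δ ∈ ℍ⁻¹` of the equation at a fixed time, where
`u` is the value of the control at that time. -/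
def rhs (u : ℝ) (φ : d.H1) : d.Hneg1 :=
  d.Dneg (d.D φ) - d.ofL2 (d.mulq (d.val φ)) - (2 * √(d.ρ 0 * d.k 0) * u) • d.delta

/-- `W : [0, T] → ℍ̂¹` is a solution of `W_t = 𝔻²W - qW - 2√((ρk)(0)) u δ`, `W(·, 0) = W⁰`, with
control `u`: as a curve in `ℍ⁻¹` it is absolutely continuous on `[0, T]` and satisfies the equation
for a.e. `t ∈ (0, T)`; its derivative is then automatically even, since the right-hand side is
an even distribution for even `W`. (The values of `W` outside `[0, T]` do not matter.) -/
structure IsSolution (T : ℝ) (u : ℝ → ℝ) (W0 : d.H1even) (W : ℝ → d.H1even) : Prop where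
  ac : AbsolutelyContinuousOnInterval (fun t => d.ofL2 (d.val (W t))) 0 T
  eqn : ∀ᵐ t ∂volume.restrict (Ioo 0 T),
    HasDerivAt (fun s => d.ofL2 (d.val (W s))) (d.rhs (u t) (W t)) t
  init : W 0 = W0

/-- The set `R_T(W⁰)` of the states reachable from `W⁰` in time `T` by controls `u ∈ L^∞(0, T)`
for which the solution exists and is unique. -/
def reachable (T : ℝ) (W0 : d.H1even) : Set d.H1even :=
  {WT | ∃ u : ℝ → ℝ, MemLp u ∞ (volume.restrict (Ioo 0 T)) ∧
    ∃ W : ℝ → d.H1even, d.IsSolution T u W0 W ∧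
      (∀ W' : ℝ → d.H1even, d.IsSolution T u W0 W' → EqOn W' W (Icc 0 T)) ∧ W T = WT}

/-- `W⁰` is controllable to `Wᵀ` in time `T`. -/
def IsControllableTo (T : ℝ) (W0 WT : d.H1even) : Prop := WT ∈ d.reachable T W0

end HeatData
end HeatControl
end

/-!
The change of variables `y = σ(x)`, `w = ω⁻¹ W` with `ω = (ρk)^(-1/4)` satisfies `𝔻ω = 0` and
`ω² ρ dx = dy`, and turns the equation into `w_t = w_yy - q w - c u(t) δ` on the line, where
`c > 0` and `∫ (1 + |y|) |q| dy < ∞`.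

For `ξ` large, a Volterra integral equation yields a solution `φ` of `-φ'' + qφ = ξ²φ` with
`φ(0) = 1`, bounded by `2`, and equal on each half-line to a combination of `cos ξy` and `sin ξy`
with bounded coefficients up to an error `O(1 / (1 + |y|))` (`nonempty_highFrequencySolution`).
Suppose that the control `u` steers `w` to `0` at time `T`. Formally, `e^{ξ²t} ⟨w(t), φ⟩` has
derivative `-c e^{ξ²t} u(t)`, so that `⟨w(0), φ⟩ = c U(ξ²)`, where `U(z) = ∫₀ᵀ e^{zt} u(t) dt`.
As `φ` is not square-integrable, it is replaced by truncations `χ(εy) φ(y)`, whose error tends to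
`0` in `ℍ¹` like `√ε` (`exists_truncations`, `HeatData.tendsto_integral_pull`).

Up to a bounded term, `⟨w(0), φ⟩` is a combination of Fourier transforms, at frequency `ξ`, of the
restrictions of the square-integrable function `w(0)` to the two half-lines. By Plancherel and
Fatou, `U(ξ²)²` therefore has bounded integrals over windows of fixed length in `ξ`
(`exists_window_bound`). But `U` is entire, of exponential type, and tends to `0` at `-∞`, whereas
`u ≠ 0` would make it large at `+∞`. Precisely, `z ↦ ∫₀¹ U(z + s)² ds` grows at most linearly on the
positive axis, and Phragmén–Lindelöf and Liouville make it constant; so `U²` is periodic, and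
`U = 0` (`laplace_eq_zero_of_window_bound`). Hence `u = 0` almost everywhere.

Thus `w` solves the free equation and vanishes at time `T`. Its generator is `c' - A` with `A`
symmetric and coercive, so `⟨w(s), A⁻¹ w(τ - s)⟩` is constant in `s`; if `w(τ) = 0`, then
`w(τ / 2) = 0`. Halving repeatedly and using continuity gives `w(0) = 0`
(`HeatData.backward_uniqueness`).
-/

namespace HeatControl

/-! ### Fourier and Laplace transforms -/

open scoped FourierTransform SchwartzMap in
/-- The Fourier integral of an integrable, square integrable function has the same `L²` norm.
Both the Fourier integral and the abstract `L²` Fourier transform act on Schwartz functions by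
transposition, so they agree almost everywhere. -/
lemma eLpNorm_fourier_eq {f : ℝ → ℂ} (h1 : Integrable f) (h2 : MemLp f 2) :
    eLpNorm (𝓕 f) 2 volume = eLpNorm f 2 volume := by
  set F : Lp ℂ 2 (volume : Measure ℝ) := h2.toLp f with hF
  have hcont : Continuous (𝓕 f) :=
    VectorFourier.fourierIntegral_continuous Real.continuous_fourierChar
      (innerSL ℝ : ℝ →L[ℝ] ℝ →L[ℝ] ℝ).continuous₂ h1
  have hae : 𝓕 f =ᵐ[volume] (𝓕 F : Lp ℂ 2 (volume : Measure ℝ)) := by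
    refine ae_eq_of_integral_contDiff_smul_eq hcont.locallyIntegrable
      ((Lp.memLp _).locallyIntegrable (by norm_num)) fun g hg hgc => ?_
    have hg1 : HasCompactSupport (fun x => (g x : ℂ)) := hgc.comp_left (g := Complex.ofReal) rfl
    have hg2 : ContDiff ℝ ∞ (fun x => (g x : ℂ)) := Complex.ofRealCLM.contDiff.comp hg
    set G : 𝓢(ℝ, ℂ) := hg1.toSchwartzMap hg2 with hG
    have e1 := congrArg (fun S : 𝓢'(ℝ, ℂ) => S G) (Lp.fourier_toTemperedDistribution_eq F)
    simp only [TemperedDistribution.fourier_apply, Lp.toTemperedDistribution_apply] at e1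
    have e2 : ∫ x, (𝓕 G) x • F x = ∫ x, (𝓕 G) x • f x :=
      integral_congr_ae (h2.coeFn_toLp.mono fun x hx => by simp only [hF, hx])
    have e3 := VectorFourier.integral_fourierIntegral_smul_eq_flip (L := innerₗ ℝ)
      Real.continuous_fourierChar (innerSL ℝ : ℝ →L[ℝ] ℝ →L[ℝ] ℝ).continuous₂
      (G.integrable (μ := volume)) h1
    have hflip : (innerₗ ℝ : ℝ →ₗ[ℝ] ℝ →ₗ[ℝ] ℝ).flip = innerₗ ℝ := by ext; simp
    rw [hflip] at e3
    have e4 : ∫ x, (𝓕 G) x • f x = ∫ x, G x • (𝓕 f) x := e3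
    rw [e2, e4] at e1
    simpa [hG] using e1
  rw [eLpNorm_congr_ae hae, ← eLpNorm_congr_ae h2.coeFn_toLp, ← hF]
  have := Lp.norm_fourier_eq F
  rw [Lp.norm_def, Lp.norm_def] at this
  exact (ENNReal.toReal_eq_toReal_iff' (Lp.eLpNorm_ne_top _) (Lp.eLpNorm_ne_top _)).1 this

/-- The two-sided Laplace transform `z ↦ ∫₀ᵀ e^{zt} u(t) dt` of a function on `(0, T)`. -/
noncomputable def laplace (T : ℝ) (u : ℝ → ℝ) (z : ℂ) : ℂ :=
  ∫ t in Ioo 0 T, Complex.exp (z * t) * (u t : ℂ)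

section laplace

variable {T : ℝ} {u : ℝ → ℝ}

lemma norm_exp_mul_le {t : ℝ} (ht : t ∈ Ioo 0 T) (z : ℂ) :
    ‖Complex.exp (z * t)‖ ≤ Real.exp (max z.re 0 * T) := by
  rw [Complex.norm_exp]
  apply Real.exp_le_exp.2
  simp only [Complex.mul_re, Complex.ofReal_re, Complex.ofReal_im, mul_zero, sub_zero]
  calc z.re * t ≤ max z.re 0 * t := by gcongr; exacts [ht.1.le, le_max_left _ _]
    _ ≤ max z.re 0 * T := by gcongr; exacts [ht.2.le]

lemma integrable_laplace (hu : IntegrableOn u (Ioo 0 T)) (z : ℂ) :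
    IntegrableOn (fun t : ℝ => Complex.exp (z * t) * (u t : ℂ)) (Ioo 0 T) := by
  refine Integrable.bdd_mul (c := Real.exp (max z.re 0 * T)) hu.ofReal
    (Continuous.aestronglyMeasurable (by fun_prop)) ?_
  filter_upwards [ae_restrict_mem measurableSet_Ioo] with t ht using norm_exp_mul_le ht z

lemma norm_laplace_le (hu : IntegrableOn u (Ioo 0 T)) (z : ℂ) :
    ‖laplace T u z‖ ≤ Real.exp (max z.re 0 * T) * ∫ t in Ioo 0 T, |u t| := by
  rw [laplace, ← integral_const_mul]
  refine norm_integral_le_of_norm_le (hu.abs.const_mul _) ?_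
  filter_upwards [ae_restrict_mem measurableSet_Ioo] with t ht
  rw [norm_mul, Complex.norm_real, Real.norm_eq_abs]
  gcongr
  exact norm_exp_mul_le ht z

lemma differentiable_laplace (hu : IntegrableOn u (Ioo 0 T)) :
    Differentiable ℂ (laplace T u) := by
  intro z₀
  have h := hasDerivAt_integral_of_dominated_loc_of_deriv_le
    (μ := volume.restrict (Ioo 0 T)) (F := fun (z : ℂ) t => Complex.exp (z * t) * (u t : ℂ))
    (F' := fun z t => Complex.exp (z * t) * t * (u t : ℂ)) (x₀ := z₀)
    (bound := fun t => Real.exp ((‖z₀‖ + 1) * T) * T * |u t|)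
    (Metric.ball_mem_nhds z₀ one_pos)
    (Eventually.of_forall fun z => (integrable_laplace hu z).aestronglyMeasurable)
    (integrable_laplace hu z₀)
    ((Continuous.aestronglyMeasurable (by fun_prop)).mul hu.ofReal.aestronglyMeasurable)
    ?_ (hu.abs.const_mul _) ?_
  · exact h.2.differentiableAt
  · filter_upwards [ae_restrict_mem measurableSet_Ioo] with t ht z hz
    have hT : 0 ≤ T := ht.1.le.trans ht.2.le
    rw [norm_mul, norm_mul, Complex.norm_real, Complex.norm_real, Real.norm_eq_abs,
      Real.norm_eq_abs, abs_of_pos ht.1]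
    gcongr
    · exact ht.1.le
    · refine (norm_exp_mul_le ht z).trans (Real.exp_le_exp.2 ?_)
      gcongr
      refine max_le ((Complex.re_le_norm z).trans ?_) (by positivity)
      have h1 := norm_sub_norm_le z z₀
      rw [Metric.mem_ball, dist_eq_norm] at hz
      linarith
    · exact ht.2.le
  · refine Eventually.of_forall fun t z _ => ?_
    have := ((hasDerivAt_id z).mul_const (t : ℂ)).cexp.mul_const (u t : ℂ)
    simpa using this

lemma tendsto_laplace_sub_nat (hu : IntegrableOn u (Ioo 0 T)) (z : ℂ) :
    Tendsto (fun n : ℕ => laplace T u (z - n)) atTop (𝓝 0) := by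
  have := tendsto_integral_of_dominated_convergence (μ := volume.restrict (Ioo 0 T))
    (F := fun (n : ℕ) t => Complex.exp ((z - n) * t) * (u t : ℂ)) (f := fun _ => 0)
    (fun t => Real.exp (max z.re 0 * T) * |u t|)
    (fun n => (integrable_laplace hu _).aestronglyMeasurable) (hu.abs.const_mul _) ?_ ?_
  · rw [integral_zero] at this
    exact this
  · intro n
    filter_upwards [ae_restrict_mem measurableSet_Ioo] with t ht
    have hT : 0 ≤ T := ht.1.le.trans ht.2.le
    rw [norm_mul, Complex.norm_real, Real.norm_eq_abs]
    gcongr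
    refine (norm_exp_mul_le ht _).trans (Real.exp_le_exp.2 ?_)
    refine mul_le_mul_of_nonneg_right (max_le_max_right 0 ?_) hT
    simp
  · filter_upwards [ae_restrict_mem measurableSet_Ioo] with t ht
    rw [← zero_mul (u t : ℂ)]
    refine Tendsto.mul_const _ ?_
    rw [tendsto_zero_iff_norm_tendsto_zero]
    simp only [Complex.norm_exp]
    refine Real.tendsto_exp_atBot.comp ?_
    have : (fun n : ℕ => ((z - n) * (t : ℂ)).re) = fun n : ℕ => z.re * t + -((n : ℝ) * t) := by
      funext n; simp; ring
    rw [this]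
    refine tendsto_atBot_add_const_left _ _ (tendsto_neg_atTop_atBot.comp ?_)
    exact tendsto_natCast_atTop_atTop.atTop_mul_const ht.1

lemma laplace_ofReal (x : ℝ) :
    laplace T u x = ((∫ t in Ioo 0 T, Real.exp (x * t) * u t : ℝ) : ℂ) := by
  rw [laplace, ← integral_complex_ofReal]
  simp

open scoped FourierTransform in
/-- The Laplace transform determines the function, since it contains its Fourier transform. -/
lemma ae_eq_zero_of_laplace_eq_zero (hu : MemLp u ∞ (volume.restrict (Ioo 0 T)))
    (h : ∀ z, laplace T u z = 0) : u =ᵐ[volume.restrict (Ioo 0 T)] 0 := by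
  have hu2 : MemLp u 2 (volume.restrict (Ioo 0 T)) := hu.mono_exponent le_top
  have hu1 : IntegrableOn u (Ioo 0 T) := memLp_one_iff_integrable.1 (hu.mono_exponent le_top)
  set f : ℝ → ℂ := (Ioo 0 T).indicator fun t => (u t : ℂ) with hf
  have f1 : Integrable f := (integrable_indicator_iff measurableSet_Ioo).2 hu1.ofReal
  have f2 : MemLp f 2 := (memLp_indicator_iff_restrict measurableSet_Ioo).2 hu2.ofReal
  have hz : 𝓕 f = 0 := by
    funext w
    have := h (-(2 * Real.pi * w) * Complex.I)
    rw [Real.fourier_real_eq_integral_exp_smul, Pi.zero_apply, ← this, laplace,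
      ← integral_indicator measurableSet_Ioo]
    congr 1
    funext t
    by_cases ht : t ∈ Ioo 0 T
    · simp only [hf, indicator_of_mem ht, smul_eq_mul]
      congr 2
      push_cast; ring
    · simp [hf, indicator_of_notMem ht]
  have h0 := eLpNorm_fourier_eq f1 f2
  rw [hz, eLpNorm_zero, eq_comm, eLpNorm_eq_zero_iff f2.1 (by norm_num)] at h0
  rw [Filter.EventuallyEq, ae_restrict_iff' measurableSet_Ioo]
  filter_upwards [h0] with t ht hm
  simpa [hf, indicator_of_mem hm] using ht

end laplace

/-! ### A uniqueness theorem for Laplace transforms -/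

/-- Phragmén–Lindelöf in the first and fourth quadrants shows that `H` grows at most linearly, and
boundedness on the left half-plane then leaves only constants. -/
lemma entire_eq_const_of_growth {H : ℂ → ℂ} (hd : Differentiable ℂ H) {K A C : ℝ} (hA : 0 ≤ A)
    (hexp : ∀ z, ‖H z‖ ≤ K * Real.exp (A * max z.re 0))
    (hreal : ∀ x : ℝ, 0 ≤ x → ‖H x‖ ≤ C * (1 + x)) (z : ℂ) : H z = H 0 := by
  have hK : 0 ≤ K := by have := (norm_nonneg _).trans (hexp 0); simpa using this
  have hC : 0 ≤ C := by have := (norm_nonneg _).trans (hreal 0 le_rfl); simpa using this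
  have hleft : ∀ z : ℂ, z.re ≤ 0 → ‖H z‖ ≤ K := fun z hz => by
    have := hexp z; rwa [max_eq_right hz, mul_zero, Real.exp_zero, mul_one] at this
  -- Dividing by `1 + z` removes the linear growth along the positive axis.
  set g : ℂ → ℂ := fun z => H z / (1 + z) with hg
  have hone : ∀ z : ℂ, 0 ≤ z.re → 1 ≤ ‖1 + z‖ := fun z hz => by
    refine le_trans ?_ (Complex.re_le_norm _); simpa using hz
  have hne : ∀ z : ℂ, 0 ≤ z.re → 1 + z ≠ 0 := fun z hz h => by
    have := hone z hz; rw [h, norm_zero] at this; linarith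
  have hgle : ∀ z : ℂ, 0 ≤ z.re → ‖g z‖ ≤ ‖H z‖ := fun z hz => by
    rw [hg]; simp only [norm_div]; exact div_le_self (norm_nonneg _) (hone z hz)
  have hgd : ∀ s : Set ℂ, s ⊆ {z : ℂ | 0 ≤ z.re} → DifferentiableOn ℂ g s := fun s hs z hz =>
    ((hd z).div (by fun_prop) (hne z (hs hz))).differentiableWithinAt
  have hclosed : IsClosed {z : ℂ | 0 ≤ z.re} := isClosed_le continuous_const Complex.continuous_re
  have hdc : ∀ s : Set ℂ, s ⊆ {z : ℂ | 0 ≤ z.re} → DiffContOnCl ℂ g s := fun s hs =>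
    (hgd _ (closure_minimal hs hclosed)).diffContOnCl
  have hB : ∀ s : Set ℂ, s ⊆ {z : ℂ | 0 ≤ z.re} → ∃ c < (2 : ℝ), ∃ B,
      g =O[Bornology.cobounded ℂ ⊓ 𝓟 s] fun z => Real.exp (B * ‖z‖ ^ c) := by
    refine fun s hs => ⟨1, by norm_num, A, Asymptotics.IsBigO.of_bound K ?_⟩
    filter_upwards [mem_inf_of_right (mem_principal_self s)] with z hz
    refine (hgle z (hs hz)).trans ((hexp z).trans ?_)
    rw [Real.rpow_one, Real.norm_eq_abs, Real.abs_exp]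
    gcongr
    exact max_le (Complex.re_le_norm z) (norm_nonneg z)
  have hgre : ∀ x : ℝ, 0 ≤ x → ‖g x‖ ≤ max C K := fun x hx => by
    have e : ‖(1 : ℂ) + x‖ = 1 + x := by
      rw [← Complex.ofReal_one, ← Complex.ofReal_add, Complex.norm_real, Real.norm_eq_abs,
        abs_of_nonneg (by linarith)]
    rw [hg]
    simp only [norm_div, e]
    rw [div_le_iff₀ (by linarith)]
    refine (hreal x hx).trans ?_
    gcongr
    exact le_max_left _ _
  have hgim : ∀ x : ℝ, ‖g (x * Complex.I)‖ ≤ max C K := fun x =>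
    (hgle _ (by simp)).trans ((hleft _ (by simp)).trans (le_max_right _ _))
  have hright : ∀ z : ℂ, 0 ≤ z.re → ‖g z‖ ≤ max C K := by
    intro z hz
    rcases le_total 0 z.im with him | him
    · exact PhragmenLindelof.quadrant_I (hdc _ fun z hz => le_of_lt (show 0 < z.re from hz.1))
        (hB _ fun z hz => le_of_lt (show 0 < z.re from hz.1))
        hgre (fun x _ => hgim x) hz him
    · exact PhragmenLindelof.quadrant_IV (hdc _ fun z hz => le_of_lt (show 0 < z.re from hz.1))
        (hB _ fun z hz => le_of_lt (show 0 < z.re from hz.1))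
        hgre (fun x _ => hgim x) hz him
  set M := max C K with hM
  have hM0 : 0 ≤ M := hC.trans (le_max_left _ _)
  have hlin : ∀ z : ℂ, ‖H z‖ ≤ M * (1 + ‖z‖) := by
    intro z
    rcases le_total 0 z.re with hz | hz
    · have h1 : H z = g z * (1 + z) := by rw [hg]; simp only; rw [div_mul_cancel₀ _ (hne z hz)]
      rw [h1, norm_mul]
      exact mul_le_mul (hright z hz) ((norm_add_le _ _).trans (by simp)) (norm_nonneg _) hM0
    · refine (hleft z hz).trans ((le_max_right C K).trans ?_)
      rw [← hM]
      nlinarith [norm_nonneg z]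
  -- Linear growth makes the slope at `0` bounded, so `H` is affine by Liouville's theorem.
  have hslope : Differentiable ℂ (dslope H 0) :=
    differentiableOn_univ.1 ((Complex.differentiableOn_dslope univ_mem).2 hd.differentiableOn)
  have hbdd : Bornology.IsBounded (range (dslope H 0)) := by
    obtain ⟨B, hB⟩ := (isCompact_closedBall (0 : ℂ) 1).exists_bound_of_continuousOn
      hslope.continuous.continuousOn
    refine isBounded_iff_forall_norm_le.2 ⟨max B (2 * M + ‖H 0‖), ?_⟩
    rintro _ ⟨z, rfl⟩
    rcases le_or_gt ‖z‖ 1 with hz | hz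
    · exact (hB z (by simpa using hz)).trans (le_max_left _ _)
    · refine le_trans ?_ (le_max_right _ _)
      have hz0 : z ≠ 0 := fun h => by rw [h, norm_zero] at hz; linarith
      rw [dslope_of_ne _ hz0, slope_def_module, sub_zero, norm_smul, norm_inv,
        inv_mul_le_iff₀ (by linarith)]
      have := norm_sub_le (H z) (H 0)
      have h2 := hlin z
      nlinarith [norm_nonneg (H 0)]
  set k := dslope H 0 0 with hk
  have hform : ∀ z, H z = H 0 + z * k := by
    intro z
    have h1 := sub_smul_dslope H 0 z
    rw [hslope.apply_eq_apply_of_bounded hbdd z 0, sub_zero, smul_eq_mul] at h1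
    rw [hk, h1]; ring
  have hk0 : k = 0 := by
    by_contra hne
    have hkpos : 0 < ‖k‖ := norm_pos_iff.2 hne
    set x : ℝ := (K + ‖H 0‖ + 1) / ‖k‖ with hx
    have hx0 : 0 ≤ x := by positivity
    have h1 := hleft (-(x : ℂ)) (by simpa using hx0)
    rw [hform] at h1
    have h2 : ‖-(x : ℂ) * k‖ = K + ‖H 0‖ + 1 := by
      rw [norm_mul, norm_neg, Complex.norm_real, Real.norm_eq_abs, abs_of_nonneg hx0, hx,
        div_mul_cancel₀ _ hkpos.ne']
    have h3 := norm_sub_le (H 0 + -(x : ℂ) * k) (H 0)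
    rw [add_sub_cancel_left, h2] at h3
    linarith
  rw [hform z, hk0, mul_zero, add_zero]

/-- Write `U` for the Laplace transform. The entire function `z ↦ ∫₀¹ U(z + s)² ds` grows at most
linearly on the positive axis, so it is constant, and `U²` has period `1`. As `U(z - n) → 0`, this
forces `U = 0`. -/
lemma laplace_eq_zero_of_window_bound {T : ℝ} (hT : 0 ≤ T) {u : ℝ → ℝ}
    (hu : IntegrableOn u (Ioo 0 T)) {c X C : ℝ} (hc : 0 < c) (hX : 0 ≤ X)
    (h : ∀ a b, X ≤ a → a ≤ b → b ≤ a + c⁻¹ →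
      ∫ η in a..b, (∫ t in Ioo 0 T, Real.exp ((c * η) ^ 2 * t) * u t) ^ 2 ≤ C) (z : ℂ) :
    laplace T u z = 0 := by
  set U := laplace T u with hU
  have hUd : Differentiable ℂ U := differentiable_laplace hu
  have hU2 : Differentiable ℂ (fun z => U z ^ 2) := hUd.pow 2
  obtain ⟨G, hG⟩ := hU2.isExactOn_univ
  have hG' : ∀ z, HasDerivAt G (U z ^ 2) z := fun z => hG z (mem_univ z)
  set H : ℂ → ℂ := fun z => G (z + 1) - G z with hH
  have hHd' : ∀ z, HasDerivAt H (U (z + 1) ^ 2 - U z ^ 2) z := fun z =>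
    ((hG' (z + 1)).comp_add_const z 1).sub (hG' z)
  have hHd : Differentiable ℂ H := fun z => (hHd' z).differentiableAt
  have hHint : ∀ z, H z = ∫ s in (0 : ℝ)..1, U (z + s) ^ 2 := by
    intro z
    have hcont : Continuous fun s : ℝ => U (z + s) ^ 2 :=
      hU2.continuous.comp (continuous_const.add Complex.continuous_ofReal)
    rw [intervalIntegral.integral_eq_sub_of_hasDerivAt (f := fun s : ℝ => G (z + s))
      (fun s _ => ?_) (hcont.intervalIntegrable _ _)]
    · simp [hH]
    · have h1 := (hG' (z + s)).comp_const_add z (s : ℂ)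
      exact h1.comp_ofReal
  set I := ∫ t in Ioo 0 T, |u t| with hI
  have hI0 : 0 ≤ I := integral_nonneg fun _ => abs_nonneg _
  have hexp : ∀ z, ‖H z‖ ≤ (Real.exp T * I) ^ 2 * Real.exp (2 * T * max z.re 0) := by
    intro z
    rw [hHint]
    have := intervalIntegral.norm_integral_le_of_norm_le_const (a := (0 : ℝ)) (b := 1)
      (f := fun s : ℝ => U (z + s) ^ 2)
      (C := (Real.exp T * I) ^ 2 * Real.exp (2 * T * max z.re 0)) ?_
    · simpa using this
    · intro s hs
      rw [uIoc_of_le zero_le_one] at hs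
      rw [norm_pow]
      have e : (Real.exp T * I) ^ 2 * Real.exp (2 * T * max z.re 0)
          = (Real.exp ((max z.re 0 + 1) * T) * I) ^ 2 := by
        rw [mul_pow, mul_pow, ← Real.exp_nat_mul, ← Real.exp_nat_mul, mul_right_comm,
          ← Real.exp_add]
        congr 2; push_cast; ring
      rw [e]
      refine pow_le_pow_left₀ (norm_nonneg _) ((norm_laplace_le hu _).trans ?_) 2
      gcongr
      simp only [Complex.add_re, Complex.ofReal_re]
      refine max_le ?_ (by positivity)
      linarith [le_max_left z.re 0, hs.2]
  set V : ℝ → ℝ := fun s => ∫ t in Ioo 0 T, Real.exp (s * t) * u t with hV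
  have hVU : ∀ s : ℝ, U s = V s := fun s => laplace_ofReal s
  have hVc : Continuous V := by
    have : V = fun s : ℝ => (U s).re := by funext s; rw [hVU, Complex.ofReal_re]
    rw [this]
    exact Complex.continuous_re.comp (hUd.continuous.comp Complex.continuous_ofReal)
  -- On the positive axis `H` is a window average of `V ^ 2`, estimated by substituting
  -- `s = (c η) ^ 2`: the window `[x, x + 1]` becomes one of length at most `c⁻¹` in `η`, and the
  -- Jacobian `2 c² η` accounts for the factor `1 + x`.
  have hreal : ∃ B, ∀ x : ℝ, 0 ≤ x → ‖H x‖ ≤ B * (1 + x) := by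
    obtain ⟨B, hB⟩ := (isCompact_Icc (a := (0 : ℝ)) (b := (c * X) ^ 2)).exists_bound_of_continuousOn
      (f := fun x : ℝ => H x) (hHd.continuous.comp Complex.continuous_ofReal).continuousOn
    have hC0 : 0 ≤ C := by simpa using h X X le_rfl le_rfl (by simpa using hc.le)
    refine ⟨max B (4 * c * C), fun x hx => ?_⟩
    rcases le_or_gt x ((c * X) ^ 2) with hle | hgt
    · have h1 := hB x ⟨hx, hle⟩
      have h2 : 0 ≤ B := (norm_nonneg _).trans h1
      have h3 := le_max_left B (4 * c * C)
      nlinarith [h3.trans (le_mul_of_one_le_right (h2.trans h3) (by linarith : 1 ≤ 1 + x))]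
    · set a := √x / c with ha
      set b := √(x + 1) / c with hb
      have hca : (c * a) ^ 2 = x := by
        rw [ha, mul_div_cancel₀ _ hc.ne', Real.sq_sqrt hx]
      have hcb : (c * b) ^ 2 = x + 1 := by
        rw [hb, mul_div_cancel₀ _ hc.ne', Real.sq_sqrt (by linarith)]
      have hab : a ≤ b := by
        rw [ha, hb]; gcongr; linarith
      have hXa : X ≤ a := by
        rw [ha, le_div_iff₀ hc, mul_comm]
        exact Real.le_sqrt_of_sq_le hgt.le
      have hb0 : 0 ≤ b := hX.trans (hXa.trans hab)
      have e1 : H x = ((∫ s in x..x + 1, V s ^ 2 : ℝ) : ℂ) := by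
        rw [hHint, ← intervalIntegral.integral_ofReal]
        have := intervalIntegral.integral_comp_add_left (a := 0) (b := 1)
          (fun s : ℝ => ((V s ^ 2 : ℝ) : ℂ)) x
        rw [add_zero] at this
        rw [← this]
        congr 1
        funext s
        rw [← Complex.ofReal_add, hVU]; push_cast; ring
      have e2 : ∫ s in x..x + 1, V s ^ 2
          = ∫ η in a..b, V ((c * η) ^ 2) ^ 2 * (2 * (c * η) * c) := by
        have := intervalIntegral.integral_comp_mul_deriv (a := a) (b := b)
          (f := fun η => (c * η) ^ 2) (f' := fun η => 2 * (c * η) * c) (g := fun s => V s ^ 2)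
          (fun η _ => by
            have := ((hasDerivAt_id η).const_mul c).fun_pow 2
            simpa using this) (by fun_prop) (hVc.pow 2)
        simp only [hca, hcb] at this
        rw [← this]; rfl
      have cI : Continuous fun η => V ((c * η) ^ 2) ^ 2 := (hVc.comp (by fun_prop)).pow 2
      have e3 : ∫ η in a..b, V ((c * η) ^ 2) ^ 2 * (2 * (c * η) * c)
          ≤ ∫ η in a..b, V ((c * η) ^ 2) ^ 2 * (2 * (c * b) * c) := by
        refine intervalIntegral.integral_mono_on hab
          ((cI.mul (by fun_prop)).intervalIntegrable _ _)
          ((cI.mul continuous_const).intervalIntegrable _ _) fun η hη => ?_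
        gcongr
        exact hη.2
      rw [intervalIntegral.integral_mul_const] at e3
      have hbc : b ≤ a + c⁻¹ := by
        rw [ha, hb, ← one_div, ← add_div]
        gcongr
        refine Real.sqrt_le_iff.2 ⟨by positivity, ?_⟩
        nlinarith [Real.sq_sqrt hx, Real.sqrt_nonneg x]
      have e4 := h a b hXa hab hbc
      have e5 : 0 ≤ ∫ s in x..x + 1, V s ^ 2 :=
        intervalIntegral.integral_nonneg (by linarith) fun _ _ => sq_nonneg _
      rw [e1, Complex.norm_real, Real.norm_eq_abs, abs_of_nonneg e5, e2]
      have hcb1 : c * b ≤ 1 + x := by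
        nlinarith [sq_nonneg (c * b - 1)]
      calc _ ≤ _ := e3
        _ ≤ C * (2 * (1 + x) * c) := by gcongr
        _ ≤ 4 * c * C * (1 + x) := by
          have : 0 ≤ c * C * (1 + x) := by positivity
          nlinarith
        _ ≤ _ := by gcongr; exact le_max_right _ _
  obtain ⟨B, hreal⟩ := hreal
  have hper : ∀ z, U (z + 1) ^ 2 = U z ^ 2 := by
    intro z
    have hc : H = fun _ => H 0 :=
      funext fun z => entire_eq_const_of_growth hHd (by positivity) hexp hreal z
    have h1 := hHd' z
    rw [hc] at h1
    exact sub_eq_zero.1 (h1.unique (hasDerivAt_const z (H 0)))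
  have hper' : ∀ n : ℕ, U (z - n) ^ 2 = U z ^ 2 := by
    intro n
    induction n with
    | zero => simp
    | succ n ih => rw [← ih, ← hper (z - (n + 1 : ℕ))]; congr 2; push_cast; ring
  have hlim := (tendsto_laplace_sub_nat hu z).pow 2
  simp only [← hU, hper'] at hlim
  have := tendsto_nhds_unique hlim tendsto_const_nhds
  simpa using this.symm

/-! ### High-frequency solutions of the Schrödinger equation -/

/-- The half-line version of `exists_integral_limits`: the tail `∫_y^∞ |g|` is at most
`N / (1 + |y|)` by Chebyshev's inequality. -/
lemma exists_integral_limit {g : ℝ → ℝ} (hgc : Continuous g) {N : ℝ}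
    (hg : Integrable fun y => (1 + |y|) * |g y|) (hN : ∫ y, (1 + |y|) * |g y| ≤ N) :
    ∃ s, |s| ≤ N ∧ ∀ y, 0 ≤ y → |(∫ t in (0 : ℝ)..y, g t) - s| ≤ N / (1 + |y|) := by
  have h1 : ∀ y, |g y| ≤ (1 + |y|) * |g y| := fun y =>
    le_mul_of_one_le_left (abs_nonneg _) (by linarith [abs_nonneg y])
  have hgi : Integrable g := hg.mono' hgc.aestronglyMeasurable (Eventually.of_forall h1)
  have key : ∀ y, 0 ≤ y → |∫ t in Ioi y, g t| ≤ N / (1 + |y|) := by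
    intro y hy
    have hpos : 0 < 1 + |y| := by positivity
    rw [le_div_iff₀ hpos]
    calc |∫ t in Ioi y, g t| * (1 + |y|) ≤ (∫ t in Ioi y, |g t|) * (1 + |y|) := by
          gcongr; exact abs_integral_le_integral_abs
      _ = ∫ t in Ioi y, |g t| * (1 + |y|) := (integral_mul_const _ _).symm
      _ ≤ ∫ t in Ioi y, (1 + |t|) * |g t| := by
          refine setIntegral_mono_on (hgi.abs.mul_const _).integrableOn hg.integrableOn
            measurableSet_Ioi fun t ht => ?_
          rw [mul_comm]
          gcongr
          exact le_of_lt ht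
      _ ≤ ∫ t, (1 + |t|) * |g t| :=
          setIntegral_le_integral hg (Eventually.of_forall fun t => by positivity)
      _ ≤ N := hN
  refine ⟨∫ t in Ioi 0, g t, by simpa using key 0 le_rfl, fun y hy => ?_⟩
  have h2 := intervalIntegral.integral_interval_add_Ioi (a := 0) (b := y)
    hgi.integrableOn hgi.integrableOn
  rw [← h2, sub_add_cancel_left, abs_neg]
  exact key y hy

/-- For `g` with an integrable first moment, its primitive has limits at `±∞`, approached at the
rate `1 / |y|`. -/
lemma exists_integral_limits {g : ℝ → ℝ} (hgc : Continuous g) {N : ℝ}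
    (hg : Integrable fun y => (1 + |y|) * |g y|) (hN : ∫ y, (1 + |y|) * |g y| ≤ N) :
    ∃ s r, |s| ≤ N ∧ |r| ≤ N ∧
      (∀ y, 0 ≤ y → |(∫ t in (0 : ℝ)..y, g t) - s| ≤ N / (1 + |y|)) ∧
      ∀ y, y ≤ 0 → |(∫ t in (0 : ℝ)..y, g t) - r| ≤ N / (1 + |y|) := by
  obtain ⟨s, hs, hs'⟩ := exists_integral_limit hgc hg hN
  have h1 : Integrable fun y => (1 + |y|) * |g (-y)| := by simpa using hg.comp_neg
  have h2 : ∫ y, (1 + |y|) * |g (-y)| ≤ N := by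
    have := integral_neg_eq_self (fun y => (1 + |y|) * |g y|) volume
    simp only [abs_neg] at this
    rwa [this]
  obtain ⟨r, hr, hr'⟩ := exists_integral_limit (hgc.comp continuous_neg) h1 h2
  refine ⟨s, -r, hs, by rwa [abs_neg], hs', fun y hy => ?_⟩
  have := hr' (-y) (by linarith)
  rw [abs_neg] at this
  have e : ∫ t in (0 : ℝ)..-y, g (-t) = -∫ t in (0 : ℝ)..y, g t := by
    rw [intervalIntegral.integral_comp_neg, neg_neg, neg_zero, intervalIntegral.integral_symm]
  simp only [Function.comp_def, e] at this
  rw [← abs_neg]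
  convert this using 2
  ring

/-- A solution of `-φ'' + Vφ = ξ²φ` with `φ(0) = 1`, bounded together with `φ'`, and asymptotic to a
trigonometric function of frequency `ξ` on each half-line. -/
structure HighFrequencySolution (V : ℝ → ℝ) (ξ : ℝ) where
  φ : ℝ → ℝ
  dφ : ℝ → ℝ
  map_zero : φ 0 = 1
  hasDerivAt : ∀ y, HasDerivAt φ (dφ y) y
  hasDerivAt_d : ∀ y, HasDerivAt dφ ((V y - ξ ^ 2) * φ y) y
  bound : ∀ y, |φ y| ≤ 2
  dbound : ∃ B, ∀ y, |dφ y| ≤ B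
  right : ∃ a b, |a| ≤ 2 ∧ |b| ≤ 2 ∧
    ∀ y, 0 ≤ y → |φ y - (a * Real.cos (ξ * y) + b * Real.sin (ξ * y))| ≤ 2 / (1 + |y|)
  left : ∃ a b, |a| ≤ 2 ∧ |b| ≤ 2 ∧
    ∀ y, y ≤ 0 → |φ y - (a * Real.cos (ξ * y) + b * Real.sin (ξ * y))| ≤ 2 / (1 + |y|)

section volterra

variable {V : ℝ → ℝ} {ξ : ℝ}

lemma integrable_of_moment (hV : Continuous V) (hm : Integrable fun y => (1 + |y|) * |V y|) :
    Integrable V :=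
  hm.mono' hV.aestronglyMeasurable (Eventually.of_forall fun y =>
    le_mul_of_one_le_left (abs_nonneg _) (by linarith [abs_nonneg y]))

lemma abs_integral_trig_le (hV : Continuous V) (hm : Integrable fun y => (1 + |y|) * |V y|)
    {e f : ℝ → ℝ} (he1 : ∀ s, |e s| ≤ 1) {N : ℝ} (hf : ∀ s, |f s| ≤ N) (y : ℝ) :
    |∫ s in (0 : ℝ)..y, e s * (V s * f s)| ≤ (∫ s, (1 + |s|) * |V s|) * N := by
  have hN : 0 ≤ N := (abs_nonneg _).trans (hf 0)
  have hVi := (integrable_of_moment hV hm).abs.mul_const N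
  have h1 : ∀ s, ‖e s * (V s * f s)‖ ≤ |V s| * N := fun s => by
    rw [Real.norm_eq_abs, abs_mul, abs_mul]
    calc |e s| * (|V s| * |f s|) ≤ 1 * (|V s| * N) := by
          gcongr
          · exact he1 s
          · exact hf s
      _ = _ := one_mul _
  calc _ ≤ |∫ s in (0 : ℝ)..y, |V s| * N| :=
        intervalIntegral.norm_integral_le_abs_of_norm_le (ae_of_all _ h1) hVi.intervalIntegrable
    _ ≤ ∫ s in uIoc 0 y, |V s| * N := by
        rw [intervalIntegral.abs_integral_eq_abs_integral_uIoc, abs_of_nonneg]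
        exact integral_nonneg fun s => by positivity
    _ ≤ ∫ s, |V s| * N :=
        setIntegral_le_integral hVi (Eventually.of_forall fun s => by positivity)
    _ ≤ _ := by
        rw [integral_mul_const]
        refine mul_le_mul_of_nonneg_right (integral_mono (integrable_of_moment hV hm).abs hm
          fun s => le_mul_of_one_le_left (abs_nonneg _) ?_) hN
        linarith [abs_nonneg s]

/-- The Volterra operator `f ↦ cos ξy + ξ⁻¹ ∫₀ʸ sin (ξ(y - s)) V(s) f(s) ds`, with the kernel
expanded by the addition formula. -/
noncomputable def volterra (V : ℝ → ℝ) (ξ : ℝ) (f : ℝ → ℝ) (y : ℝ) : ℝ :=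
  Real.cos (ξ * y) + ξ⁻¹ * (Real.sin (ξ * y) * (∫ s in (0 : ℝ)..y, Real.cos (ξ * s) * (V s * f s))
    - Real.cos (ξ * y) * ∫ s in (0 : ℝ)..y, Real.sin (ξ * s) * (V s * f s))

lemma continuous_volterra (hV : Continuous V) {f : ℝ → ℝ} (hf : Continuous f) :
    Continuous (volterra V ξ f) := by
  have h1 : Continuous fun y => ∫ s in (0 : ℝ)..y, Real.cos (ξ * s) * (V s * f s) :=
    intervalIntegral.continuous_primitive
      (fun a b => Continuous.intervalIntegrable (by fun_prop) a b) 0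
  have h2 : Continuous fun y => ∫ s in (0 : ℝ)..y, Real.sin (ξ * s) * (V s * f s) :=
    intervalIntegral.continuous_primitive
      (fun a b => Continuous.intervalIntegrable (by fun_prop) a b) 0
  unfold volterra
  fun_prop

/-- At high frequency the perturbation term of the Volterra operator has norm at most `1 / 2`. -/
lemma abs_volterra_sub_cos_le (hV : Continuous V) (hm : Integrable fun y => (1 + |y|) * |V y|)
    (hξ : 4 * (∫ y, (1 + |y|) * |V y|) + 1 ≤ ξ) {f : ℝ → ℝ} {N : ℝ} (hf : ∀ s, |f s| ≤ N) (y : ℝ) :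
    |volterra V ξ f y - Real.cos (ξ * y)| ≤ N / 2 := by
  have hM : 0 ≤ ∫ y, (1 + |y|) * |V y| := integral_nonneg fun y => by positivity
  have hN : 0 ≤ N := (abs_nonneg _).trans (hf 0)
  set M := ∫ y, (1 + |y|) * |V y| with hMdef
  have hξ0 : 0 < ξ := by linarith
  have h1 := abs_integral_trig_le hV hm (fun s => Real.abs_cos_le_one (ξ * s)) hf y
  have h2 := abs_integral_trig_le hV hm (fun s => Real.abs_sin_le_one (ξ * s)) hf y
  rw [volterra, add_sub_cancel_left, abs_mul, abs_inv, abs_of_pos hξ0, inv_mul_le_iff₀ hξ0]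
  calc _ ≤ |Real.sin (ξ * y)| * _ + |Real.cos (ξ * y)| * _ := by
        rw [← abs_mul, ← abs_mul]; exact abs_sub _ _
    _ ≤ 1 * (M * N) + 1 * (M * N) := by
        gcongr
        · exact Real.abs_sin_le_one _
        · exact Real.abs_cos_le_one _
    _ ≤ ξ * (N / 2) := by nlinarith

lemma volterra_sub (hV : Continuous V) {f g : ℝ → ℝ} (hf : Continuous f) (hg : Continuous g)
    (y : ℝ) : volterra V ξ f y - volterra V ξ g y
      = volterra V ξ (fun s => f s - g s) y - Real.cos (ξ * y) := by
  have h1 : ∀ e : ℝ → ℝ, Continuous e → ∫ s in (0 : ℝ)..y, e s * (V s * (f s - g s))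
      = (∫ s in (0 : ℝ)..y, e s * (V s * f s)) - ∫ s in (0 : ℝ)..y, e s * (V s * g s) := by
    intro e he
    rw [← intervalIntegral.integral_sub (Continuous.intervalIntegrable (by fun_prop) _ _)
      (Continuous.intervalIntegrable (by fun_prop) _ _)]
    congr 1; funext s; ring
  simp only [volterra]
  rw [h1 (fun s => Real.cos (ξ * s)) (by fun_prop), h1 (fun s => Real.sin (ξ * s)) (by fun_prop)]
  ring

open scoped BoundedContinuousFunction in
lemma exists_volterra_fixed (hV : Continuous V) (hm : Integrable fun y => (1 + |y|) * |V y|)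
    (hξ : 4 * (∫ y, (1 + |y|) * |V y|) + 1 ≤ ξ) :
    ∃ f : ℝ → ℝ, Continuous f ∧ (∀ y, |f y| ≤ 2) ∧ volterra V ξ f = f := by
  have hb : ∀ f : ℝ →ᵇ ℝ, ∀ s, |f s| ≤ ‖f‖ := fun f s => f.norm_coe_le_norm s
  have hb2 : ∀ f : ℝ →ᵇ ℝ, ∀ y, ‖volterra V ξ f y‖ ≤ 1 + ‖f‖ / 2 := by
    intro f y
    have h1 := abs_volterra_sub_cos_le hV hm hξ (hb f) y
    have h2 := abs_add_le (volterra V ξ f y - Real.cos (ξ * y)) (Real.cos (ξ * y))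
    rw [sub_add_cancel] at h2
    rw [Real.norm_eq_abs]
    linarith [Real.abs_cos_le_one (ξ * y)]
  set Φ : (ℝ →ᵇ ℝ) → (ℝ →ᵇ ℝ) := fun f =>
    BoundedContinuousFunction.ofNormedAddCommGroup (volterra V ξ f)
      (continuous_volterra hV f.continuous) _ (hb2 f) with hΦ
  have hcontr : ContractingWith (1 / 2) Φ := by
    refine ⟨by rw [← NNReal.coe_lt_coe]; norm_num, LipschitzWith.of_dist_le_mul fun f g => ?_⟩
    rw [BoundedContinuousFunction.dist_le (by positivity)]
    intro y
    have h1 := abs_volterra_sub_cos_le hV hm hξ (hb (f - g)) y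
    rw [Real.dist_eq, dist_eq_norm]
    have h2 := volterra_sub (ξ := ξ) hV f.continuous g.continuous y
    calc |volterra V ξ f y - volterra V ξ g y|
          = |volterra V ξ (f - g : ℝ →ᵇ ℝ) y - Real.cos (ξ * y)| := by rw [h2]; rfl
      _ ≤ ‖f - g‖ / 2 := h1
      _ = _ := by push_cast; ring
  have hfix : Φ (ContractingWith.fixedPoint Φ hcontr) = ContractingWith.fixedPoint Φ hcontr :=
    hcontr.fixedPoint_isFixedPt
  set f := ContractingWith.fixedPoint Φ hcontr with hf
  have hfix' : volterra V ξ f = f := congrArg (fun F : ℝ →ᵇ ℝ => (F : ℝ → ℝ)) hfix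
  refine ⟨f, f.continuous, fun y => ?_, hfix'⟩
  have h1 : ‖f‖ ≤ 1 + ‖f‖ / 2 := by
    refine (BoundedContinuousFunction.norm_le (by positivity)).2 fun y => ?_
    have := hb2 f y
    rwa [hfix'] at this
  linarith [hb f y]

/-- At high frequency the Volterra operator is a contraction; its fixed point is the solution. -/
lemma nonempty_highFrequencySolution (hV : Continuous V)
    (hm : Integrable fun y => (1 + |y|) * |V y|) (hξ : 4 * (∫ y, (1 + |y|) * |V y|) + 1 ≤ ξ) :
    Nonempty (HighFrequencySolution V ξ) := by
  obtain ⟨f, hfc, hf2, hfix⟩ := exists_volterra_fixed hV hm hξ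
  have hM : 0 ≤ ∫ y, (1 + |y|) * |V y| := integral_nonneg fun y => by positivity
  set M := ∫ y, (1 + |y|) * |V y| with hMdef
  have hξ0 : 0 < ξ := by linarith
  set C : ℝ → ℝ := fun y => ∫ s in (0 : ℝ)..y, Real.cos (ξ * s) * (V s * f s) with hC
  set S : ℝ → ℝ := fun y => ∫ s in (0 : ℝ)..y, Real.sin (ξ * s) * (V s * f s) with hS
  have hfy : ∀ y, f y = Real.cos (ξ * y)
      + ξ⁻¹ * (Real.sin (ξ * y) * C y - Real.cos (ξ * y) * S y) := fun y => by
    conv_lhs => rw [← hfix]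
    rfl
  have hdC : ∀ y, HasDerivAt C (Real.cos (ξ * y) * (V y * f y)) y := fun y =>
    intervalIntegral.integral_hasDerivAt_right (Continuous.intervalIntegrable (by fun_prop) _ _)
      (Continuous.stronglyMeasurableAtFilter (by fun_prop) _ _)
      (Continuous.continuousAt (by fun_prop))
  have hdS : ∀ y, HasDerivAt S (Real.sin (ξ * y) * (V y * f y)) y := fun y =>
    intervalIntegral.integral_hasDerivAt_right (Continuous.intervalIntegrable (by fun_prop) _ _)
      (Continuous.stronglyMeasurableAtFilter (by fun_prop) _ _)
      (Continuous.continuousAt (by fun_prop))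
  have hdcos : ∀ y, HasDerivAt (fun y => Real.cos (ξ * y)) (-Real.sin (ξ * y) * ξ) y := fun y => by
    simpa using ((hasDerivAt_id y).const_mul ξ).cos
  have hdsin : ∀ y, HasDerivAt (fun y => Real.sin (ξ * y)) (Real.cos (ξ * y) * ξ) y := fun y => by
    simpa using ((hasDerivAt_id y).const_mul ξ).sin
  set df : ℝ → ℝ := fun y => -ξ * Real.sin (ξ * y)
    + (Real.cos (ξ * y) * C y + Real.sin (ξ * y) * S y) with hdf
  have hCb : ∀ y, |C y| ≤ M * 2 :=
    abs_integral_trig_le hV hm (fun s => Real.abs_cos_le_one (ξ * s)) hf2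
  have hSb : ∀ y, |S y| ≤ M * 2 :=
    abs_integral_trig_le hV hm (fun s => Real.abs_sin_le_one (ξ * s)) hf2
  -- Both `C` and `S` have limits at `±∞`, and these give the asymptotic amplitudes.
  have hmom : ∀ e : ℝ → ℝ, Continuous e → (∀ s, |e s| ≤ 1) →
      Integrable (fun y => (1 + |y|) * |e y * (V y * f y)|) ∧
        ∫ y, (1 + |y|) * |e y * (V y * f y)| ≤ M * 2 := by
    intro e he he1
    have hle : ∀ y, (1 + |y|) * |e y * (V y * f y)| ≤ (1 + |y|) * |V y| * 2 := fun y => by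
      rw [abs_mul, abs_mul]
      calc (1 + |y|) * (|e y| * (|V y| * |f y|)) ≤ (1 + |y|) * (1 * (|V y| * 2)) := by
            gcongr
            · exact he1 y
            · exact hf2 y
        _ = _ := by ring
    have hi : Integrable (fun y => (1 + |y|) * |e y * (V y * f y)|) := by
      refine (hm.mul_const 2).mono' (Continuous.aestronglyMeasurable (by fun_prop))
        (Eventually.of_forall fun y => ?_)
      rw [Real.norm_eq_abs, abs_of_nonneg (by positivity)]
      exact hle y
    refine ⟨hi, ?_⟩
    rw [hMdef, ← integral_mul_const]
    exact integral_mono hi (hm.mul_const 2) hle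
  obtain ⟨hc1, hc2⟩ := hmom (fun s => Real.cos (ξ * s)) (by fun_prop)
    fun s => Real.abs_cos_le_one _
  obtain ⟨hs1, hs2⟩ := hmom (fun s => Real.sin (ξ * s)) (by fun_prop)
    fun s => Real.abs_sin_le_one _
  obtain ⟨c₁, c₂, hc₁, hc₂, hcr, hcl⟩ := exists_integral_limits (by fun_prop) hc1 hc2
  obtain ⟨s₁, s₂, hs₁, hs₂, hsr, hsl⟩ := exists_integral_limits (by fun_prop) hs1 hs2
  have hamp : ∀ c s : ℝ, |c| ≤ M * 2 → |s| ≤ M * 2 → |1 - ξ⁻¹ * s| ≤ 2 ∧ |ξ⁻¹ * c| ≤ 2 := by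
    intro c s hc hs
    have h1 : ∀ x : ℝ, |x| ≤ M * 2 → |ξ⁻¹ * x| ≤ 1 := fun x hx => by
      rw [abs_mul, abs_inv, abs_of_pos hξ0, inv_mul_le_iff₀ hξ0]; linarith
    refine ⟨?_, (h1 c hc).trans (by norm_num)⟩
    have := abs_sub 1 (ξ⁻¹ * s)
    rw [abs_one] at this
    linarith [h1 s hs]
  have hasym : ∀ c s y : ℝ, |C y - c| ≤ M * 2 / (1 + |y|) → |S y - s| ≤ M * 2 / (1 + |y|) →
      |f y - ((1 - ξ⁻¹ * s) * Real.cos (ξ * y) + ξ⁻¹ * c * Real.sin (ξ * y))|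
        ≤ 2 / (1 + |y|) := by
    intro c s y hc hs
    have hp : 0 < 1 + |y| := by positivity
    have e : f y - ((1 - ξ⁻¹ * s) * Real.cos (ξ * y) + ξ⁻¹ * c * Real.sin (ξ * y))
        = ξ⁻¹ * (Real.sin (ξ * y) * (C y - c) - Real.cos (ξ * y) * (S y - s)) := by
      rw [hfy]; ring
    rw [e, abs_mul, abs_inv, abs_of_pos hξ0, inv_mul_le_iff₀ hξ0]
    calc _ ≤ |Real.sin (ξ * y)| * |C y - c| + |Real.cos (ξ * y)| * |S y - s| := by
          rw [← abs_mul, ← abs_mul]; exact abs_sub _ _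
      _ ≤ 1 * (M * 2 / (1 + |y|)) + 1 * (M * 2 / (1 + |y|)) := by
          gcongr
          · exact Real.abs_sin_le_one _
          · exact Real.abs_cos_le_one _
      _ = (4 * M) / (1 + |y|) := by ring
      _ ≤ (ξ * 2) / (1 + |y|) := div_le_div_of_nonneg_right (by linarith) hp.le
      _ = _ := by ring
  refine ⟨{ φ := f, dφ := df, map_zero := ?_, hasDerivAt := fun y => ?_, hasDerivAt_d := fun y => ?_,
            bound := hf2, dbound := ⟨ξ + (M * 2 + M * 2), fun y => ?_⟩, right := ?_, left := ?_ }⟩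
  · rw [hfy]; simp [hC, hS]
  · have h1 := (hdcos y).add ((((hdsin y).mul (hdC y)).sub ((hdcos y).mul (hdS y))).const_mul ξ⁻¹)
    rw [show f = _ from funext hfy]
    refine h1.congr_deriv ?_
    simp only [hdf]
    field_simp
    ring
  · have h1 := ((hdsin y).const_mul (-ξ)).add
      (((hdcos y).mul (hdC y)).add ((hdsin y).mul (hdS y)))
    refine h1.congr_deriv ?_
    have h2 := Real.sin_sq_add_cos_sq (ξ * y)
    have h3 : ξ ^ 2 * f y = ξ ^ 2 * Real.cos (ξ * y)
        + ξ * (Real.sin (ξ * y) * C y - Real.cos (ξ * y) * S y) := by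
      rw [hfy]; field_simp
    rw [sub_mul, h3]
    linear_combination (V y * f y) * h2
  · rw [hdf]
    calc _ ≤ |-ξ * Real.sin (ξ * y)| + (|Real.cos (ξ * y) * C y| + |Real.sin (ξ * y) * S y|) :=
          (abs_add_le _ _).trans (by gcongr; exact abs_add_le _ _)
      _ ≤ _ := by
        rw [abs_mul, abs_mul, abs_mul, abs_neg, abs_of_pos hξ0]
        have h1 := Real.abs_sin_le_one (ξ * y)
        have h2 := Real.abs_cos_le_one (ξ * y)
        exact add_le_add (mul_le_of_le_one_right hξ0.le h1)
          (add_le_add ((mul_le_of_le_one_left (abs_nonneg _) h2).trans (hCb y))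
            ((mul_le_of_le_one_left (abs_nonneg _) h1).trans (hSb y)))
  · exact ⟨_, _, (hamp c₁ s₁ hc₁ hs₁).1, (hamp c₁ s₁ hc₁ hs₁).2,
      fun y hy => hasym c₁ s₁ y (hcr y hy) (hsr y hy)⟩
  · exact ⟨_, _, (hamp c₂ s₂ hc₂ hs₂).1, (hamp c₂ s₂ hc₂ hs₂).2,
      fun y hy => hasym c₂ s₂ y (hcl y hy) (hsl y hy)⟩

end volterra

/-! ### Even extensions -/

/-- The even extension of a `C¹` function on `[0, ∞)` with vanishing derivative at `0` is `C¹`. -/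
lemma contDiff_evenExt {G : ℝ → ℝ} (hG : ContDiffOn ℝ 1 G (Ici 0))
    (h0 : derivWithin G (Ici 0) 0 = 0) : ContDiff ℝ 1 (evenExt G) := by
  set D := derivWithin G (Ici 0) with hD
  have hDc : ContinuousOn D (Ici 0) :=
    hG.continuousOn_derivWithin (uniqueDiffOn_Ici 0) le_rfl
  have hGd : ∀ x, 0 ≤ x → HasDerivWithinAt G (D x) (Ici 0) x := fun x hx =>
    (hG.differentiableOn one_ne_zero x hx).hasDerivWithinAt
  set D' : ℝ → ℝ := fun x => if 0 ≤ x then D |x| else -D |x| with hD'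
  have hDabs : Continuous fun x : ℝ => D |x| :=
    hDc.comp_continuous continuous_abs fun x => abs_nonneg x
  have hD'c : Continuous D' := by
    refine Continuous.if_le hDabs hDabs.neg continuous_const continuous_id fun x hx => ?_
    rw [← hx, abs_zero, h0, neg_zero]
  have hpos : ∀ x, 0 < x → HasDerivAt (evenExt G) (D x) x := fun x hx => by
    refine ((hGd x hx.le).hasDerivAt (Ici_mem_nhds hx)).congr_of_eventuallyEq ?_
    filter_upwards [lt_mem_nhds hx] with y hy
    simp only [evenExt, abs_of_pos hy]
  have hd : ∀ x, HasDerivAt (evenExt G) (D' x) x := by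
    intro x
    rcases lt_trichotomy x 0 with hx | hx | hx
    · have h1 : evenExt G = fun y => evenExt G (-y) := by funext y; simp [evenExt]
      have h2 := (hpos (-x) (by linarith)).comp x (hasDerivAt_neg x)
      rw [h1]
      simpa only [hD', if_neg (not_le.2 hx), abs_of_neg hx, mul_neg, mul_one,
        Function.comp_def] using h2
    · subst hx
      have e : D' 0 = 0 := by simp [hD', h0]
      rw [e]
      have h1 : HasDerivWithinAt G 0 (Ici 0) 0 := by have := hGd 0 le_rfl; rwa [h0] at this
      have hr : HasDerivWithinAt (evenExt G) 0 (Ici 0) 0 :=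
        h1.congr (fun y hy => by simp only [evenExt, abs_of_nonneg (show 0 ≤ y from hy)])
          (by simp [evenExt])
      have hl : HasDerivWithinAt (evenExt G) 0 (Iic 0) 0 := by
        have h2 : HasDerivWithinAt (fun y => G (-y)) (0 * -1) (Iic 0) 0 :=
          HasDerivWithinAt.scomp (t' := Ici 0) (h := fun y : ℝ => -y) (x := 0) (h' := -1)
            (g₁ := G) (g₁' := 0) (by simpa using h1)
            ((hasDerivAt_neg (0 : ℝ)).hasDerivWithinAt)
            (fun y hy => by simpa using (show y ≤ 0 from hy)) |>.congr_deriv (by simp)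
        rw [zero_mul] at h2
        exact h2.congr (fun y hy => by simp only [evenExt, abs_of_nonpos (show y ≤ 0 from hy)])
          (by simp [evenExt])
      have := hl.union hr
      rwa [Iic_union_Ici, hasDerivWithinAt_univ] at this
    · simpa only [hD', if_pos hx.le, abs_of_pos hx] using hpos x hx
  rw [contDiff_one_iff_deriv]
  refine ⟨fun x => (hd x).differentiableAt, ?_⟩
  rwa [show deriv (evenExt G) = D' from funext fun x => (hd x).deriv]

namespace HeatData

variable (d : HeatData)

/-! ### Regularity of the coefficients -/

/-- The speed `σ' = √(ρ/k)` of the Liouville change of variables. -/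
noncomputable def p (x : ℝ) : ℝ := √(d.rho x / d.kappa x)

/-- The Liouville weight `ω = (ρk)^(-1/4)`. -/
noncomputable def omega (x : ℝ) : ℝ := (d.kappa x * d.rho x) ^ (-(1 / 4) : ℝ)

lemma prod_pos (x : ℝ) : 0 < d.kappa x * d.rho x := mul_pos (d.kappa_pos x) (d.rho_pos x)

lemma p_pos (x : ℝ) : 0 < d.p x := Real.sqrt_pos.2 (div_pos (d.rho_pos x) (d.kappa_pos x))

lemma p_cont : Continuous d.p :=
  Real.continuous_sqrt.comp (d.rho_cont.div d.kappa_cont fun x => (d.kappa_pos x).ne')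

lemma omega_pos (x : ℝ) : 0 < d.omega x := Real.rpow_pos_of_pos (d.prod_pos x) _

lemma prod_contDiff : ContDiff ℝ 1 fun y => d.kappa y * d.rho y := by
  have h := contDiff_evenExt (d.ρk_C2.of_le (by norm_num)) d.ρk_deriv_zero
  have e : (fun y => d.kappa y * d.rho y) = evenExt fun x => d.ρ x * d.k x := by
    funext y; simp only [kappa, rho, evenExt]; ring
  rwa [e]

lemma Q_cont : Continuous d.Q := by
  have h1 : Continuous (deriv fun y => d.kappa y * d.rho y) :=
    d.prod_contDiff.continuous_deriv le_rfl
  have h2 : Continuous fun x => √(d.kappa x / d.rho x) :=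
    Real.continuous_sqrt.comp (d.kappa_cont.div d.rho_cont fun x => (d.rho_pos x).ne')
  exact (h2.mul h1).div (continuous_const.mul (d.kappa_cont.mul d.rho_cont))
    fun x => (mul_pos four_pos (d.prod_pos x)).ne'

lemma Q_mul_p (x : ℝ) :
    d.Q x * d.p x = deriv (fun y => d.kappa y * d.rho y) x / (4 * (d.kappa x * d.rho x)) := by
  have h1 : √(d.kappa x / d.rho x) * √(d.rho x / d.kappa x) = 1 := by
    rw [← Real.sqrt_mul (div_nonneg (d.kappa_pos x).le (d.rho_pos x).le), div_mul_div_cancel₀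
      (d.rho_pos x).ne', div_self (d.kappa_pos x).ne', Real.sqrt_one]
  change √(d.kappa x / d.rho x) * deriv (fun y => d.kappa y * d.rho y) x
    / (4 * (d.kappa x * d.rho x)) * √(d.rho x / d.kappa x) = _
  rw [div_mul_eq_mul_div, mul_right_comm, h1, one_mul]

/-- `ω' = -Q₁ √(ρ/k) ω`: the Liouville weight is annihilated by `𝔻`. -/
lemma hasDerivAt_omega (x : ℝ) : HasDerivAt d.omega (-(d.Q x * d.p x) * d.omega x) x := by
  have h1 : HasDerivAt (fun y => d.kappa y * d.rho y)
      (deriv (fun y => d.kappa y * d.rho y) x) x :=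
    (d.prod_contDiff.differentiable one_ne_zero x).hasDerivAt
  have h2 := h1.rpow_const (p := -(1 / 4)) (Or.inl (d.prod_pos x).ne')
  refine h2.congr_deriv ?_
  rw [Q_mul_p, omega, Real.rpow_sub_one (d.prod_pos x).ne']
  have := (d.prod_pos x).ne'
  field_simp

lemma omega_cont : Continuous d.omega :=
  continuous_iff_continuousAt.2 fun x => (d.hasDerivAt_omega x).continuousAt

/-- `ω² ρ = σ'`: the weight turns `ρ dx` into `dσ`. -/
lemma omega_sq_mul_rho (x : ℝ) : d.omega x ^ 2 * d.rho x = d.p x := by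
  have hk := d.kappa_pos x
  have hr := d.rho_pos x
  rw [omega, ← Real.rpow_natCast, ← Real.rpow_mul (d.prod_pos x).le, p, Real.sqrt_eq_rpow,
    Real.div_rpow hr.le hk.le, Real.mul_rpow hk.le hr.le]
  norm_num
  rw [Real.rpow_neg hk.le, Real.rpow_neg hr.le]
  have h3 : d.rho x = d.rho x ^ (1 / 2 : ℝ) * d.rho x ^ (1 / 2 : ℝ) := by
    rw [← Real.rpow_add hr]; norm_num
  have h4 : d.rho x ^ (1 / 2 : ℝ) ≠ 0 := (Real.rpow_pos_of_pos hr _).ne'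
  nth_rewrite 2 [h3]
  field_simp

/-! ### The space `L²_ρ` and completeness of `ℍ¹` -/

instance : IsLocallyFiniteMeasure d.meas := IsLocallyFiniteMeasure.withDensity_ofReal d.rho_cont

lemma integral_meas (f : ℝ → ℝ) : ∫ x, f x ∂d.meas = ∫ x, f x * d.rho x := by
  rw [meas, integral_withDensity_eq_integral_toReal_smul
    d.rho_cont.measurable.ennreal_ofReal (by simp)]
  congr 1
  funext x
  rw [ENNReal.toReal_ofReal (d.rho_pos x).le, smul_eq_mul, mul_comm]

lemma inner_eq (f g : d.L2) : inner ℝ f g = ∫ x, f x * g x * d.rho x := by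
  rw [L2.inner_def, ← integral_meas]
  congr 1
  funext x
  simp [mul_comm]

lemma locallyIntegrable_L2 (f : d.L2) : LocallyIntegrable (fun x => f x) volume := by
  rw [locallyIntegrable_iff]
  intro K hK
  have h1 : IntegrableOn f K d.meas :=
    ((Lp.memLp f).locallyIntegrable (by norm_num)).integrableOn_isCompact hK
  have h1' : Integrable (fun x => f x)
    ((volume.withDensity fun x => ENNReal.ofReal (d.rho x)).restrict K) := h1
  rw [restrict_withDensity hK.measurableSet, integrable_withDensity_iff_integrable_smul'
    d.rho_cont.measurable.ennreal_ofReal (by simp)] at h1'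
  have h2 : IntegrableOn (fun x => (ENNReal.ofReal (d.rho x)).toReal • f x) K volume := h1'
  have h3 := h2.continuousOn_mul (g := fun x => (d.rho x)⁻¹)
    (d.rho_cont.inv₀ fun x => (d.rho_pos x).ne').continuousOn hK
  refine h3.congr_fun (fun x _ => ?_) hK.measurableSet
  simp only [ENNReal.toReal_ofReal (d.rho_pos x).le, smul_eq_mul]
  rw [inv_mul_cancel_left₀ (d.rho_pos x).ne']

lemma locallyIntegrable_mul_cont {f g : ℝ → ℝ} (hf : LocallyIntegrable f volume)
    (hg : Continuous g) : LocallyIntegrable (fun x => g x * f x) volume := by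
  rw [locallyIntegrable_iff]
  intro K hK
  exact (hf.integrableOn_isCompact hK).continuousOn_mul hg.continuousOn hK

lemma locallyIntegrable_deriv (f g : d.L2) :
    LocallyIntegrable (fun x => √(d.rho x / d.kappa x) * (g x - d.Q x * f x)) volume :=
  locallyIntegrable_mul_cont ((d.locallyIntegrable_L2 g).sub
    (locallyIntegrable_mul_cont (d.locallyIntegrable_L2 f) d.Q_cont)) d.p_cont

/-- The class of `η / ρ` in `L²_ρ`, so that pairing with it in `L²_ρ` is integration against `η`. -/
noncomputable def testL2 {η : ℝ → ℝ} (hη : Continuous η) (hc : HasCompactSupport η) : d.L2 :=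
  MemLp.toLp (fun x => η x / d.rho x)
    ((hη.div d.rho_cont fun x => (d.rho_pos x).ne').memLp_of_hasCompactSupport
      (by simp only [div_eq_mul_inv]; exact hc.mul_right (f' := fun x => (d.rho x)⁻¹)))

lemma inner_testL2 {η : ℝ → ℝ} (hη : Continuous η) (hc : HasCompactSupport η) (f : d.L2) :
    inner ℝ f (d.testL2 hη hc) = ∫ x, f x * η x := by
  rw [inner_eq]
  refine integral_congr_ae ?_
  filter_upwards [d.vol_ac.ae_eq (MemLp.coeFn_toLp _ :
    d.testL2 hη hc =ᵐ[d.meas] fun x => η x / d.rho x)] with x hx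
  rw [show d.testL2 hη hc x = η x / d.rho x from hx]
  have := (d.rho_pos x).ne'
  field_simp

lemma continuous_integral_mul {η : ℝ → ℝ} (hη : Continuous η) (hc : HasCompactSupport η) :
    Continuous fun f : d.L2 => ∫ x, f x * η x := by
  simp only [← d.inner_testL2 hη hc]
  fun_prop

lemma isClosed_H1 : IsClosed (d.H1 : Set (WithLp 2 (d.L2 × d.L2))) := by
  have e : (d.H1 : Set (WithLp 2 (d.L2 × d.L2))) = ⋂ η : {η : ℝ → ℝ // ContDiff ℝ ∞ η ∧
      HasCompactSupport η}, {P | (∫ x, P.fst x * deriv η.1 x) = -((∫ x, P.snd x * (d.p x * η.1 x))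
        - ∫ x, P.fst x * (d.p x * d.Q x * η.1 x))} := by
    ext P
    simp only [mem_iInter, Set.mem_ofPred_eq, Subtype.forall]
    have hsplit : ∀ η : ℝ → ℝ, ContDiff ℝ ∞ η → HasCompactSupport η →
        ∫ x, √(d.rho x / d.kappa x) * (P.snd x - d.Q x * P.fst x) * η x
          = (∫ x, P.snd x * (d.p x * η x)) - ∫ x, P.fst x * (d.p x * d.Q x * η x) := by
      intro η h1 h2
      have i1 : Integrable fun x => P.snd x * (d.p x * η x) :=
        integrable_mul_test (d.locallyIntegrable_L2 _) (d.p_cont.mul h1.continuous) h2.mul_left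
      have i2 : Integrable fun x => P.fst x * (d.p x * d.Q x * η x) :=
        integrable_mul_test (d.locallyIntegrable_L2 _)
          ((d.p_cont.mul d.Q_cont).mul h1.continuous) h2.mul_left
      rw [← integral_sub i1 i2]
      congr 1; funext x; simp only [p]; ring
    constructor
    · intro h η hη
      have h3 : IsWeakDeriv _ _ := h
      rw [← hsplit η hη.1 hη.2]
      exact h3.2.2 η hη.1 hη.2
    · intro h
      refine ⟨d.locallyIntegrable_L2 _, d.locallyIntegrable_deriv _ _, fun η h1 h2 => ?_⟩
      rw [hsplit η h1 h2]
      exact h η ⟨h1, h2⟩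
  rw [e]
  refine isClosed_iInter fun η => isClosed_eq ?_ ?_
  · exact (d.continuous_integral_mul (η.2.1.continuous_deriv (by simp)) η.2.2.deriv).comp
      (WithLp.continuous_fst _ _ _)
  · refine (Continuous.sub ?_ ?_).neg
    · exact (d.continuous_integral_mul (d.p_cont.mul η.2.1.continuous) η.2.2.mul_left).comp
        (WithLp.continuous_snd _ _ _)
    · exact (d.continuous_integral_mul ((d.p_cont.mul d.Q_cont).mul η.2.1.continuous)
        η.2.2.mul_left).comp (WithLp.continuous_fst _ _ _)

instance : CompleteSpace d.H1 := d.isClosed_H1.completeSpace_coe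

lemma norm_sq_eq (φ : d.H1) : ‖φ‖ ^ 2 = ‖d.val φ‖ ^ 2 + ‖d.D φ‖ ^ 2 := by
  rw [Submodule.coe_norm, WithLp.prod_norm_sq_eq_of_L2]
  rfl

lemma eq_zero_of_val_eq_zero {φ : d.H1} (h : d.val φ = 0) : φ = 0 := by
  have hw : IsWeakDeriv (fun x => d.val φ x)
    (fun x => √(d.rho x / d.kappa x) * (d.D φ x - d.Q x * d.val φ x)) := φ.2
  have h0 : (fun x => d.val φ x) =ᵐ[volume] fun _ => 0 := by
    rw [h]; exact d.vol_ac.ae_eq (Lp.coeFn_zero ℝ 2 d.meas)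
  have h1 : (fun x => √(d.rho x / d.kappa x) * (d.D φ x - d.Q x * d.val φ x)) =ᵐ[volume]
      fun _ => 0 := by
    refine ae_eq_of_integral_contDiff_smul_eq hw.2.1 locallyIntegrable_zero fun η h1 h2 => ?_
    have h3 := hw.2.2 η h1 h2
    have h4 : ∫ x, d.val φ x * deriv η x = 0 := by
      rw [integral_congr_ae (h0.mono fun x hx => show d.val φ x * deriv η x = (0 : ℝ) by
        simp only at hx; rw [hx, zero_mul])]
      simp
    rw [h4] at h3
    simp only [smul_eq_mul, mul_comm (η _)]
    rw [neg_eq_iff_eq_neg.1 h3.symm]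
    simp
  have hD : d.D φ = 0 := by
    rw [Lp.eq_zero_iff_ae_eq_zero]
    refine d.meas_ac.ae_eq ?_
    filter_upwards [h0, h1] with x hx0 hx1
    rw [hx0, mul_zero, sub_zero] at hx1
    exact (mul_eq_zero.1 hx1).resolve_left (d.p_pos x).ne'
  have hn := d.norm_sq_eq φ
  rw [h, hD] at hn
  simpa using hn

end HeatData

/-! ### Absolutely continuous curves -/

open AbsolutelyContinuousOnInterval in
/-- A curve whose increments are dominated by those of two absolutely continuous curves is
absolutely continuous. -/
lemma ac_of_dist_le {E F G : Type*} [PseudoMetricSpace E] [PseudoMetricSpace F]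
    [PseudoMetricSpace G] {f : ℝ → E} {g : ℝ → F} {h : ℝ → G} {a b K : ℝ}
    (hf : AbsolutelyContinuousOnInterval f a b) (hg : AbsolutelyContinuousOnInterval g a b)
    (hh : ∀ s ∈ uIcc a b, ∀ t ∈ uIcc a b,
      dist (h s) (h t) ≤ K * (dist (f s) (f t) + dist (g s) (g t))) :
    AbsolutelyContinuousOnInterval h a b := by
  refine squeeze_zero' (Eventually.of_forall fun E => Finset.sum_nonneg fun i _ => dist_nonneg) ?_
    (by simpa using (Tendsto.add hf hg).const_mul K)
  filter_upwards [mem_inf_of_right (mem_principal_self _)] with E hE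
  rw [← Finset.sum_add_distrib, Finset.mul_sum]
  exact Finset.sum_le_sum fun i hi => hh _ (hE.1 i hi).1 _ (hE.1 i hi).2

lemma ac_clm_comp {E F : Type*} [NormedAddCommGroup E] [NormedSpace ℝ E] [NormedAddCommGroup F]
    [NormedSpace ℝ F] (L : E →L[ℝ] F) {f : ℝ → E} {a b : ℝ}
    (hf : AbsolutelyContinuousOnInterval f a b) :
    AbsolutelyContinuousOnInterval (fun t => L (f t)) a b := by
  refine ac_of_dist_le (K := ‖L‖) hf hf fun s _ t _ => ?_
  rw [dist_eq_norm, ← map_sub]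
  refine (L.le_opNorm _).trans ?_
  rw [dist_eq_norm]
  exact mul_le_mul_of_nonneg_left (by linarith [norm_nonneg (f s - f t)]) (norm_nonneg L)

lemma ac_bilin {E F : Type*} [NormedAddCommGroup E] [NormedSpace ℝ E] [NormedAddCommGroup F]
    [NormedSpace ℝ F] (β : E →L[ℝ] F →L[ℝ] ℝ) {f : ℝ → E} {g : ℝ → F} {a b : ℝ}
    (hf : AbsolutelyContinuousOnInterval f a b) (hg : AbsolutelyContinuousOnInterval g a b) :
    AbsolutelyContinuousOnInterval (fun t => β (f t) (g t)) a b := by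
  obtain ⟨A, hA⟩ := isCompact_uIcc.exists_bound_of_continuousOn hf.continuousOn
  obtain ⟨B, hB⟩ := isCompact_uIcc.exists_bound_of_continuousOn hg.continuousOn
  refine ac_of_dist_le (K := ‖β‖ * (|A| + |B|)) hf hg fun s hs t ht => ?_
  have e : β (f s) (g s) - β (f t) (g t) = β (f s - f t) (g s) + β (f t) (g s - g t) := by
    simp
  have h1 := (β.le_opNorm₂ (f s - f t) (g s))
  have h2 := (β.le_opNorm₂ (f t) (g s - g t))
  have hA' := (hA t ht).trans (le_abs_self A)
  have hB' := (hB s hs).trans (le_abs_self B)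
  rw [dist_eq_norm, dist_eq_norm, dist_eq_norm, e]
  have hβ := norm_nonneg β
  calc _ ≤ ‖β‖ * ‖f s - f t‖ * ‖g s‖ + ‖β‖ * ‖f t‖ * ‖g s - g t‖ :=
        (norm_add_le _ _).trans (add_le_add h1 h2)
    _ ≤ ‖β‖ * ‖f s - f t‖ * (|A| + |B|) + ‖β‖ * (|A| + |B|) * ‖g s - g t‖ := by
        gcongr
        · linarith [abs_nonneg A]
        · linarith [abs_nonneg B]
    _ = _ := by ring

open AbsolutelyContinuousOnInterval in
lemma ac_reflect {E : Type*} [PseudoMetricSpace E] {f : ℝ → E} {τ : ℝ}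
    (hf : AbsolutelyContinuousOnInterval f 0 τ) :
    AbsolutelyContinuousOnInterval (fun t => f (τ - t)) 0 τ := by
  rw [absolutelyContinuousOnInterval_iff] at hf ⊢
  intro ε hε
  obtain ⟨δ, hδ, h⟩ := hf ε hε
  refine ⟨δ, hδ, fun E hE hlen => ?_⟩
  refine h (E.1, fun i => (τ - (E.2 i).1, τ - (E.2 i).2)) ⟨fun i hi => ?_, ?_⟩ ?_
  · obtain ⟨h1, h2⟩ := hE.1 i hi
    simp only [mem_uIcc] at h1 h2 ⊢
    constructor
    · rcases h1 with h1 | h1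
      · left; constructor <;> linarith
      · right; constructor <;> linarith
    · rcases h2 with h2 | h2
      · left; constructor <;> linarith
      · right; constructor <;> linarith
  · intro i hi j hj hij
    have h1 := hE.2 hi hj hij
    simp only [Function.onFun, uIoc, Set.Ioc_disjoint_Ioc, min_sub_sub_left, max_sub_sub_left]
      at h1 ⊢
    linarith
  · refine lt_of_eq_of_lt (Finset.sum_congr rfl fun i _ => ?_) hlen
    rw [Real.dist_eq, Real.dist_eq, sub_sub_sub_cancel_left, abs_sub_comm]

/-! ### Backward uniqueness -/

section abstractUniqueness

variable {V : Type*} [NormedAddCommGroup V] [InnerProductSpace ℝ V] [CompleteSpace V]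

/-- The Riesz representative of a functional. -/
noncomputable def riesz (V : Type*) [NormedAddCommGroup V] [InnerProductSpace ℝ V]
    [CompleteSpace V] : StrongDual ℝ V →L[ℝ] V :=
  LinearMap.mkContinuous
    { toFun := fun f => (InnerProductSpace.toDual ℝ V).symm f
      map_add' := fun f g => map_add _ f g
      map_smul' := fun c f => by simp } 1 fun f => by
    rw [one_mul]
    exact ((InnerProductSpace.toDual ℝ V).symm.norm_map f).le

variable {a : V →L[ℝ] V →L[ℝ] ℝ} (ha : IsCoercive a)

/-- The inverse `V* → V` of the operator of a coercive form. -/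
noncomputable def formInverse : StrongDual ℝ V →L[ℝ] V :=
  (ha.continuousLinearEquivOfBilin.symm : V →L[ℝ] V).comp (riesz V)

lemma form_formInverse (f : StrongDual ℝ V) (v : V) : a (formInverse ha f) v = f v := by
  rw [← ha.continuousLinearEquivOfBilin_apply]
  have e : ha.continuousLinearEquivOfBilin (formInverse ha f) = riesz V f :=
    ha.continuousLinearEquivOfBilin.apply_symm_apply _
  rw [e]
  exact InnerProductSpace.toDual_symm_apply

/-- The form `(f, g) ↦ ⟨f, A⁻¹ g⟩` on the dual space, where `A` is the operator of a coercive
form. -/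
noncomputable def greenForm : StrongDual ℝ V →L[ℝ] StrongDual ℝ V →L[ℝ] ℝ :=
  (ContinuousLinearMap.compL ℝ (StrongDual ℝ V) V ℝ).flip (formInverse ha)

lemma greenForm_apply (f g : StrongDual ℝ V) : greenForm ha f g = f (formInverse ha g) := rfl

lemma greenForm_comm (hs : ∀ v w, a v w = a w v) (f g : StrongDual ℝ V) :
    greenForm ha f g = greenForm ha g f := by
  rw [greenForm_apply, greenForm_apply, ← form_formInverse ha f, hs, form_formInverse]

lemma eq_zero_of_greenForm_self {f : StrongDual ℝ V} (h : greenForm ha f f = 0) : f = 0 := by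
  obtain ⟨C, hC, hcoer⟩ := id ha
  have h1 := hcoer (formInverse ha f)
  rw [form_formInverse, ← greenForm_apply, h] at h1
  have h2 : ‖formInverse ha f‖ = 0 := by
    by_contra hne
    have h3 : 0 < ‖formInverse ha f‖ := lt_of_le_of_ne (norm_nonneg _) (Ne.symm hne)
    have : 0 < C * ‖formInverse ha f‖ * ‖formInverse ha f‖ := by positivity
    linarith
  ext ψ
  rw [← form_formInverse ha f, norm_eq_zero.1 h2]
  simp

/-- If `w' = Lw` with `L` symmetric for the form `β`, then `s ↦ β(w(s), w(τ - s))` is constant. -/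
lemma symm_form_half_eq_zero {E : Type*} [NormedAddCommGroup E] [NormedSpace ℝ E]
    (β : E →L[ℝ] E →L[ℝ] ℝ) {w w' : ℝ → E} {τ : ℝ} (hτ : 0 ≤ τ)
    (hac : AbsolutelyContinuousOnInterval w 0 τ)
    (heq : ∀ᵐ t, t ∈ Ioo 0 τ → HasDerivAt w (w' t) t)
    (hsymm : ∀ s t, β (w' s) (w t) = β (w s) (w' t)) (h0 : w τ = 0) :
    β (w (τ / 2)) (w (τ / 2)) = 0 := by
  have hac2 := ac_bilin β hac (ac_reflect hac)
  have hrefl : ∀ᵐ s : ℝ, τ - s ∈ Ioo 0 τ → HasDerivAt w (w' (τ - s)) (τ - s) :=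
    (Measure.measurePreserving_sub_left (volume : Measure ℝ) τ).quasiMeasurePreserving.ae heq
  have hne0 : ∀ᵐ s : ℝ, s ≠ 0 := by simp [ae_iff]
  have hneτ : ∀ᵐ s : ℝ, s ≠ τ := by simp [ae_iff]
  obtain ⟨c, hc⟩ := hac2.const_of_ae_hasDerivAt_zero (by
    filter_upwards [heq, hrefl, hne0, hneτ] with s h1 h2 h3 h4 hs
    rw [uIcc_of_le hτ] at hs
    have hs' : s ∈ Ioo 0 τ := ⟨lt_of_le_of_ne hs.1 (Ne.symm h3), lt_of_le_of_ne hs.2 h4⟩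
    have e1 := h1 hs'
    have e2 := (h2 ⟨by linarith [hs'.2], by linarith [hs'.1]⟩).comp_const_sub τ s
    have e4 := (β.hasFDerivAt_of_bilinear e1.hasFDerivAt e2.hasFDerivAt).hasDerivAt
    refine e4.congr_deriv ?_
    simp [hsymm])
  have e0 := hc 0 left_mem_uIcc
  have e1 := hc (τ / 2) (by rw [uIcc_of_le hτ]; constructor <;> linarith)
  rw [sub_zero, h0, map_zero] at e0
  rwa [show τ - τ / 2 = τ / 2 by ring, ← e0] at e1

/-- Backward uniqueness for an evolution whose generator is symmetric with respect to a definite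
form: vanishing at `τ` propagates to `τ / 2`, hence to `0` by continuity. -/
lemma symm_evolution_eq_zero {E : Type*} [NormedAddCommGroup E] [NormedSpace ℝ E]
    (β : E →L[ℝ] E →L[ℝ] ℝ) {w w' : ℝ → E} {T : ℝ} (hT : 0 ≤ T)
    (hac : AbsolutelyContinuousOnInterval w 0 T)
    (heq : ∀ᵐ t, t ∈ Ioo 0 T → HasDerivAt w (w' t) t)
    (hsymm : ∀ s t, β (w' s) (w t) = β (w s) (w' t)) (hdef : ∀ v, β v v = 0 → v = 0)
    (h0 : w T = 0) : w 0 = 0 := by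
  have hmem : ∀ n : ℕ, 0 ≤ T / 2 ^ n ∧ T / 2 ^ n ≤ T := fun n =>
    ⟨by positivity, div_le_self hT (one_le_pow₀ one_le_two)⟩
  have hn : ∀ n : ℕ, w (T / 2 ^ n) = 0 := by
    intro n
    induction n with
    | zero => simpa using h0
    | succ n ih =>
      rw [pow_succ, ← div_div]
      obtain ⟨h1, h2⟩ := hmem n
      refine hdef _ (symm_form_half_eq_zero β h1 (hac.mono ?_) ?_ hsymm ih)
      · rw [uIcc_of_le h1, uIcc_of_le hT]; exact Icc_subset_Icc_right h2
      · filter_upwards [heq] with t ht htm using ht ⟨htm.1, htm.2.trans_le h2⟩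
  have hlim : Tendsto (fun n : ℕ => T / 2 ^ n) atTop (𝓝[uIcc 0 T] 0) := by
    refine tendsto_nhdsWithin_iff.2 ⟨?_, Eventually.of_forall fun n => ?_⟩
    · have := (tendsto_pow_atTop_nhds_zero_of_lt_one (r := (1 / 2 : ℝ)) (by norm_num)
        (by norm_num)).const_mul T
      simpa [div_eq_mul_inv] using this
    · rw [uIcc_of_le hT]; exact hmem n
  have h1 := (hac.continuousOn 0 left_mem_uIcc).tendsto.comp hlim
  simp only [Function.comp_def, hn] at h1
  exact tendsto_nhds_unique h1 tendsto_const_nhds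

end abstractUniqueness

namespace HeatData

variable (d : HeatData)

lemma mulq_ae (f : d.L2) : d.mulq f =ᵐ[d.meas] fun x => d.q x * f x := by
  have := MemLp.coeFn_toLp ((Lp.memLp f).mul d.q_memLp (r := 2))
  filter_upwards [this] with x hx
  exact hx

/-- Multiplication by `q` as a bounded operator. -/
noncomputable def mulqL : d.L2 →L[ℝ] d.L2 :=
  LinearMap.mkContinuousOfExistsBound
    { toFun := d.mulq
      map_add' := fun f g => by
        apply Lp.ext
        filter_upwards [d.mulq_ae (f + g), d.mulq_ae f, d.mulq_ae g, Lp.coeFn_add f g,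
          Lp.coeFn_add (d.mulq f) (d.mulq g)] with x h1 h2 h3 h4 h5
        rw [h1, h5, Pi.add_apply, h2, h3, h4, Pi.add_apply, mul_add]
      map_smul' := fun c f => by
        apply Lp.ext
        filter_upwards [d.mulq_ae (c • f), d.mulq_ae f, Lp.coeFn_smul c f,
          Lp.coeFn_smul c (d.mulq f)] with x h1 h2 h3 h4
        rw [RingHom.id_apply, h1, h4, Pi.smul_apply, h2, h3, Pi.smul_apply, smul_eq_mul,
          smul_eq_mul, mul_left_comm] }
    (by
      obtain ⟨C, hC⟩ := d.q_bounded
      refine ⟨C, fun f => Lp.norm_le_mul_norm_of_ae_le_mul ?_⟩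
      filter_upwards [d.mulq_ae f] with x hx
      simp only [LinearMap.coe_mk, AddHom.coe_mk]
      rw [hx, norm_mul, Real.norm_eq_abs, ← d.q_even]
      gcongr
      exact hC _ (abs_nonneg x))

lemma inner_mulq_comm (f g : d.L2) : inner ℝ (d.mulq f) g = inner ℝ (d.mulq g) f := by
  rw [inner_eq, inner_eq]
  refine integral_congr_ae ?_
  filter_upwards [d.vol_ac.ae_eq (d.mulq_ae f), d.vol_ac.ae_eq (d.mulq_ae g)] with x h1 h2
  rw [h1, h2]; ring

/-- A constant that makes the form `⟨𝔻φ, 𝔻ψ⟩ + ⟨qφ, ψ⟩ + c⟨φ, ψ⟩` coercive on `ℍ¹`. -/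
noncomputable def shift : ℝ := ‖d.mulqL‖ + 1

/-- The form `⟨𝔻φ, 𝔻ψ⟩ + ⟨qφ, ψ⟩ + c⟨φ, ψ⟩` of the operator `-𝔻² + q + c`. -/
noncomputable def form : d.H1 →L[ℝ] d.H1 →L[ℝ] ℝ :=
  (innerSL ℝ).bilinearComp d.D d.D + (innerSL ℝ).bilinearComp (d.mulqL.comp d.val) d.val
    + d.shift • (innerSL ℝ).bilinearComp d.val d.val

lemma form_apply (φ ψ : d.H1) : d.form φ ψ = inner ℝ (d.D φ) (d.D ψ)
    + inner ℝ (d.mulq (d.val φ)) (d.val ψ) + d.shift * inner ℝ (d.val φ) (d.val ψ) := rfl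

lemma form_comm (φ ψ : d.H1) : d.form φ ψ = d.form ψ φ := by
  rw [form_apply, form_apply, inner_mulq_comm, real_inner_comm (d.D ψ), real_inner_comm (d.val ψ) (d.val φ)]

lemma rhs_zero_apply (φ ψ : d.H1) :
    d.rhs 0 φ ψ = d.shift * inner ℝ (d.val φ) (d.val ψ) - d.form φ ψ := by
  rw [form_apply]
  simp only [rhs, Dneg, ofL2]
  simp
  ring

lemma form_coercive : IsCoercive d.form := by
  refine ⟨1, one_pos, fun φ => ?_⟩
  have h1 : |inner ℝ (d.mulq (d.val φ)) (d.val φ)| ≤ ‖d.mulqL‖ * ‖d.val φ‖ * ‖d.val φ‖ :=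
    (abs_real_inner_le_norm _ _).trans
      (mul_le_mul_of_nonneg_right (d.mulqL.le_opNorm _) (norm_nonneg _))
  have h2 := neg_le_of_abs_le h1
  have h3 := d.norm_sq_eq φ
  rw [form_apply, real_inner_self_eq_norm_sq, real_inner_self_eq_norm_sq, shift]
  nlinarith

/-- On `ℍ¹` the uncontrolled generator is `c - A`, where `A` is the operator of `form`. -/
lemma greenForm_rhs (φ : d.H1) (g : d.Hneg1) :
    greenForm d.form_coercive (d.rhs 0 φ) g
      = d.shift * greenForm d.form_coercive (d.ofL2 (d.val φ)) g - g φ := by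
  rw [greenForm_apply, rhs_zero_apply, form_comm, form_formInverse]
  rfl

lemma ofL2_val_comm (φ ψ : d.H1) : d.ofL2 (d.val φ) ψ = d.ofL2 (d.val ψ) φ :=
  real_inner_comm (d.val ψ) (d.val φ)

lemma eq_zero_of_ofL2_val {φ : d.H1} (h : d.ofL2 (d.val φ) = 0) : φ = 0 := by
  have h1 : inner ℝ (d.val φ) (d.val φ) = 0 := by
    have := congrArg (fun F : d.Hneg1 => F φ) h
    exact this
  exact d.eq_zero_of_val_eq_zero (inner_self_eq_zero.1 h1)

/-- Backward uniqueness for the uncontrolled equation. -/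
lemma backward_uniqueness {W : ℝ → d.H1} {T : ℝ} (hT : 0 ≤ T)
    (hac : AbsolutelyContinuousOnInterval (fun t => d.ofL2 (d.val (W t))) 0 T)
    (heq : ∀ᵐ t, t ∈ Ioo 0 T → HasDerivAt (fun s => d.ofL2 (d.val (W s))) (d.rhs 0 (W t)) t)
    (h0 : W T = 0) : W 0 = 0 := by
  -- The generator `c - A` is symmetric for the form `⟨f, A⁻¹ g⟩` on `ℍ⁻¹`.
  refine d.eq_zero_of_ofL2_val (symm_evolution_eq_zero (greenForm d.form_coercive) hT hac heq
    (fun s t => ?_) (fun v => eq_zero_of_greenForm_self _) ?_)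
  · rw [greenForm_comm d.form_coercive d.form_comm _ (d.rhs 0 (W t)), greenForm_rhs, greenForm_rhs,
      d.ofL2_val_comm, greenForm_comm d.form_coercive d.form_comm]
  · ext ψ
    simp [ofL2, h0]

end HeatData

/-! ### Test functions -/

lemma exists_radius_of_hasCompactSupport {η : ℝ → ℝ} (h : HasCompactSupport η) :
    ∃ R : ℝ, 0 < R ∧ ∀ x, R ≤ |x| → η x = 0 := by
  obtain ⟨R, hR⟩ := h.isCompact.isBounded.subset_closedBall 0
  refine ⟨max (R + 1) 1, by positivity, fun x hx => ?_⟩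
  by_contra hne
  have h3 := hR (subset_tsupport η hne)
  simp only [Metric.mem_closedBall, dist_zero_right, Real.norm_eq_abs] at h3
  have h4 := le_max_left (R + 1) 1
  linarith

/-- Weak derivatives may be tested with `C¹` functions of compact support. -/
lemma IsWeakDeriv.integral_mul_deriv {f g η η' : ℝ → ℝ} (h : IsWeakDeriv f g)
    (hη : ∀ x, HasDerivAt η (η' x) x) (hη' : Continuous η') (hc : HasCompactSupport η) :
    ∫ x, f x * η' x = -∫ x, g x * η x := by
  have hdη : deriv η = η' := funext fun x => (hη x).deriv
  obtain ⟨R, hR0, hR⟩ := exists_radius_of_hasCompactSupport hc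
  obtain ⟨R', -, hR'⟩ := exists_radius_of_hasCompactSupport (hdη ▸ hc.deriv : HasCompactSupport η')
  set S := max R R' with hS
  have hS0 : 0 < S := hR0.trans_le (le_max_left _ _)
  obtain ⟨c, hf⟩ := h.exists_rep
  set F : ℝ → ℝ := fun x => c + ∫ y in (0 : ℝ)..x, g y with hF
  have key : ∀ G : ℝ → ℝ, (∀ x, S ≤ |x| → G x = 0) → ∫ x, G x = ∫ x in (-S)..S, G x := by
    intro G hG
    rw [intervalIntegral.integral_of_le (by linarith), ← integral_Icc_eq_integral_Ioc,
      setIntegral_eq_integral_of_forall_compl_eq_zero]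
    intro x hx
    apply hG
    by_contra hle
    exact hx (abs_le.mp (not_le.mp hle).le)
  have hFac : AbsolutelyContinuousOnInterval F (-S) S := by
    have h1 := IntervalIntegrable.absolutelyContinuousOnInterval_intervalIntegral
      (intervalIntegrable_of_loc h.2.1 (-S) S) (c := 0)
      (by rw [uIcc_of_le (by linarith)]; constructor <;> linarith)
    exact ac_of_dist_le (K := 1) h1 h1 fun s _ t _ => by
      simp only [hF, dist_add_left, one_mul]
      exact le_add_of_nonneg_right dist_nonneg
  have hηac : AbsolutelyContinuousOnInterval η (-S) S := by
    have h1 : ContDiff ℝ 1 η := contDiff_one_iff_deriv.2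
      ⟨fun x => (hη x).differentiableAt, by rwa [hdη]⟩
    exact h1.contDiffOn.absolutelyContinuousOnInterval
  have e1 : ∫ x, f x * η' x = ∫ x, F x * η' x :=
    integral_congr_ae (hf.mono fun x hx => by simp only [hx])
  have hibp := hFac.integral_mul_deriv_eq_deriv_mul hηac
  rw [hdη, hR S ((le_max_left _ _).trans (le_abs_self S)),
    hR (-S) (by rw [abs_neg]; exact (le_max_left _ _).trans (le_abs_self S))] at hibp
  rw [e1, key _ fun x hx => by rw [hR' x ((le_max_right _ _).trans hx), mul_zero],
    key _ fun x hx => by rw [hR x ((le_max_left _ _).trans hx), mul_zero], hibp]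
  have e2 : ∫ x in (-S)..S, deriv F x * η x = ∫ x in (-S)..S, g x * η x := by
    apply intervalIntegral.integral_congr_ae
    filter_upwards [LocallyIntegrable.ae_hasDerivAt_integral h.2.1] with x hx _
    rw [((hx 0).const_add c).deriv]
  rw [e2]; simp

lemma isWeakDeriv_of_hasDerivAt {f f' : ℝ → ℝ} (h : ∀ x, HasDerivAt f (f' x) x)
    (hc : Continuous f') : IsWeakDeriv f f' := by
  refine ⟨(continuous_iff_continuousAt.2 fun x => (h x).continuousAt).locallyIntegrable,
    hc.locallyIntegrable, fun η h1 h2 => ?_⟩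
  have hη : IsWeakDeriv (fun x => ∫ y in (0 : ℝ)..x, f' y) f' :=
    isWeakDeriv_primitive hc.locallyIntegrable
  have e : f = fun x => f 0 + ∫ y in (0 : ℝ)..x, f' y := by
    funext x
    rw [intervalIntegral.integral_eq_sub_of_hasDerivAt (fun y _ => h y)
      (hc.intervalIntegrable _ _)]
    ring
  have h0 : ∫ x, f 0 * deriv η x = 0 := by
    rw [integral_const_mul, integral_eq_zero_of_hasDerivAt_of_integrable
      (fun x => (h1.differentiable (by simp) x).hasDerivAt)
      ((h1.continuous_deriv (by simp)).integrable_of_hasCompactSupport h2.deriv)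
      (h1.continuous.integrable_of_hasCompactSupport h2), mul_zero]
  have hd : Continuous (deriv η) := h1.continuous_deriv (by simp)
  rw [← hη.2.2 η h1 h2]
  conv_lhs => rw [e]
  simp only [add_mul]
  rw [integral_add (integrable_mul_test (locallyIntegrable_const _) hd h2.deriv)
    (integrable_mul_test hη.1 hd h2.deriv), h0, zero_add]

/-- A `C¹` function on the line with compact support, together with its derivative. -/
structure TestFn where
  f : ℝ → ℝ
  df : ℝ → ℝ
  hasDerivAt : ∀ y, HasDerivAt f (df y) y
  cont_df : Continuous df
  supp : HasCompactSupport f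

namespace TestFn

variable (η : TestFn)

lemma cont : Continuous η.f := continuous_iff_continuousAt.2 fun x => (η.hasDerivAt x).continuousAt

lemma supp_df : HasCompactSupport η.df := by
  have : deriv η.f = η.df := funext fun x => (η.hasDerivAt x).deriv
  rw [← this]
  exact η.supp.deriv

end TestFn

namespace HeatData

variable (d : HeatData)

/-! ### The Liouville change of variables `y = σ(x)` -/

/-- `σ(x) = ∫₀ˣ √(ρ/k)` on the whole line. -/
noncomputable def sig : ℝ → ℝ := sigma d.rho d.kappa

lemma hasDerivAt_sig (x : ℝ) : HasDerivAt d.sig (d.p x) x :=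
  intervalIntegral.integral_hasDerivAt_right (d.p_cont.intervalIntegrable _ _)
    (d.p_cont.stronglyMeasurableAtFilter _ _) d.p_cont.continuousAt

lemma sig_strictMono : StrictMono d.sig :=
  strictMono_of_hasDerivAt_pos d.hasDerivAt_sig d.p_pos

lemma sig_cont : Continuous d.sig :=
  continuous_iff_continuousAt.2 fun x => (d.hasDerivAt_sig x).continuousAt

lemma sig_zero : d.sig 0 = 0 := by simp [sig, sigma]

lemma p_neg (x : ℝ) : d.p (-x) = d.p x := by simp [p, rho, kappa, evenExt]

lemma sig_neg (x : ℝ) : d.sig (-x) = -d.sig x := by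
  change ∫ ξ in (0 : ℝ)..-x, d.p ξ = -∫ ξ in (0 : ℝ)..x, d.p ξ
  have h := intervalIntegral.integral_comp_neg (a := 0) (b := x) d.p
  simp only [p_neg, neg_zero] at h
  rw [h, intervalIntegral.integral_symm]

lemma sig_surjective : Function.Surjective d.sig := by
  have h1 : Tendsto d.sig atTop atTop := d.sigma_tendsto
  refine d.sig_cont.surjective h1 ?_
  have h2 : d.sig = fun x => -d.sig (-x) := by funext x; rw [sig_neg, neg_neg]
  rw [h2]
  exact tendsto_neg_atTop_atBot.comp (h1.comp tendsto_neg_atBot_atTop)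

/-- `σ` as a homeomorphism of the line. -/
noncomputable def sigHomeo : ℝ ≃ₜ ℝ :=
  (d.sig_strictMono.orderIsoOfSurjective d.sig d.sig_surjective).toHomeomorph

lemma sigHomeo_symm_sig (x : ℝ) : d.sigHomeo.symm (d.sig x) = x :=
  d.sigHomeo.symm_apply_apply x

lemma integral_comp_sig (g : ℝ → ℝ) : ∫ x, g (d.sig x) * d.p x = ∫ y, g y := by
  have h := integral_image_eq_integral_abs_deriv_smul (s := univ) MeasurableSet.univ
    (fun x _ => (d.hasDerivAt_sig x).hasDerivWithinAt) d.sig_strictMono.injective.injOn g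
  rw [image_univ, d.sig_surjective.range_eq, setIntegral_univ, setIntegral_univ] at h
  rw [h]
  congr 1; funext x
  rw [abs_of_pos (d.p_pos x), smul_eq_mul, mul_comm]

lemma integrable_comp_sig {g : ℝ → ℝ} :
    Integrable (fun x => g (d.sig x) * d.p x) ↔ Integrable g := by
  have h := integrableOn_image_iff_integrableOn_abs_deriv_smul (s := univ) MeasurableSet.univ
    (fun x _ => (d.hasDerivAt_sig x).hasDerivWithinAt) d.sig_strictMono.injective.injOn g
  rw [image_univ, d.sig_surjective.range_eq, integrableOn_univ, integrableOn_univ] at h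
  rw [h]
  refine integrable_congr (Eventually.of_forall fun x => ?_)
  simp only
  rw [abs_of_pos (d.p_pos x), smul_eq_mul, mul_comm]

/-- The potential in the variable `y = σ(x)`. -/
noncomputable def qy (y : ℝ) : ℝ := d.q (d.sigHomeo.symm y)

lemma qy_cont : Continuous d.qy := d.q_cont.comp d.sigHomeo.symm.continuous

lemma qy_sig (x : ℝ) : d.qy (d.sig x) = d.q x := by rw [qy, sigHomeo_symm_sig]

lemma qy_bounded : ∃ C, ∀ y, |d.qy y| ≤ C := by
  obtain ⟨C, hC⟩ := d.q_bounded
  refine ⟨C, fun y => ?_⟩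
  rw [qy, ← d.q_even]
  exact hC _ (abs_nonneg _)

lemma qy_moment : Integrable fun y => (1 + |y|) * |d.qy y| := by
  rw [← d.integrable_comp_sig]
  simp only [qy_sig]
  set g : ℝ → ℝ := fun x => (1 + |d.sig x|) * |d.q x| * d.p x with hg
  have hgc : Continuous g := by
    have := d.sig_cont
    have := d.q_cont
    have := d.p_cont
    fun_prop
  have hg0 : ∀ x, 0 ≤ g x := fun x => by have := d.p_pos x; positivity
  have hgeven : ∀ x, g (-x) = g x := fun x => by
    have h1 : d.q (-x) = d.q x := by rw [← d.q_even, abs_neg, d.q_even]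
    simp only [hg, sig_neg, abs_neg, p_neg, h1]
  -- The weight in the hypothesis is `|σ|`, comparable to `1 + |σ|` only where `σ ≥ 1`.
  obtain ⟨x₁, hx₁⟩ := (d.sigma_tendsto.eventually_ge_atTop 1).and (eventually_ge_atTop 0) |>.exists
  have hs1 : 1 ≤ d.sig x₁ := hx₁.1
  have h1 : IntegrableOn g (Ioc 0 x₁) :=
    (hgc.integrableOn_Icc (a := 0) (b := x₁)).mono_set Ioc_subset_Icc_self
  have hmom : IntegrableOn (fun x => d.p x * d.q x * d.sig x) (Ioi 0) := d.q_moment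
  have h2 : IntegrableOn g (Ioi x₁) := by
    refine ((hmom.mono_set (Ioi_subset_Ioi hx₁.2)).norm.const_mul 2).mono'
      hgc.aestronglyMeasurable ?_
    filter_upwards [ae_restrict_mem measurableSet_Ioi] with x hx
    have h3 : 1 ≤ d.sig x := hs1.trans (d.sig_strictMono.monotone (le_of_lt hx))
    have hp := d.p_pos x
    rw [Real.norm_eq_abs, abs_of_nonneg (hg0 x), Real.norm_eq_abs, abs_mul, abs_mul,
      abs_of_pos hp, hg]
    simp only
    rw [abs_of_nonneg (by linarith : 0 ≤ d.sig x)]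
    have : 0 ≤ |d.q x| * d.p x := by positivity
    nlinarith
  have h3 : IntegrableOn g (Ioi 0) := by
    rw [← Ioc_union_Ioi_eq_Ioi hx₁.2]; exact h1.union h2
  have h4 : IntegrableOn g (Iio 0) := by
    have := h3.comp_neg
    simpa [hgeven] using this
  rw [← integrableOn_univ, ← Iic_union_Ioi (a := (0 : ℝ))]
  exact ((integrableOn_Iic_iff_integrableOn_Iio).2 h4).union h3

/-- The transform `w ↦ (w / ω) ∘ σ⁻¹`, unitary from `L²(ρ dx)` to `L²(dy)`. -/
noncomputable def pull (w : d.L2) (y : ℝ) : ℝ :=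
  w (d.sigHomeo.symm y) / d.omega (d.sigHomeo.symm y)

lemma pull_sig (w : d.L2) (x : ℝ) : d.pull w (d.sig x) = w x / d.omega x := by
  rw [pull, sigHomeo_symm_sig]

lemma pull_memLp (w : d.L2) : MemLp (d.pull w) 2 := by
  have hm : Measurable (d.pull w) :=
    ((Lp.stronglyMeasurable w).measurable.comp d.sigHomeo.symm.continuous.measurable).div
      (d.omega_cont.comp d.sigHomeo.symm.continuous).measurable
  rw [memLp_two_iff_integrable_sq hm.aestronglyMeasurable, ← d.integrable_comp_sig]
  have h1 := (memLp_two_iff_integrable_sq (Lp.memLp w).1).1 (Lp.memLp w)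
  have h2 : Integrable (fun x => w x ^ 2)
    (volume.withDensity fun x => ENNReal.ofReal (d.rho x)) := h1
  rw [integrable_withDensity_iff_integrable_smul' d.rho_cont.measurable.ennreal_ofReal
    (by simp)] at h2
  refine h2.congr (Eventually.of_forall fun x => ?_)
  simp only [pull_sig, smul_eq_mul]
  rw [ENNReal.toReal_ofReal (d.rho_pos x).le, ← omega_sq_mul_rho]
  have := (d.omega_pos x).ne'
  field_simp

/-- The element `ω · (g ∘ σ)` of `L²_ρ`. -/
noncomputable def lift {g : ℝ → ℝ} (hg : Continuous g) (hc : HasCompactSupport g) : d.L2 :=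
  MemLp.toLp (fun x => d.omega x * g (d.sig x))
    ((d.omega_cont.mul (hg.comp d.sig_cont)).memLp_of_hasCompactSupport
      ((hc.comp_homeomorph d.sigHomeo).mul_left (f := d.omega)))

lemma lift_ae {g : ℝ → ℝ} (hg : Continuous g) (hc : HasCompactSupport g) :
    (fun x => d.lift hg hc x) =ᵐ[volume] fun x => d.omega x * g (d.sig x) :=
  d.vol_ac.ae_eq (MemLp.coeFn_toLp _)

lemma inner_lift {g : ℝ → ℝ} (hg : Continuous g) (hc : HasCompactSupport g) (w : d.L2) :
    inner ℝ w (d.lift hg hc) = ∫ y, d.pull w y * g y := by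
  rw [inner_eq, ← d.integral_comp_sig (fun y => d.pull w y * g y)]
  refine integral_congr_ae ?_
  filter_upwards [d.lift_ae hg hc] with x hx
  rw [hx, pull_sig, ← omega_sq_mul_rho]
  have := (d.omega_pos x).ne'
  field_simp

lemma norm_sq_lift {g : ℝ → ℝ} (hg : Continuous g) (hc : HasCompactSupport g) :
    ‖d.lift hg hc‖ ^ 2 = ∫ y, g y ^ 2 := by
  rw [← real_inner_self_eq_norm_sq, inner_eq, ← d.integral_comp_sig (fun y => g y ^ 2)]
  refine integral_congr_ae ?_
  filter_upwards [d.lift_ae hg hc] with x hx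
  rw [hx, ← omega_sq_mul_rho]
  ring

/-- The element `ω · (f ∘ σ)` of `ℍ¹`; its `𝔻`-derivative is `ω · (f' ∘ σ)`. -/
noncomputable def embed (η : TestFn) : d.H1 :=
  ⟨WithLp.toLp 2 (d.lift η.cont η.supp, d.lift η.cont_df η.supp_df), by
    have hder : ∀ x, HasDerivAt (fun x => d.omega x * η.f (d.sig x))
        (d.p x * (d.omega x * η.df (d.sig x) - d.Q x * (d.omega x * η.f (d.sig x)))) x := by
      intro x
      have := (d.hasDerivAt_omega x).mul ((η.hasDerivAt (d.sig x)).comp x (d.hasDerivAt_sig x))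
      refine this.congr_deriv ?_
      simp only [Function.comp_apply]
      ring
    have hcont : Continuous fun x => d.p x *
        (d.omega x * η.df (d.sig x) - d.Q x * (d.omega x * η.f (d.sig x))) := by
      have h1 := d.omega_cont
      have h2 := η.cont_df.comp d.sig_cont
      have h3 := η.cont.comp d.sig_cont
      exact d.p_cont.mul ((h1.mul h2).sub (d.Q_cont.mul (h1.mul h3)))
    refine (isWeakDeriv_of_hasDerivAt hder hcont).congr (d.lift_ae η.cont η.supp).symm ?_
    filter_upwards [d.lift_ae η.cont η.supp, d.lift_ae η.cont_df η.supp_df] with x h1 h2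
    simp only [WithLp.toLp_fst, WithLp.toLp_snd]
    rw [h1, h2]
    rfl⟩

lemma val_embed (η : TestFn) : d.val (d.embed η) = d.lift η.cont η.supp := rfl

lemma D_embed (η : TestFn) : d.D (d.embed η) = d.lift η.cont_df η.supp_df := rfl

lemma norm_sq_embed (η : TestFn) :
    ‖d.embed η‖ ^ 2 = (∫ y, η.f y ^ 2) + ∫ y, η.df y ^ 2 := by
  rw [norm_sq_eq, val_embed, D_embed, norm_sq_lift, norm_sq_lift]

lemma ofL2_embed (w : d.L2) (η : TestFn) : d.ofL2 w (d.embed η) = ∫ y, d.pull w y * η.f y :=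
  d.inner_lift η.cont η.supp w

lemma delta_embed (η : TestFn) : d.delta (d.embed η) = d.omega 0 * η.f 0 := by
  have h : d.contRep (d.embed η) = fun x => d.omega x * η.f (d.sig x) :=
    d.contRep_unique _ (d.omega_cont.mul (η.cont.comp d.sig_cont)) (d.lift_ae η.cont η.supp)
  change d.contRep (d.embed η) 0 = _
  rw [h]
  simp only [sig_zero]

/-- Integration by parts: `⟨𝔻φ, ω (f ∘ σ)⟩ = -⟨φ, ω (f' ∘ σ)⟩`. -/
lemma inner_D_lift (φ : d.H1) (η : TestFn) :
    inner ℝ (d.D φ) (d.lift η.cont η.supp) = -inner ℝ (d.val φ) (d.lift η.cont_df η.supp_df) := by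
  have hw : IsWeakDeriv (fun x => d.val φ x)
    (fun x => √(d.rho x / d.kappa x) * (d.D φ x - d.Q x * d.val φ x)) := φ.2
  -- `θ = ω⁻¹ (f ∘ σ)` is the test function for the weak derivative, since `ρ ω = p ω⁻¹`.
  set θ : ℝ → ℝ := fun x => (d.omega x)⁻¹ * η.f (d.sig x) with hθ
  set θ' : ℝ → ℝ := fun x => d.Q x * d.p x * θ x + d.p x * ((d.omega x)⁻¹ * η.df (d.sig x))
    with hθ'
  have hωi : Continuous fun x => (d.omega x)⁻¹ := d.omega_cont.inv₀ fun x => (d.omega_pos x).ne'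
  have hθc : Continuous θ := hωi.mul (η.cont.comp d.sig_cont)
  have hζc : Continuous fun x => d.p x * ((d.omega x)⁻¹ * η.df (d.sig x)) :=
    d.p_cont.mul (hωi.mul (η.cont_df.comp d.sig_cont))
  have hθs : HasCompactSupport θ :=
    (η.supp.comp_homeomorph d.sigHomeo).mul_left (f := fun x => (d.omega x)⁻¹)
  have hζs : HasCompactSupport fun x => d.p x * ((d.omega x)⁻¹ * η.df (d.sig x)) :=
    ((η.supp_df.comp_homeomorph d.sigHomeo).mul_left (f := fun x => (d.omega x)⁻¹)).mul_left
  have hder : ∀ x, HasDerivAt θ (θ' x) x := by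
    intro x
    have h1 := ((d.hasDerivAt_omega x).inv (d.omega_pos x).ne').mul
      ((η.hasDerivAt (d.sig x)).comp x (d.hasDerivAt_sig x))
    refine h1.congr_deriv ?_
    have := (d.omega_pos x).ne'
    simp only [Function.comp_apply, hθ', hθ, Pi.inv_apply]
    field_simp
  have hibp := hw.integral_mul_deriv hder ((d.Q_cont.mul d.p_cont).mul hθc |>.add hζc) hθs
  have hQθc : Continuous fun x => d.Q x * d.p x * θ x := (d.Q_cont.mul d.p_cont).mul hθc
  have hpθc : Continuous fun x => d.p x * θ x := d.p_cont.mul hθc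
  have i1 : Integrable fun x => d.val φ x * (d.Q x * d.p x * θ x) :=
    integrable_mul_test (d.locallyIntegrable_L2 _) hQθc hθs.mul_left
  have i2 : Integrable fun x => d.val φ x * (d.p x * ((d.omega x)⁻¹ * η.df (d.sig x))) :=
    integrable_mul_test (d.locallyIntegrable_L2 _) hζc hζs
  have i3 : Integrable fun x => d.D φ x * (d.p x * θ x) :=
    integrable_mul_test (d.locallyIntegrable_L2 _) hpθc hθs.mul_left
  have e1 : ∫ x, d.val φ x * θ' x = (∫ x, d.val φ x * (d.Q x * d.p x * θ x))
      + ∫ x, d.val φ x * (d.p x * ((d.omega x)⁻¹ * η.df (d.sig x))) := by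
    rw [← integral_add i1 i2]
    simp only [hθ', mul_add]
  have e2 : ∫ x, √(d.rho x / d.kappa x) * (d.D φ x - d.Q x * d.val φ x) * θ x
      = (∫ x, d.D φ x * (d.p x * θ x)) - ∫ x, d.val φ x * (d.Q x * d.p x * θ x) := by
    rw [← integral_sub i3 i1]
    congr 1; funext x; simp only [p]; ring
  have e3 : inner ℝ (d.D φ) (d.lift η.cont η.supp) = ∫ x, d.D φ x * (d.p x * θ x) := by
    rw [inner_eq]
    refine integral_congr_ae ?_
    filter_upwards [d.lift_ae η.cont η.supp] with x hx
    rw [hx, hθ, ← omega_sq_mul_rho]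
    have := (d.omega_pos x).ne'
    field_simp
  have e4 : inner ℝ (d.val φ) (d.lift η.cont_df η.supp_df)
      = ∫ x, d.val φ x * (d.p x * ((d.omega x)⁻¹ * η.df (d.sig x))) := by
    rw [inner_eq]
    refine integral_congr_ae ?_
    filter_upwards [d.lift_ae η.cont_df η.supp_df] with x hx
    rw [hx, ← omega_sq_mul_rho]
    have := (d.omega_pos x).ne'
    field_simp
  rw [e3, e4]
  have h5 : (∫ x, d.val φ x * θ' x)
    = -∫ x, √(d.rho x / d.kappa x) * (d.D φ x - d.Q x * d.val φ x) * θ x := hibp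
  rw [e1, e2] at h5
  linarith

/-- In the variable `y` the equation becomes `w_t = w_yy - q w - c u δ`, tested against `C²`
functions. -/
lemma rhs_embed (u : ℝ) (φ : d.H1) (η η' : TestFn) (h : η.df = η'.f) :
    d.rhs u φ (d.embed η) = (∫ y, d.pull (d.val φ) y * (η'.df y - d.qy y * η.f y))
      - 2 * √(d.ρ 0 * d.k 0) * d.omega 0 * η.f 0 * u := by
  have h1 : d.Dneg (d.D φ) (d.embed η) = ∫ y, d.pull (d.val φ) y * η'.df y := by
    have e : d.D (d.embed η) = d.lift η'.cont η'.supp := by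
      rw [D_embed]; congr 1
    change -inner ℝ (d.D φ) (d.D (d.embed η)) = _
    rw [e, inner_D_lift, neg_neg, inner_lift]
  have hqc : Continuous fun y => d.qy y * η.f y := d.qy_cont.mul η.cont
  have hqs : HasCompactSupport fun y => d.qy y * η.f y := η.supp.mul_left
  have h2 : d.ofL2 (d.mulq (d.val φ)) (d.embed η)
      = ∫ y, d.pull (d.val φ) y * (d.qy y * η.f y) := by
    rw [ofL2_embed, ← d.inner_lift hqc hqs, inner_eq,
      ← d.integral_comp_sig (fun y => d.pull (d.mulq (d.val φ)) y * η.f y)]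
    refine integral_congr_ae ?_
    filter_upwards [d.lift_ae hqc hqs, d.vol_ac.ae_eq (d.mulq_ae (d.val φ))] with x hx h2
    rw [hx, pull_sig, h2, qy_sig, ← omega_sq_mul_rho]
    have := (d.omega_pos x).ne'
    field_simp
  have hl : LocallyIntegrable (d.pull (d.val φ)) volume :=
    (d.pull_memLp (d.val φ)).locallyIntegrable (by norm_num)
  have h3 : d.rhs u φ (d.embed η) = d.Dneg (d.D φ) (d.embed η)
      - d.ofL2 (d.mulq (d.val φ)) (d.embed η)
      - 2 * √(d.ρ 0 * d.k 0) * u * d.delta (d.embed η) := rfl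
  rw [h3, h1, h2, delta_embed,
    ← integral_sub (integrable_mul_test hl η'.cont_df η'.supp_df) (integrable_mul_test hl hqc hqs)]
  simp only [← mul_sub]
  ring

end HeatData

/-! ### Truncated high-frequency solutions -/

/-- A smooth cutoff equal to `1` near `0`, with its first three derivatives. -/
lemma exists_cutoff : ∃ b₀ b₁ b₂ b₃ : ℝ → ℝ, ∃ B : ℝ,
    (∀ y, HasDerivAt b₀ (b₁ y) y) ∧ (∀ y, HasDerivAt b₁ (b₂ y) y) ∧
    (∀ y, HasDerivAt b₂ (b₃ y) y) ∧ Continuous b₃ ∧ (∀ y, 0 ≤ b₀ y ∧ b₀ y ≤ 1) ∧ b₀ 0 = 1 ∧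
    (∀ y, |b₁ y| ≤ B) ∧ (∀ y, |b₂ y| ≤ B) ∧ (∀ y, |b₃ y| ≤ B) ∧
    ∀ y, 2 < |y| → b₀ y = 0 ∧ b₁ y = 0 ∧ b₂ y = 0 ∧ b₃ y = 0 := by
  let b : ContDiffBump (0 : ℝ) := ⟨1, 2, one_pos, one_lt_two⟩
  have s0 : ContDiff ℝ ∞ (b : ℝ → ℝ) := b.contDiff
  have s1 : ContDiff ℝ ∞ (deriv b) := (contDiff_infty_iff_deriv.1 s0).2
  have s2 : ContDiff ℝ ∞ (deriv (deriv b)) := (contDiff_infty_iff_deriv.1 s1).2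
  have s3 : ContDiff ℝ ∞ (deriv (deriv (deriv b))) := (contDiff_infty_iff_deriv.1 s2).2
  have c0 : HasCompactSupport (b : ℝ → ℝ) := b.hasCompactSupport
  obtain ⟨B₁, h1⟩ := s1.continuous.bounded_above_of_compact_support c0.deriv
  obtain ⟨B₂, h2⟩ := s2.continuous.bounded_above_of_compact_support c0.deriv.deriv
  obtain ⟨B₃, h3⟩ := s3.continuous.bounded_above_of_compact_support c0.deriv.deriv.deriv
  have hz : ∀ f : ℝ → ℝ, (∀ y, 2 < |y| → f y = 0) → ∀ y, 2 < |y| → deriv f y = 0 := by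
    intro f hf y hy
    have : f =ᶠ[𝓝 y] fun _ => 0 := by
      filter_upwards [(continuous_abs.tendsto y).eventually (lt_mem_nhds hy)] with z hz
      exact hf z hz
    rw [this.deriv_eq]; simp
  have z0 : ∀ y, 2 < |y| → b y = 0 := fun y hy =>
    b.zero_of_le_dist (by simpa using hy.le)
  have z1 := hz _ z0
  have z2 := hz _ z1
  have z3 := hz _ z2
  refine ⟨b, deriv b, deriv (deriv b), deriv (deriv (deriv b)), max B₁ (max B₂ B₃),
    fun y => (s0.differentiable (by simp) y).hasDerivAt,
    fun y => (s1.differentiable (by simp) y).hasDerivAt,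
    fun y => (s2.differentiable (by simp) y).hasDerivAt, s3.continuous,
    fun y => ⟨b.nonneg, b.le_one⟩, b.one_of_mem_closedBall (by simp [b]), fun y => ?_, fun y => ?_,
    fun y => ?_, fun y hy => ⟨z0 y hy, z1 y hy, z2 y hy, z3 y hy⟩⟩
  · exact (h1 y).trans (le_max_left _ _)
  · exact (h2 y).trans ((le_max_left _ _).trans (le_max_right _ _))
  · exact (h3 y).trans ((le_max_right _ _).trans (le_max_right _ _))

/-- A function of size `Kε` supported in an interval of length `4 / ε` has squared `L²` norm
`O(ε)`. -/
lemma integral_sq_le_of_bound {f : ℝ → ℝ} {K ε : ℝ} (hε : 0 < ε) (hb : ∀ y, |f y| ≤ K * ε)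
    (h0 : ∀ y, 2 < |ε * y| → f y = 0) : ∫ y, f y ^ 2 ≤ 4 * K ^ 2 * ε := by
  have e : ∫ y, f y ^ 2 = ∫ y in Icc (-(2 / ε)) (2 / ε), f y ^ 2 := by
    rw [setIntegral_eq_integral_of_forall_compl_eq_zero]
    intro y hy
    rw [h0 y, zero_pow two_ne_zero]
    by_contra hle
    refine hy (abs_le.1 ?_)
    rw [le_div_iff₀ hε]
    rwa [abs_mul, abs_of_pos hε, not_lt, mul_comm] at hle
  rw [e]
  have h1 := norm_setIntegral_le_of_norm_le_const (μ := volume) (s := Icc (-(2 / ε)) (2 / ε))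
    (f := fun y => f y ^ 2) (C := (K * ε) ^ 2) (by simp) (fun y _ => by
      rw [norm_pow, Real.norm_eq_abs]
      exact pow_le_pow_left₀ (abs_nonneg _) (hb y) 2)
  refine (le_abs_self _).trans (h1.trans (le_of_eq ?_))
  rw [Measure.real, Real.volume_Icc, ENNReal.toReal_ofReal (by
    have : 0 < 2 / ε := by positivity
    linarith)]
  field_simp
  ring

/-- Truncations `η = χ(ε ·) φ` of a high-frequency solution: they satisfy the eigenvalue equation
up to an error `E` whose `H¹` norm is `O(√ε)`. -/
lemma exists_truncations {V : ℝ → ℝ} (hV : Continuous V) {C : ℝ} (hVb : ∀ y, |V y| ≤ C) {ξ : ℝ}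
    (S : HighFrequencySolution V ξ) {b₀ b₁ b₂ b₃ : ℝ → ℝ} {B : ℝ}
    (d0 : ∀ y, HasDerivAt b₀ (b₁ y) y) (d1 : ∀ y, HasDerivAt b₁ (b₂ y) y)
    (d2 : ∀ y, HasDerivAt b₂ (b₃ y) y) (c3 : Continuous b₃) (h1 : ∀ y, |b₁ y| ≤ B)
    (h2 : ∀ y, |b₂ y| ≤ B) (h3 : ∀ y, |b₃ y| ≤ B)
    (hz : ∀ y, 2 < |y| → b₀ y = 0 ∧ b₁ y = 0 ∧ b₂ y = 0 ∧ b₃ y = 0) :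
    ∃ K : ℝ, ∀ ε, 0 < ε → ε ≤ 1 → ∃ η η' E : TestFn, η.df = η'.f ∧
      (∀ y, η.f y = b₀ (ε * y) * S.φ y) ∧
      (∀ y, η'.df y - V y * η.f y = -ξ ^ 2 * η.f y + E.f y) ∧
      (∫ y, E.f y ^ 2) + (∫ y, E.df y ^ 2) ≤ K * ε := by
  obtain ⟨P, hP⟩ := S.dbound
  have hB : 0 ≤ B := (abs_nonneg _).trans (h1 0)
  have hP0 : 0 ≤ P := (abs_nonneg _).trans (hP 0)
  have hC0 : 0 ≤ C := (abs_nonneg _).trans (hVb 0)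
  have cb0 : Continuous b₀ := continuous_iff_continuousAt.2 fun x => (d0 x).continuousAt
  have cb1 : Continuous b₁ := continuous_iff_continuousAt.2 fun x => (d1 x).continuousAt
  have cb2 : Continuous b₂ := continuous_iff_continuousAt.2 fun x => (d2 x).continuousAt
  have cφ : Continuous S.φ := continuous_iff_continuousAt.2 fun x => (S.hasDerivAt x).continuousAt
  have cdφ : Continuous S.dφ :=
    continuous_iff_continuousAt.2 fun x => (S.hasDerivAt_d x).continuousAt
  set K : ℝ := B * 2 + 3 * (B * P) + 2 * (B * ((C + ξ ^ 2) * 2)) with hK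
  refine ⟨8 * K ^ 2, fun ε hε hε1 => ?_⟩
  have hsc : ∀ {f f' : ℝ → ℝ}, (∀ y, HasDerivAt f (f' y) y) →
      ∀ y, HasDerivAt (fun y => f (ε * y)) (ε * f' (ε * y)) y := by
    intro f f' h y
    have := (h (ε * y)).comp y ((hasDerivAt_id y).const_mul ε)
    refine this.congr_deriv ?_
    ring
  have hcs : ∀ f : ℝ → ℝ, (∀ y, 2 < |ε * y| → f y = 0) → HasCompactSupport f := by
    intro f hf
    refine HasCompactSupport.intro (isCompact_Icc (a := -(2 / ε)) (b := 2 / ε)) fun y hy => hf y ?_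
    by_contra hle
    refine hy (abs_le.1 ?_)
    rw [le_div_iff₀ hε]
    rwa [abs_mul, abs_of_pos hε, not_lt, mul_comm] at hle
  have hE0 : ∀ y, 2 < |ε * y| →
      ε ^ 2 * b₂ (ε * y) * S.φ y + 2 * ε * b₁ (ε * y) * S.dφ y = 0 := fun y hy => by
    simp [hz _ hy]
  have hE0' : ∀ y, 2 < |ε * y| → ε ^ 3 * b₃ (ε * y) * S.φ y + 3 * ε ^ 2 * b₂ (ε * y) * S.dφ y
      + 2 * ε * b₁ (ε * y) * ((V y - ξ ^ 2) * S.φ y) = 0 := fun y hy => by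
    simp [hz _ hy]
  let η : TestFn :=
    { f := fun y => b₀ (ε * y) * S.φ y
      df := fun y => ε * b₁ (ε * y) * S.φ y + b₀ (ε * y) * S.dφ y
      hasDerivAt := fun y => (hsc d0 y).mul (S.hasDerivAt y)
      cont_df := by fun_prop
      supp := hcs _ fun y hy => by simp [hz _ hy] }
  let η' : TestFn :=
    { f := η.df
      df := fun y => ε ^ 2 * b₂ (ε * y) * S.φ y + 2 * ε * b₁ (ε * y) * S.dφ y
        + b₀ (ε * y) * ((V y - ξ ^ 2) * S.φ y)
      hasDerivAt := fun y => by
        have := (((hsc d1 y).const_mul ε).mul (S.hasDerivAt y)).add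
          ((hsc d0 y).mul (S.hasDerivAt_d y))
        refine this.congr_deriv ?_
        ring
      cont_df := by fun_prop
      supp := hcs _ fun y hy => by simp [η, hz _ hy] }
  let E : TestFn :=
    { f := fun y => ε ^ 2 * b₂ (ε * y) * S.φ y + 2 * ε * b₁ (ε * y) * S.dφ y
      df := fun y => ε ^ 3 * b₃ (ε * y) * S.φ y + 3 * ε ^ 2 * b₂ (ε * y) * S.dφ y
        + 2 * ε * b₁ (ε * y) * ((V y - ξ ^ 2) * S.φ y)
      hasDerivAt := fun y => by
        have := (((hsc d2 y).const_mul (ε ^ 2)).mul (S.hasDerivAt y)).add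
          (((hsc d1 y).const_mul (2 * ε)).mul (S.hasDerivAt_d y))
        refine this.congr_deriv ?_
        ring
      cont_df := by fun_prop
      supp := hcs _ hE0 }
  have hε2 : ε ^ 2 ≤ ε := by nlinarith
  have hε3 : ε ^ 3 ≤ ε := by nlinarith [sq_nonneg ε]
  have hmul : ∀ x y X Y : ℝ, |x| ≤ X → |y| ≤ Y → |x * y| ≤ X * Y := fun x y X Y hx hy => by
    rw [abs_mul]
    exact mul_le_mul hx hy (abs_nonneg _) ((abs_nonneg _).trans hx)
  have hVξ : ∀ y, |(V y - ξ ^ 2) * S.φ y| ≤ (C + ξ ^ 2) * 2 := fun y => by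
    refine hmul _ _ _ _ ((abs_sub _ _).trans ?_) (S.bound y)
    rw [abs_of_nonneg (sq_nonneg ξ)]
    linarith [hVb y]
  have hterm : ∀ c e x X : ℝ, 0 ≤ c → 0 ≤ e → e ≤ ε → |x| ≤ X → |c * e * x| ≤ ε * (c * X) := by
    intro c e x X hc he hle hx
    rw [abs_mul, abs_of_nonneg (mul_nonneg hc he)]
    have hX : 0 ≤ X := (abs_nonneg _).trans hx
    calc c * e * |x| ≤ c * ε * X := by gcongr
      _ = _ := by ring
  have hEb : ∀ y, |E.f y| ≤ K * ε := fun y => by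
    have t1 := hterm 1 (ε ^ 2) _ _ one_pos.le (sq_nonneg ε) hε2
      (hmul _ _ _ _ (h2 (ε * y)) (S.bound y))
    have t2 := hterm 2 ε _ _ two_pos.le hε.le le_rfl (hmul _ _ _ _ (h1 (ε * y)) (hP y))
    have e : E.f y = 1 * ε ^ 2 * (b₂ (ε * y) * S.φ y) + 2 * ε * (b₁ (ε * y) * S.dφ y) := by
      simp only [E]; ring
    rw [e]
    refine (abs_add_le _ _).trans ((add_le_add t1 t2).trans ?_)
    have : 0 ≤ ε * (B * P + 2 * (B * ((C + ξ ^ 2) * 2))) := by positivity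
    rw [hK]; linarith
  have hEb' : ∀ y, |E.df y| ≤ K * ε := fun y => by
    have t1 := hterm 1 (ε ^ 3) _ _ one_pos.le (by positivity) hε3
      (hmul _ _ _ _ (h3 (ε * y)) (S.bound y))
    have t2 := hterm 3 (ε ^ 2) _ _ three_pos.le (sq_nonneg ε) hε2
      (hmul _ _ _ _ (h2 (ε * y)) (hP y))
    have t3 := hterm 2 ε _ _ two_pos.le hε.le le_rfl (hmul _ _ _ _ (h1 (ε * y)) (hVξ y))
    have e : E.df y = 1 * ε ^ 3 * (b₃ (ε * y) * S.φ y) + 3 * ε ^ 2 * (b₂ (ε * y) * S.dφ y)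
        + 2 * ε * (b₁ (ε * y) * ((V y - ξ ^ 2) * S.φ y)) := by
      simp only [E]; ring
    rw [e]
    refine (abs_add_three _ _ _).trans ((add_le_add (add_le_add t1 t2) t3).trans ?_)
    rw [hK]; linarith
  refine ⟨η, η', E, rfl, fun y => rfl, fun y => ?_, ?_⟩
  · simp only [η, η', E]; ring
  · have i1 := integral_sq_le_of_bound hε hEb hE0
    have i2 := integral_sq_le_of_bound hε hEb' hE0'
    linarith

/-- Pairing a curve `w` in a dual space, vanishing at time `T`, with an approximate eigenvector `η` of
the adjoint generator: the initial value determines the Laplace transform of the control up to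
the error `E`. -/
lemma exists_abs_apply_sub_laplace_le {V : Type*} [NormedAddCommGroup V] [NormedSpace ℝ V] {T : ℝ}
    (hT : 0 < T) {u : ℝ → ℝ} (hu : IntegrableOn u (Ioo 0 T)) {w w' : ℝ → StrongDual ℝ V}
    (hac : AbsolutelyContinuousOnInterval w 0 T)
    (heq : ∀ᵐ t ∂volume.restrict (Ioo 0 T), HasDerivAt w (w' t) t) (hz : w T = 0) :
    ∃ M : ℝ, 0 ≤ M ∧ ∀ {μ c : ℝ} {η E : V}, 0 ≤ μ →
      (∀ t, w' t η = -μ * w t η + w t E - c * u t) →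
      |w 0 η - c * ∫ t in Ioo 0 T, Real.exp (μ * t) * u t|
        ≤ Real.exp (μ * T) * (M * ‖E‖) * T := by
  obtain ⟨M, hM⟩ := hac.exists_bound
  rw [uIcc_of_le hT.le] at hM
  refine ⟨M, (norm_nonneg _).trans (hM 0 ⟨le_rfl, hT.le⟩), fun {μ c η E} hμ hrhs => ?_⟩
  have happ : ∀ ψ : V, AbsolutelyContinuousOnInterval (fun t => w t ψ) 0 T := fun ψ =>
    ac_clm_comp (ContinuousLinearMap.apply ℝ ℝ ψ) hac
  have hexp : AbsolutelyContinuousOnInterval (fun t => Real.exp (μ * t)) 0 T := by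
    have : ContDiff ℝ 1 fun t => Real.exp (μ * t) := by fun_prop
    exact this.contDiffOn.absolutelyContinuousOnInterval
  have hG := hexp.fun_mul (happ η)
  have hder : ∀ᵐ t ∂volume.restrict (Ioo 0 T),
      deriv (fun t => Real.exp (μ * t) * w t η) t
        = Real.exp (μ * t) * w t E - c * (Real.exp (μ * t) * u t) := by
    filter_upwards [heq] with t ht
    have h1 : HasDerivAt (fun t => w t η) (w' t η) t := by
      have := ht.clm_apply (hasDerivAt_const t η)
      simpa using this
    have h2 : HasDerivAt (fun t => Real.exp (μ * t)) (Real.exp (μ * t) * μ) t := by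
      simpa using ((hasDerivAt_id t).const_mul μ).exp
    rw [(h2.fun_mul h1).deriv, hrhs]
    ring
  have hint := hG.integral_deriv_eq_sub
  rw [intervalIntegral.integral_of_le hT.le, integral_Ioc_eq_integral_Ioo,
    integral_congr_ae hder, hz] at hint
  have hcE : ContinuousOn (fun t => Real.exp (μ * t) * w t E) (Icc 0 T) := by
    have h1 := (happ E).continuousOn
    rw [uIcc_of_le hT.le] at h1
    exact (Continuous.continuousOn (by fun_prop)).mul h1
  have i1 : IntegrableOn (fun t => Real.exp (μ * t) * w t E) (Ioo 0 T) :=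
    (hcE.integrableOn_Icc).mono_set Ioo_subset_Icc_self
  have i2 : IntegrableOn (fun t => Real.exp (μ * t) * u t) (Ioo 0 T) := by
    refine Integrable.bdd_mul (c := Real.exp (μ * T)) hu
      (Continuous.aestronglyMeasurable (by fun_prop)) ?_
    filter_upwards [ae_restrict_mem measurableSet_Ioo] with t ht
    rw [Real.norm_eq_abs, Real.abs_exp]
    gcongr
    exact ht.2.le
  rw [integral_sub i1 (i2.const_mul _), integral_const_mul] at hint
  simp only [mul_zero, Real.exp_zero, one_mul, zero_apply] at hint
  have e1 : w 0 η - c * ∫ t in Ioo 0 T, Real.exp (μ * t) * u t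
      = -∫ t in Ioo 0 T, Real.exp (μ * t) * w t E := by linarith
  rw [e1, abs_neg]
  have hb := norm_setIntegral_le_of_norm_le_const (μ := volume) (s := Ioo 0 T)
    (f := fun t => Real.exp (μ * t) * w t E)
    (C := Real.exp (μ * T) * (M * ‖E‖)) (by simp) (fun t ht => by
      rw [norm_mul, Real.norm_eq_abs, Real.abs_exp]
      have h3 : ‖w t E‖ ≤ M * ‖E‖ := ((w t).le_opNorm E).trans
        (mul_le_mul_of_nonneg_right (hM t ⟨ht.1.le, ht.2.le⟩) (norm_nonneg _))
      refine mul_le_mul (Real.exp_le_exp.2 ?_) h3 (norm_nonneg _) (Real.exp_pos _).le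
      gcongr
      exact ht.2.le)
  simpa [Measure.real, Real.volume_Ioo, ENNReal.toReal_ofReal hT.le] using hb

namespace HeatData

variable (d : HeatData)

/-- The constant `2 √((ρk)(0)) ω(0)` in front of the control. -/
noncomputable def controlConst : ℝ := 2 * √(d.ρ 0 * d.k 0) * d.omega 0

lemma controlConst_pos : 0 < d.controlConst := by
  have h1 := d.ρ_pos 0 le_rfl
  have h2 := d.k_pos 0 le_rfl
  have h3 := d.omega_pos 0
  unfold controlConst
  positivity

/-- The generator acts on an approximate eigenfunction by the eigenvalue, up to the error `E` and
the contribution of the control. -/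
lemma rhs_embed_approx_eigen (u : ℝ) (φ : d.H1) {μ : ℝ} {η η' E : TestFn} (h : η.df = η'.f)
    (h0 : η.f 0 = 1) (heig : ∀ y, η'.df y - d.qy y * η.f y = -μ * η.f y + E.f y) :
    d.rhs u φ (d.embed η) = -μ * d.ofL2 (d.val φ) (d.embed η) + d.ofL2 (d.val φ) (d.embed E)
      - d.controlConst * u := by
  have hl : LocallyIntegrable (d.pull (d.val φ)) volume :=
    (d.pull_memLp (d.val φ)).locallyIntegrable (by norm_num)
  rw [rhs_embed _ _ _ _ _ h, h0, mul_one, ofL2_embed, ofL2_embed, ← integral_const_mul,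
    ← integral_add ((integrable_mul_test hl η.cont η.supp).const_mul _)
      (integrable_mul_test hl E.cont E.supp)]
  simp only [heig, controlConst]
  congr 2
  funext y
  ring

/-- For a trajectory that is steered to zero, the generalized Fourier coefficient of the initial
state at a high frequency `ξ` is the Laplace transform of the control at `ξ²`. -/
lemma tendsto_integral_pull {T : ℝ} (hT : 0 < T) {u : ℝ → ℝ} (hu : IntegrableOn u (Ioo 0 T))
    {W : ℝ → d.H1} (hac : AbsolutelyContinuousOnInterval (fun t => d.ofL2 (d.val (W t))) 0 T)
    (heq : ∀ᵐ t ∂volume.restrict (Ioo 0 T),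
      HasDerivAt (fun s => d.ofL2 (d.val (W s))) (d.rhs (u t) (W t)) t)
    (hWT : d.ofL2 (d.val (W T)) = 0) {ξ : ℝ} (S : HighFrequencySolution d.qy ξ)
    {b₀ b₁ b₂ b₃ : ℝ → ℝ} {B : ℝ}
    (d0 : ∀ y, HasDerivAt b₀ (b₁ y) y) (d1 : ∀ y, HasDerivAt b₁ (b₂ y) y)
    (d2 : ∀ y, HasDerivAt b₂ (b₃ y) y) (c3 : Continuous b₃) (hb0 : b₀ 0 = 1)
    (h1 : ∀ y, |b₁ y| ≤ B) (h2 : ∀ y, |b₂ y| ≤ B) (h3 : ∀ y, |b₃ y| ≤ B)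
    (hz : ∀ y, 2 < |y| → b₀ y = 0 ∧ b₁ y = 0 ∧ b₂ y = 0 ∧ b₃ y = 0) :
    Tendsto (fun n : ℕ => ∫ y, d.pull (d.val (W 0)) y * (b₀ (1 / ((n : ℝ) + 1) * y) * S.φ y)) atTop
      (𝓝 (d.controlConst * ∫ t in Ioo 0 T, Real.exp (ξ ^ 2 * t) * u t)) := by
  obtain ⟨C, hC⟩ := d.qy_bounded
  obtain ⟨K, hK⟩ := exists_truncations d.qy_cont hC S d0 d1 d2 c3 h1 h2 h3 hz
  obtain ⟨M, hM0, hM⟩ := exists_abs_apply_sub_laplace_le hT hu hac heq hWT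
  have hbound : ∀ n : ℕ,
      |(∫ y, d.pull (d.val (W 0)) y * (b₀ (1 / ((n : ℝ) + 1) * y) * S.φ y))
        - d.controlConst * ∫ t in Ioo 0 T, Real.exp (ξ ^ 2 * t) * u t|
      ≤ Real.exp (ξ ^ 2 * T) * (M * √(K * (1 / ((n : ℝ) + 1)))) * T := by
    intro n
    have hε : 0 < 1 / ((n : ℝ) + 1) := by positivity
    obtain ⟨η, η', E, e1, e2, e3, e4⟩ := hK _ hε (by
      rw [div_le_one (by positivity)]; linarith [(Nat.cast_nonneg n : (0 : ℝ) ≤ n)])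
    have h0 : η.f 0 = 1 := by rw [e2, mul_zero, hb0, S.map_zero, one_mul]
    have e5 : ∫ y, d.pull (d.val (W 0)) y * (b₀ (1 / ((n : ℝ) + 1) * y) * S.φ y)
        = d.ofL2 (d.val (W 0)) (d.embed η) := by
      rw [ofL2_embed]
      simp only [e2]
    have e6 : ‖d.embed E‖ ≤ √(K * (1 / ((n : ℝ) + 1))) := by
      refine Real.le_sqrt_of_sq_le ?_
      rw [norm_sq_embed]
      exact e4
    rw [e5]
    refine (hM (μ := ξ ^ 2) (c := d.controlConst) (η := d.embed η) (E := d.embed E) (sq_nonneg ξ)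
      (fun t => d.rhs_embed_approx_eigen (u t) (W t) e1 h0 e3)).trans ?_
    exact mul_le_mul_of_nonneg_right (mul_le_mul_of_nonneg_left
      (mul_le_mul_of_nonneg_left e6 hM0) (Real.exp_pos _).le) hT.le
  have hε0 : Tendsto (fun n : ℕ => 1 / ((n : ℝ) + 1)) atTop (𝓝 0) :=
    tendsto_one_div_add_atTop_nhds_zero_nat
  have h4 : Tendsto (fun n : ℕ => Real.exp (ξ ^ 2 * T) * (M * √(K * (1 / ((n : ℝ) + 1)))) * T) atTop
      (𝓝 0) := by
    have := ((((hε0.const_mul K).sqrt).const_mul M).const_mul (Real.exp (ξ ^ 2 * T))).mul_const T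
    simpa only [mul_zero, zero_mul, Real.sqrt_zero] using this
  exact tendsto_iff_norm_sub_tendsto_zero.2 (squeeze_zero (fun _ => norm_nonneg _) hbound h4)

end HeatData

/-! ### Fourier coefficients at high frequencies -/

open scoped FourierTransform

lemma memLp_two_div_one_add_abs : MemLp (fun y : ℝ => 2 / (1 + |y|)) 2 volume := by
  have hc : Continuous fun y : ℝ => 2 / (1 + |y|) :=
    continuous_const.div (by fun_prop) fun y => by positivity
  refine (memLp_two_iff_integrable_sq hc.aestronglyMeasurable).2 ?_
  refine (integrable_inv_one_add_sq.const_mul 4).mono' (hc.pow 2).aestronglyMeasurable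
    (Eventually.of_forall fun y => ?_)
  rw [norm_pow, Real.norm_eq_abs, sq_abs, div_pow, div_eq_mul_inv]
  norm_num
  gcongr
  nlinarith [sq_abs y, abs_nonneg y]

/-- On a half-line `A` a high-frequency solution is a combination of `cos` and `sin` up to a
square-integrable error, so that integration against it is controlled by the Fourier transform. -/
lemma abs_setIntegral_mul_le {A : Set ℝ} (hA : MeasurableSet A) {v w φ : ℝ → ℝ} {s : ℝ}
    (hv : Integrable v) (hvw : ∀ y, |v y| ≤ |w y|) (hw : MemLp w 2 volume) (cφ : Continuous φ)
    (hφb : ∀ y, |φ y| ≤ 2)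
    (hφ : ∃ a b : ℝ, |a| ≤ 2 ∧ |b| ≤ 2 ∧ ∀ y ∈ A,
      |φ y - (a * Real.cos (2 * Real.pi * s * y) + b * Real.sin (2 * Real.pi * s * y))|
        ≤ 2 / (1 + |y|)) :
    |∫ y in A, v y * φ y| ≤ 4 * ‖𝓕 (A.indicator fun y => (v y : ℂ)) s‖
      + ∫ y in A, |w y| * (2 / (1 + |y|)) := by
  obtain ⟨a, b, ha, hb, hab⟩ := hφ
  have hgi : Integrable fun y => |w y| * (2 / (1 + |y|)) :=
    MemLp.integrable_mul hw.abs memLp_two_div_one_add_abs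
  set θ : ℝ → ℝ := fun y =>
    a * Real.cos (2 * Real.pi * s * y) + b * Real.sin (2 * Real.pi * s * y) with hθ
  have cθ : Continuous θ := by fun_prop
  have hθb : ∀ y, |θ y| ≤ 4 := fun y => by
    have h1 : |a * Real.cos (2 * Real.pi * s * y)| ≤ 2 * 1 := by
      rw [abs_mul]; exact mul_le_mul ha (Real.abs_cos_le_one _) (abs_nonneg _) (by norm_num)
    have h2 : |b * Real.sin (2 * Real.pi * s * y)| ≤ 2 * 1 := by
      rw [abs_mul]; exact mul_le_mul hb (Real.abs_sin_le_one _) (abs_nonneg _) (by norm_num)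
    exact (abs_add_le _ _).trans (by linarith)
  have iθ : Integrable fun y => v y * θ y :=
    hv.mul_bdd (c := 4) cθ.aestronglyMeasurable (Eventually.of_forall hθb)
  have iφ : Integrable fun y => v y * φ y :=
    hv.mul_bdd (c := 2) cφ.aestronglyMeasurable (Eventually.of_forall hφb)
  -- `∫ v (a cos + b sin)` is the real part of `(a + bi)` times the Fourier transform.
  have e1 : ∫ y in A, v y * θ y
      = (((a : ℂ) + b * Complex.I) * 𝓕 (A.indicator fun y => (v y : ℂ)) s).re := by
    have hF : Integrable (A.indicator fun y => (v y : ℂ)) := hv.ofReal.indicator hA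
    have hFe : Integrable fun y : ℝ => Complex.exp (↑(-2 * Real.pi * y * s) * Complex.I) •
        A.indicator (fun y => (v y : ℂ)) y := by
      refine hF.bdd_mul (c := 1) (Continuous.aestronglyMeasurable (by fun_prop))
        (Eventually.of_forall fun y => ?_)
      rw [Complex.norm_exp_ofReal_mul_I]
    rw [Real.fourier_real_eq_integral_exp_smul, ← integral_const_mul,
      ← integral_indicator hA, ← Complex.reCLM_apply,
      ← Complex.reCLM.integral_comp_comm (hFe.const_mul _)]
    refine integral_congr_ae (Eventually.of_forall fun y => ?_)
    by_cases hy : y ∈ A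
    · simp only [indicator_of_mem hy, hθ, Complex.reCLM_apply, smul_eq_mul]
      rw [show -2 * Real.pi * y * s = -(2 * Real.pi * s * y) by ring]
      generalize 2 * Real.pi * s * y = c
      rw [Complex.exp_mul_I, ← Complex.ofReal_cos, ← Complex.ofReal_sin, Real.cos_neg, Real.sin_neg]
      simp [-Complex.ofReal_cos, -Complex.ofReal_sin]
      ring
    · simp [indicator_of_notMem hy]
  have e2 : |∫ y in A, v y * θ y| ≤ 4 * ‖𝓕 (A.indicator fun y => (v y : ℂ)) s‖ := by
    rw [e1]
    refine (Complex.abs_re_le_norm _).trans ?_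
    rw [norm_mul]
    refine mul_le_mul_of_nonneg_right ((norm_add_le _ _).trans ?_) (norm_nonneg _)
    simp only [norm_mul, Complex.norm_real, Complex.norm_I, mul_one, Real.norm_eq_abs]
    linarith
  have e3 : |∫ y in A, v y * (φ y - θ y)| ≤ ∫ y in A, |w y| * (2 / (1 + |y|)) := by
    rw [← Real.norm_eq_abs]
    refine norm_integral_le_of_norm_le hgi.integrableOn ?_
    filter_upwards [ae_restrict_mem hA] with y hy
    rw [norm_mul]
    exact mul_le_mul (hvw y) (hab y hy) (norm_nonneg _) (abs_nonneg _)
  have e4 : ∫ y in A, v y * φ y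
      = (∫ y in A, v y * θ y) + ∫ y in A, v y * (φ y - θ y) := by
    have iφθ : Integrable fun y => v y * (φ y - θ y) :=
      (iφ.sub iθ).congr (Eventually.of_forall fun y => by simp only [Pi.sub_apply]; ring)
    rw [← integral_add iθ.integrableOn iφθ.integrableOn]
    refine integral_congr_ae (Eventually.of_forall fun y => ?_)
    simp only; ring
  rw [e4]
  exact (abs_add_le _ _).trans (add_le_add e2 e3)

/-- The two half-lines are treated separately, the amplitudes of the solution at `±∞` being
different. -/
lemma sq_integral_mul_highFrequency_le {V v w : ℝ → ℝ} {s : ℝ}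
    (S : HighFrequencySolution V (2 * Real.pi * s)) (hv : Integrable v)
    (hvw : ∀ y, |v y| ≤ |w y|) (hw : MemLp w 2 volume) :
    (∫ y, v y * S.φ y) ^ 2 ≤ 48 * (‖𝓕 ((Ici 0).indicator fun y => (v y : ℂ)) s‖ ^ 2
      + ‖𝓕 ((Iio 0).indicator fun y => (v y : ℂ)) s‖ ^ 2)
      + 3 * (∫ y, |w y| * (2 / (1 + |y|))) ^ 2 := by
  have cφ : Continuous S.φ := continuous_iff_continuousAt.2 fun x => (S.hasDerivAt x).continuousAt
  have hgi : Integrable fun y => |w y| * (2 / (1 + |y|)) :=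
    MemLp.integrable_mul hw.abs memLp_two_div_one_add_abs
  have iφ : Integrable fun y => v y * S.φ y :=
    hv.mul_bdd (c := 2) cφ.aestronglyMeasurable (Eventually.of_forall S.bound)
  have h1 := abs_setIntegral_mul_le measurableSet_Ici hv hvw hw cφ S.bound S.right
  have h2 := abs_setIntegral_mul_le measurableSet_Iio hv hvw hw cφ S.bound
    (by obtain ⟨a, b, ha, hb, hab⟩ := S.left
        exact ⟨a, b, ha, hb, fun y hy => hab y (le_of_lt hy)⟩)
  have e1 := integral_add_compl (measurableSet_Ici (a := (0 : ℝ))) iφ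
  have e2 := integral_add_compl (measurableSet_Ici (a := (0 : ℝ))) hgi
  rw [compl_Ici] at e1 e2
  rw [← e1, ← e2]
  set F := ‖𝓕 ((Ici 0).indicator fun y => (v y : ℂ)) s‖
  set G := ‖𝓕 ((Iio 0).indicator fun y => (v y : ℂ)) s‖
  set K₁ := ∫ y in Ici 0, |w y| * (2 / (1 + |y|))
  set K₂ := ∫ y in Iio 0, |w y| * (2 / (1 + |y|))
  have h3 := (abs_add_le (∫ y in Ici 0, v y * S.φ y) (∫ y in Iio 0, v y * S.φ y)).trans
    (add_le_add h1 h2)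
  rw [← sq_abs]
  refine (pow_le_pow_left₀ (abs_nonneg _) h3 2).trans ?_
  nlinarith [sq_nonneg (4 * F - 4 * G), sq_nonneg (4 * F - (K₁ + K₂)),
    sq_nonneg (4 * G - (K₁ + K₂))]

/-- Plancherel for the part of a truncated square-integrable function on a set `A`. -/
lemma lintegral_sq_fourier_indicator_le {A : Set ℝ} (hA : MeasurableSet A) {v w : ℝ → ℝ}
    (hv : Integrable v) (hvw : ∀ y, |v y| ≤ |w y|) (hw : MemLp w 2 volume) :
    ∫⁻ s, ENNReal.ofReal (‖𝓕 (A.indicator fun y => (v y : ℂ)) s‖ ^ 2)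
      ≤ eLpNorm w 2 volume ^ 2 := by
  have hle : ∀ y, ‖A.indicator (fun y => (v y : ℂ)) y‖ ≤ ‖w y‖ := fun y => by
    by_cases hy : y ∈ A
    · simpa [indicator_of_mem hy] using hvw y
    · simp [indicator_of_notMem hy]
  have h1 : Integrable (A.indicator fun y => (v y : ℂ)) := hv.ofReal.indicator hA
  have h2 : MemLp (A.indicator fun y => (v y : ℂ)) 2 volume :=
    hw.mono h1.aestronglyMeasurable (Eventually.of_forall hle)
  have e := eLpNorm_fourier_eq h1 h2
  have h3 : eLpNorm (A.indicator fun y => (v y : ℂ)) 2 volume ≤ eLpNorm w 2 volume :=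
    eLpNorm_mono hle
  rw [← e] at h3
  refine le_trans (le_of_eq ?_) (pow_le_pow_left' h3 2)
  rw [eLpNorm_eq_lintegral_rpow_enorm_toReal (by norm_num) (by norm_num),
    ← ENNReal.rpow_natCast, ← ENNReal.rpow_mul]
  norm_num [ENNReal.ofReal_pow]

/-- If `g ξ` is the generalized Fourier coefficient of a square-integrable `w`, then `g (2π ·)²` has
uniformly bounded integrals over windows of a fixed length at high frequencies. -/
lemma exists_window_bound {V : ℝ → ℝ} (hV : Continuous V)
    (hm : Integrable fun y => (1 + |y|) * |V y|) {w : ℝ → ℝ} (hw : MemLp w 2 volume)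
    {b : ℝ → ℝ} (cb : Continuous b) (hb : ∀ y, 0 ≤ b y ∧ b y ≤ 1) (hb0 : ∀ y, 2 < |y| → b y = 0)
    {g : ℝ → ℝ} (hg : ∀ ξ, ∀ S : HighFrequencySolution V ξ,
      Tendsto (fun n : ℕ => ∫ y, w y * (b (1 / ((n : ℝ) + 1) * y) * S.φ y)) atTop (𝓝 (g ξ))) :
    ∃ X C : ℝ, 0 ≤ X ∧ ∀ α β, X ≤ α → α ≤ β → β ≤ α + (2 * Real.pi)⁻¹ →
      ∫ s in α..β, g (2 * Real.pi * s) ^ 2 ≤ C := by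
  have hπ := Real.pi_pos
  set M := ∫ y, (1 + |y|) * |V y|
  have hM : 0 ≤ M := integral_nonneg fun y => by positivity
  set K := ∫ y, |w y| * (2 / (1 + |y|))
  set v : ℕ → ℝ → ℝ := fun n y => w y * b (1 / ((n : ℝ) + 1) * y) with hv
  have hvw : ∀ n y, |v n y| ≤ |w y| := fun n y => by
    rw [hv, abs_mul, abs_of_nonneg (hb _).1]
    exact mul_le_of_le_one_right (abs_nonneg _) (hb _).2
  have hwl : LocallyIntegrable w volume := hw.locallyIntegrable (by norm_num)
  have hvi : ∀ n, Integrable (v n) := fun n => by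
    have hε : 0 < 1 / ((n : ℝ) + 1) := by positivity
    refine integrable_mul_test hwl (by fun_prop) ?_
    refine HasCompactSupport.intro (isCompact_Icc (a := -(2 / (1 / ((n : ℝ) + 1))))
      (b := 2 / (1 / ((n : ℝ) + 1)))) fun y hy => hb0 _ ?_
    by_contra hle
    refine hy (abs_le.1 ?_)
    rw [le_div_iff₀ hε]
    rwa [abs_mul, abs_of_pos hε, not_lt, mul_comm] at hle
  set P : ℕ → ℝ → ℝ := fun n s => ‖𝓕 ((Ici 0).indicator fun y => (v n y : ℂ)) s‖ ^ 2 with hP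
  set N : ℕ → ℝ → ℝ := fun n s => ‖𝓕 ((Iio 0).indicator fun y => (v n y : ℂ)) s‖ ^ 2 with hN
  have hcont : ∀ {A : Set ℝ}, MeasurableSet A → ∀ n,
      Continuous (𝓕 (A.indicator fun y => (v n y : ℂ))) := fun hA n =>
    VectorFourier.fourierIntegral_continuous Real.continuous_fourierChar continuous_inner
      ((hvi n).ofReal.indicator hA)
  have cP : ∀ n, Continuous (P n) := fun n => (hcont measurableSet_Ici n).norm.pow 2
  have cN : ∀ n, Continuous (N n) := fun n => (hcont measurableSet_Iio n).norm.pow 2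
  set L : ℝ≥0∞ := eLpNorm w 2 volume ^ 2 with hL
  have hLtop : L ≠ ⊤ := ENNReal.pow_ne_top hw.2.ne
  set C : ℝ≥0∞ := 48 * (L + L) + ENNReal.ofReal (3 * K ^ 2) * ENNReal.ofReal (2 * Real.pi)⁻¹ with hC
  have hCtop : C ≠ ⊤ := by
    simp only [hC]
    finiteness
  refine ⟨(4 * M + 1) / (2 * Real.pi), C.toReal, by positivity, fun α β hα hαβ hβ => ?_⟩
  -- The solutions are chosen separately for each frequency, so that nothing is known about the
  -- measurability of the coefficients in `s`; Fatou's lemma is applied to their continuous majorants.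
  have hpt : ∀ s ∈ Ioc α β, ENNReal.ofReal (g (2 * Real.pi * s) ^ 2)
      ≤ liminf (fun n => ENNReal.ofReal (48 * (P n s + N n s) + 3 * K ^ 2)) atTop := by
    intro s hs
    have hξ : 4 * M + 1 ≤ 2 * Real.pi * s := by
      have := hα.trans hs.1.le
      rw [div_le_iff₀ (by positivity)] at this
      linarith
    obtain ⟨S⟩ := nonempty_highFrequencySolution hV hm hξ
    have h1 := ENNReal.tendsto_ofReal ((hg _ S).pow 2)
    rw [← h1.liminf_eq]
    refine liminf_le_liminf (Eventually.of_forall fun n => ENNReal.ofReal_le_ofReal ?_)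
    have h2 := sq_integral_mul_highFrequency_le S (hvi n) (hvw n) hw
    simpa only [hv, mul_assoc] using h2
  have hint : ∀ n, ∫⁻ s in Ioc α β, ENNReal.ofReal (48 * (P n s + N n s) + 3 * K ^ 2) ≤ C := by
    intro n
    have e : ∀ s, ENNReal.ofReal (48 * (P n s + N n s) + 3 * K ^ 2)
        = 48 * (ENNReal.ofReal (P n s) + ENNReal.ofReal (N n s)) + ENNReal.ofReal (3 * K ^ 2) := by
      intro s
      have p1 : 0 ≤ P n s := by positivity
      have p2 : 0 ≤ N n s := by positivity
      rw [ENNReal.ofReal_add (by positivity) (by positivity), ENNReal.ofReal_mul (by norm_num),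
        ENNReal.ofReal_add p1 p2]
      norm_num
    have mP : Measurable fun s => ENNReal.ofReal (P n s) := (cP n).measurable.ennreal_ofReal
    have mN : Measurable fun s => ENNReal.ofReal (N n s) := (cN n).measurable.ennreal_ofReal
    simp only [e]
    rw [lintegral_add_right _ measurable_const, lintegral_const_mul _ (by fun_prop),
      lintegral_add_left mP, setLIntegral_const, Real.volume_Ioc, hC]
    gcongr
    · exact (setLIntegral_le_lintegral _ _).trans
        (lintegral_sq_fourier_indicator_le measurableSet_Ici (hvi n) (hvw n) hw)
    · exact (setLIntegral_le_lintegral _ _).trans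
        (lintegral_sq_fourier_indicator_le measurableSet_Iio (hvi n) (hvw n) hw)
    · linarith
  have hmain : ∫⁻ s in Ioc α β, ENNReal.ofReal (g (2 * Real.pi * s) ^ 2) ≤ C := by
    calc _ ≤ ∫⁻ s in Ioc α β,
          liminf (fun n => ENNReal.ofReal (48 * (P n s + N n s) + 3 * K ^ 2)) atTop :=
          setLIntegral_mono' measurableSet_Ioc hpt
      _ ≤ liminf (fun n => ∫⁻ s in Ioc α β,
          ENNReal.ofReal (48 * (P n s + N n s) + 3 * K ^ 2)) atTop :=
          lintegral_liminf_le fun n =>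
            (Continuous.measurable (by have := cP n; have := cN n; fun_prop)).ennreal_ofReal
      _ ≤ C := liminf_le_of_le (by isBoundedDefault) fun c hc => by
          obtain ⟨n, hn⟩ := hc.exists
          exact hn.trans (hint n)
  rw [intervalIntegral.integral_of_le hαβ]
  refine (Real.le_norm_self _).trans ((norm_integral_le_lintegral_norm _).trans ?_)
  refine ENNReal.toReal_mono hCtop ?_
  simpa only [norm_pow, Real.norm_eq_abs, sq_abs] using hmain

namespace HeatData

variable (d : HeatData)

/-- Only the zero control can steer a trajectory to zero. -/
lemma control_eq_zero {T : ℝ} (hT : 0 < T) {u : ℝ → ℝ}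
    (hu : MemLp u ∞ (volume.restrict (Ioo 0 T)))
    {W : ℝ → d.H1} (hac : AbsolutelyContinuousOnInterval (fun t => d.ofL2 (d.val (W t))) 0 T)
    (heq : ∀ᵐ t ∂volume.restrict (Ioo 0 T),
      HasDerivAt (fun s => d.ofL2 (d.val (W s))) (d.rhs (u t) (W t)) t)
    (hWT : d.ofL2 (d.val (W T)) = 0) : u =ᵐ[volume.restrict (Ioo 0 T)] 0 := by
  have hui : IntegrableOn u (Ioo 0 T) := hu.integrable (by simp)
  obtain ⟨b₀, b₁, b₂, b₃, B, d0, d1, d2, c3, hb, hb0, h1, h2, h3, hz⟩ := exists_cutoff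
  have cb : Continuous b₀ := continuous_iff_continuousAt.2 fun x => (d0 x).continuousAt
  obtain ⟨X, C, hX, hXC⟩ := exists_window_bound d.qy_cont d.qy_moment (d.pull_memLp (d.val (W 0))) cb
    hb (fun y hy => (hz y hy).1) fun ξ S =>
      d.tendsto_integral_pull hT hui hac heq hWT S d0 d1 d2 c3 hb0 h1 h2 h3 hz
  have hκ := d.controlConst_pos
  refine ae_eq_zero_of_laplace_eq_zero hu fun z =>
    laplace_eq_zero_of_window_bound (c := 2 * Real.pi) (C := C / d.controlConst ^ 2) hT.le hui
      (by positivity) hX (fun α β h₁ h₂ h₃ => ?_) z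
  have h := hXC α β h₁ h₂ h₃
  simp only [mul_pow d.controlConst] at h
  rwa [intervalIntegral.integral_const_mul, mul_comm, ← le_div_iff₀ (by positivity)] at h

end HeatData

end HeatControl

theorem mainTheorem2 (d : HeatControl.HeatData) (T : ℝ) (hT : 0 < T) (W0 : d.H1even)
    (hW0 : d.IsControllableTo T W0 0) : W0 = 0 := by
  obtain ⟨u, hu, W, hsol, -, hWT⟩ := hW0
  have hWT' : (W T : d.H1) = 0 := by rw [hWT]; rfl
  have hu0 := d.control_eq_zero (W := fun t => (W t : d.H1)) hT hu hsol.ac hsol.eqn (by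
    rw [hWT', map_zero]
    simp [HeatControl.HeatData.ofL2])
  have h0 := d.backward_uniqueness (W := fun t => (W t : d.H1)) hT.le hsol.ac (by
    rw [← ae_restrict_iff' measurableSet_Ioo]
    filter_upwards [hsol.eqn, hu0] with t h1 h2
    rwa [h2] at h1) hWT'
  rw [← hsol.init]
  exact Subtype.ext h0
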